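/- **Setting.** All Hilbert spaces are complex, with inner products linear in the second argument, and $\otimes$ is the Hilbert space tensor product. Let $\mathsf k$ be a Hilbert space, let $\mathcal F_J$ be the symmetric Fock space over $L^2(J;\mathsf k)$ for $J\subset\mathbb R_+$, and let $\mathcal F=\mathcal F_{\mathbb R_+}$, with normalised exponential vectors $\varpi(f)=e^{-\|f\|^2/2}\big((n!)^{-1/2}f^{\otimes n}\big)_{n\ge0}$ and Weyl operators $W(f):\varpi(g)\mapsto e^{-i\,\mathrm{Im}\langle f,g\rangle}\varpi(f+g)$. Identify $\mathcal F=\mathcal F_{[0,t[}\otimes\mathcal F_{[t,\infty[}$ through $\varpi(f)\mapsto\varpi(f|_{[0,t[})\otimes\varpi(f|_{[t,\infty[})$. For $x\in\mathsf k$ let $x_{[0,t[}\in L^2(\mathbb R_+;\mathsf k)$ be the function equal to $x$ on $[0,t[$ and $0$ elsewhere. For a vector $e$ write $E_e:u\mapsto u\otimes e$ and $E^e=(E_e)^*$. Let $V$ be an operator space in $B(\mathsf h;\mathsf h')$, i.e. a norm closed subspace, where $\mathsf h,\mathsf h'$ are Hilbert spaces. For a Hilbert space $\mathsf H$ put $V\otimes_M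 B(\mathsf H)=\{T\in B(\mathsf h\otimes\mathsf H;\mathsf h'\otimes\mathsf H): E^xTE_y\in V\ \forall x,y\in\mathsf H\}$. For a completely bounded map $\phi$ on $V$, $\phi\otimes_M\mathrm{id}_{B(\mathsf H)}$ is the unique map on $V\otimes_M B(\mathsf H)$ with $E^x(\phi\otimes_M\mathrm{id}_{B(\mathsf H)})(T)E_y=\phi(E^xTE_y)$ for all $x,y\in\mathsf H$ and all $T$. For a set $I$, with $(\delta^\alpha)_{\alpha\in I}$ the standard basis of $l^2(I)$, $V\otimes_M B(l^2(I))$ is identified with $M_I(V)_{\mathrm{bd}}$ through $T\mapsto[E^{\delta^\alpha}TE_{\delta^\beta}]_{\alpha,\beta}$. The shift $\sigma_r$ ($r\ge0$) maps an operator on $\mathsf h\otimes\mathcal F$ (or from $\mathsf h\otimes\mathcal F$ to $\mathsf h'\otimes\mathcal F$) to the operator obtained by transporting it to $\mathcal F_{[r,\infty[}$ through the right shift by $r$ on $L^2(\mathbb R_+;\mathsf k)$ and tensoring with the identity operator of $\mathcal F_{[0,r[}$. A *QS cocycle on $V$* is a family of completely bounded maps $k_t:V\to V\otimes_M B(\mathcal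 F)$ ($t\ge0$) such that $k_t(a)\in V\otimes_M B(\mathcal F_{[0,t[})\otimes I_{[t,\infty[}$ for all $t$ and $a$, $k_0(a)=a\otimes I_{\mathcal F}$, and $k_{r+t}=\hat k_r\circ\sigma_r\circ k_t$ for all $r,t\ge0$, where $\hat k_r=k_r\otimes_M\mathrm{id}_{B(\mathcal F_{[r,\infty[})}$ with $k_r$ regarded as a map into $V\otimes_M B(\mathcal F_{[0,r[})$. Its *associated semigroups* $\mathcal P^{x,y}$, $x,y\in\mathsf k$, are given by $\mathcal P^{x,y}_t(a)=(E_{\varpi(x_{[0,t[})})^*\,k_t(a)\,E_{\varpi(y_{[0,t[})}$; $\mathcal P^{0,0}$ is its *expectation semigroup*. A *left* (resp. *right*) *QS cocycle on a Hilbert space* $\mathsf h$ is a family of bounded operators $X_t\in B(\mathsf h\otimes\mathcal F_{[0,t[})\otimes I_{[t,\infty[}$ ($t\ge0$) with $X_0=I$ and $X_{r+t}=X_r\sigma_r(X_t)$ (resp. $X_{r+t}=\sigma_r(X_t)X_r$) for all $r,t\ge0$. Its associated semigroups are $X^{x,y}_t=(E_{\varpi(x_{[0,t[})})^*X_tE_{\varpi(y_{[0,t[})}$,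 $x,y\in\mathsf k$. **Proposition.** Let $\Gamma:I\to\mathsf k$ be a map on a set $I$, let $W^\Gamma_t$ ($t\ge0$) be the operator on $l^2(I)\otimes\mathcal F$ determined by $\delta^\alpha\otimes\xi\mapsto\delta^\alpha\otimes W(\Gamma(\alpha)_{[0,t[})\xi$, and let $k$ be a QS cocycle on an operator space $V$ in $B(\mathsf h;\mathsf h')$ with associated semigroups $\mathcal P^{x,y}$. Then every $W^\Gamma_t$ is unitary, and: (a) $W^\Gamma$ is a strongly continuous left QS cocycle on $l^2(I)$. (b) $W^\Gamma$ is also a right QS cocycle on $l^2(I)$. (c) For all $x,y\in\mathsf k$, the associated semigroup $\big((W^\Gamma)^{x,y}_t\big)_{t\ge0}$ on $l^2(I)$ is a one-parameter semigroup, and it is norm continuous if and only if $\Gamma$ is bounded. (d) Let $k^{l^2(I)}_t:V\otimes_MB(l^2(I))\to V\otimes_MB(l^2(I)\otimes\mathcal F)$ be the lifting $k_t\otimes_M\mathrm{id}_{B(l^2(I))}$ followed by the tensor flip of $\mathcal F$ and $l^2(I)$. The maps $$K^\Gamma_t:=(I_{\mathsf h'}\otimes W^\Gamma_t)^*\,k^{l^2(I)}_t(\cdot)\,(I_{\mathsf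 h}\otimes W^\Gamma_t),\qquad t\ge0,$$ form a QS cocycle on $V\otimes_MB(l^2(I))=M_I(V)_{\mathrm{bd}}$, and its expectation semigroup is the one-parameter semigroup with Schur action $$[a^\alpha_\beta]_{\alpha,\beta\in I}\mapsto\big[\mathcal P^{\Gamma(\alpha),\Gamma(\beta)}_t(a^\alpha_\beta)\big]_{\alpha,\beta\in I},\qquad t\ge0.$$ -/

import Mathlib

open scoped TensorProduct InnerProductSpace NNReal ENNReal

noncomputable section

namespace QS

universe u

set_option linter.unusedSectionVars false

/-! ### Extension from total families -/

/-- A family of vectors is total if its linear span is dense. -/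
def IsTotal {X H : Type*} [NormedAddCommGroup H] [InnerProductSpace ℂ H] (a : X → H) : Prop :=
  Dense (Submodule.span ℂ (Set.range a) : Set H)

section Extension

variable {X H K : Type*} [NormedAddCommGroup H] [InnerProductSpace ℂ H]
  [NormedAddCommGroup K] [InnerProductSpace ℂ K]

theorem IsTotal.denseRange {a : X → H} (ha : IsTotal a) :
    DenseRange (Finsupp.linearCombination ℂ a) := by
  unfold IsTotal at ha
  rw [← Finsupp.range_linearCombination] at ha
  exact ha

theorem norm_linearCombination_eq {a : X → H} {b : X → K}
    (hab : ∀ x y, ⟪b x, b y⟫_ℂ = ⟪a x, a y⟫_ℂ) (c : X →₀ ℂ) :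
    ‖Finsupp.linearCombination ℂ b c‖ = ‖Finsupp.linearCombination ℂ a c‖ := by
  have h : ⟪Finsupp.linearCombination ℂ b c, Finsupp.linearCombination ℂ b c⟫_ℂ
      = ⟪Finsupp.linearCombination ℂ a c, Finsupp.linearCombination ℂ a c⟫_ℂ := by
    simp only [Finsupp.linearCombination_apply, Finsupp.sum_inner, Finsupp.inner_sum,
      inner_smul_left, inner_smul_right, hab]
  rw [inner_self_eq_norm_sq_to_K, inner_self_eq_norm_sq_to_K] at h
  have h2 : ‖Finsupp.linearCombination ℂ b c‖ ^ 2 = ‖Finsupp.linearCombination ℂ a c‖ ^ 2 := by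
    exact_mod_cast h
  exact (sq_eq_sq₀ (norm_nonneg _) (norm_nonneg _)).1 h2

/-- The isometry determined by continuous linear extension of the prescription `a x ↦ b x`,
where `a` is total and inner products are preserved. -/
def isometryOfTotal [CompleteSpace K] (a : X → H) (b : X → K) (ha : IsTotal a)
    (hab : ∀ x y, ⟪b x, b y⟫_ℂ = ⟪a x, a y⟫_ℂ) : H →ₗᵢ[ℂ] K where
  toLinearMap := ((Finsupp.linearCombination ℂ b).extendOfNorm
    (Finsupp.linearCombination ℂ a) : H →L[ℂ] K)
  norm_map' := by
    refine ha.denseRange.induction ?_ (isClosed_eq (by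
      simp only [ContinuousLinearMap.coe_coe]; fun_prop) continuous_norm)
    rintro _ ⟨c, rfl⟩
    simp only [ContinuousLinearMap.coe_coe]
    rw [LinearMap.extendOfNorm_eq ha.denseRange
      ⟨1, fun x => by rw [one_mul, norm_linearCombination_eq hab]⟩,
      norm_linearCombination_eq hab]

theorem isometryOfTotal_apply [CompleteSpace K] (a : X → H) (b : X → K) (ha : IsTotal a)
    (hab : ∀ x y, ⟪b x, b y⟫_ℂ = ⟪a x, a y⟫_ℂ) (x : X) :
    isometryOfTotal a b ha hab (a x) = b x := by
  have h := LinearMap.extendOfNorm_eq (f := Finsupp.linearCombination ℂ b) ha.denseRange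
      ⟨1, fun x => by rw [one_mul, norm_linearCombination_eq hab]⟩ (Finsupp.single x 1)
  rw [Finsupp.linearCombination_single, Finsupp.linearCombination_single, one_smul, one_smul] at h
  exact h

end Extension

/-! ### Hilbert space tensor products -/

/-- The Hilbert space tensor product: the completion of the algebraic tensor product. -/
def HTensor (H K : Type*) [NormedAddCommGroup H] [InnerProductSpace ℂ H]
    [NormedAddCommGroup K] [InnerProductSpace ℂ K] : Type _ :=
  UniformSpace.Completion (H ⊗[ℂ] K)

infixl:70 " ⊗ₕ " => HTensor

section Tensor

variable {H K L : Type*} [NormedAddCommGroup H] [InnerProductSpace ℂ H]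
  [NormedAddCommGroup K] [InnerProductSpace ℂ K]
  [NormedAddCommGroup L] [InnerProductSpace ℂ L]

instance : NormedAddCommGroup (H ⊗ₕ K) :=
  inferInstanceAs (NormedAddCommGroup (UniformSpace.Completion (H ⊗[ℂ] K)))

instance : InnerProductSpace ℂ (H ⊗ₕ K) :=
  inferInstanceAs (InnerProductSpace ℂ (UniformSpace.Completion (H ⊗[ℂ] K)))

instance : CompleteSpace (H ⊗ₕ K) :=
  inferInstanceAs (CompleteSpace (UniformSpace.Completion (H ⊗[ℂ] K)))

/-- The algebraic tensor product inside the Hilbert space tensor product. -/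
def HTensor.incl : (H ⊗[ℂ] K) →L[ℂ] H ⊗ₕ K :=
  (UniformSpace.Completion.toComplL : (H ⊗[ℂ] K) →L[ℂ] UniformSpace.Completion (H ⊗[ℂ] K))

/-- Elementary tensors. -/
def tmul (u : H) (e : K) : H ⊗ₕ K := HTensor.incl (u ⊗ₜ[ℂ] e)

theorem HTensor.denseRange_incl : DenseRange (HTensor.incl : (H ⊗[ℂ] K) →L[ℂ] H ⊗ₕ K) :=
  UniformSpace.Completion.denseRange_coe

theorem HTensor.inner_incl (x y : H ⊗[ℂ] K) :
    ⟪HTensor.incl x, HTensor.incl y⟫_ℂ = ⟪x, y⟫_ℂ :=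
  UniformSpace.Completion.inner_coe x y

theorem HTensor.norm_incl (x : H ⊗[ℂ] K) : ‖HTensor.incl x‖ = ‖x‖ :=
  UniformSpace.Completion.norm_coe x

theorem inner_tmul (u v : H) (e d : K) :
    ⟪tmul u e, tmul v d⟫_ℂ = ⟪u, v⟫_ℂ * ⟪e, d⟫_ℂ := by
  simp [tmul, HTensor.inner_incl]

/-- The operator `E_e = I ⊗ |e⟩ : u ↦ u ⊗ e`; its adjoint is `E^e`. -/
def ket (H : Type*) [NormedAddCommGroup H] [InnerProductSpace ℂ H] (e : K) : H →L[ℂ] H ⊗ₕ K :=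
  HTensor.incl ∘L (TensorProduct.mkL ℂ H K).flip e

@[simp] theorem ket_apply (u : H) (e : K) : ket H e u = tmul u e := rfl

theorem tmul_add (u : H) (e d : K) : tmul u (e + d) = tmul u e + tmul u d := by
  simp [tmul, TensorProduct.tmul_add]

theorem add_tmul (u v : H) (e : K) : tmul (u + v) e = tmul u e + tmul v e := by
  simp [tmul, TensorProduct.add_tmul]

theorem isTotal_tmul {X Y : Type*} {a : X → H} {b : Y → K} (ha : IsTotal a) (hb : IsTotal b) :
    IsTotal (fun p : X × Y => tmul (a p.1) (b p.2)) := by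
  set S : Submodule ℂ (H ⊗ₕ K) :=
    (Submodule.span ℂ (Set.range fun p : X × Y => tmul (a p.1) (b p.2))).topologicalClosure with hS
  have hcl : IsClosed (S : Set (H ⊗ₕ K)) := Submodule.isClosed_topologicalClosure _
  have h1 : ∀ x (e : K), tmul (a x) e ∈ S := by
    intro x e
    have hc : Continuous fun e : K => tmul (a x) e :=
      (HTensor.incl ∘L (TensorProduct.mkL ℂ H K (a x))).continuous
    refine hb.induction (P := fun e => tmul (a x) e ∈ S) (fun e he => ?_) (hcl.preimage hc) e
    have : Submodule.span ℂ (Set.range b) ≤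
        S.comap (HTensor.incl ∘L (TensorProduct.mkL ℂ H K (a x))).toLinearMap := by
      rw [Submodule.span_le]
      rintro _ ⟨y, rfl⟩
      exact Submodule.le_topologicalClosure _ (Submodule.subset_span ⟨(x, y), rfl⟩)
    exact this he
  have h2 : ∀ (u : H) (e : K), tmul u e ∈ S := by
    intro u e
    have hc : Continuous fun u : H => tmul u e := (ket H e).continuous
    refine ha.induction (P := fun u => tmul u e ∈ S) (fun u hu => ?_) (hcl.preimage hc) u
    have : Submodule.span ℂ (Set.range a) ≤ S.comap (ket H e).toLinearMap := by
      rw [Submodule.span_le]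
      rintro _ ⟨y, rfl⟩
      exact h1 y e
    exact this hu
  have h3 : ∀ z : H ⊗ₕ K, z ∈ S := by
    intro z
    refine HTensor.denseRange_incl.induction (P := fun z => z ∈ S) ?_ hcl z
    rintro _ ⟨w, rfl⟩
    induction w with
    | zero => simp
    | tmul u e => exact h2 u e
    | add x y hx hy => rw [map_add]; exact S.add_mem hx hy
  intro z
  have := h3 z
  rwa [hS, ← SetLike.mem_coe, Submodule.topologicalClosure_coe] at this

theorem isTotal_id : IsTotal (fun u : H => u) := by
  intro z
  exact subset_closure (Submodule.subset_span ⟨z, rfl⟩)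

/-- The tensor product `S ⊗ T` of bounded operators. -/
def opTensor {H' K' : Type*} [NormedAddCommGroup H'] [InnerProductSpace ℂ H']
    [NormedAddCommGroup K'] [InnerProductSpace ℂ K'] (S : H →L[ℂ] H') (T : K →L[ℂ] K') :
    H ⊗ₕ K →L[ℂ] H' ⊗ₕ K' :=
  (HTensor.incl ∘L TensorProduct.mapL S T).extend HTensor.incl

@[simp] theorem opTensor_tmul {H' K' : Type*} [NormedAddCommGroup H'] [InnerProductSpace ℂ H']
    [NormedAddCommGroup K'] [InnerProductSpace ℂ K'] (S : H →L[ℂ] H') (T : K →L[ℂ] K')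
    (u : H) (e : K) : opTensor S T (tmul u e) = tmul (S u) (T e) := by
  unfold opTensor tmul
  rw [ContinuousLinearMap.extend_eq _ HTensor.denseRange_incl]
  · simp
  · exact UniformSpace.Completion.isUniformInducing_coe _

theorem isTotal_tmul_three (H K L : Type*) [NormedAddCommGroup H] [InnerProductSpace ℂ H]
    [NormedAddCommGroup K] [InnerProductSpace ℂ K]
    [NormedAddCommGroup L] [InnerProductSpace ℂ L] :
    IsTotal (fun p : (H × K) × L => tmul (tmul p.1.1 p.1.2) p.2) := by
  have h : IsTotal (fun p : H × K => tmul p.1 p.2) :=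
    isTotal_tmul (a := fun u : H => u) (b := fun e : K => e) isTotal_id isTotal_id
  exact isTotal_tmul (a := fun p : H × K => tmul p.1 p.2) (b := fun d : L => d) h isTotal_id

/-- The associativity isometry `(H ⊗ K) ⊗ L → H ⊗ (K ⊗ L)`. -/
def assoc (H K L : Type*) [NormedAddCommGroup H] [InnerProductSpace ℂ H]
    [NormedAddCommGroup K] [InnerProductSpace ℂ K]
    [NormedAddCommGroup L] [InnerProductSpace ℂ L] : (H ⊗ₕ K) ⊗ₕ L →ₗᵢ[ℂ] H ⊗ₕ (K ⊗ₕ L) :=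
  isometryOfTotal (fun p : (H × K) × L => tmul (tmul p.1.1 p.1.2) p.2)
    (fun p => tmul p.1.1 (tmul p.1.2 p.2)) (isTotal_tmul_three H K L)
    (fun _ _ => by rw [inner_tmul, inner_tmul, inner_tmul, inner_tmul, mul_assoc])

theorem assoc_tmul (u : H) (e : K) (d : L) :
    assoc H K L (tmul (tmul u e) d) = tmul u (tmul e d) :=
  isometryOfTotal_apply (fun p : (H × K) × L => tmul (tmul p.1.1 p.1.2) p.2) _ _ _ ((u, e), d)

/-- The flip `(H ⊗ K) ⊗ L → (H ⊗ L) ⊗ K` of the last two tensor factors. -/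
def flip (H K L : Type*) [NormedAddCommGroup H] [InnerProductSpace ℂ H]
    [NormedAddCommGroup K] [InnerProductSpace ℂ K]
    [NormedAddCommGroup L] [InnerProductSpace ℂ L] : (H ⊗ₕ K) ⊗ₕ L →ₗᵢ[ℂ] (H ⊗ₕ L) ⊗ₕ K :=
  isometryOfTotal (fun p : (H × K) × L => tmul (tmul p.1.1 p.1.2) p.2)
    (fun p => tmul (tmul p.1.1 p.2) p.1.2) (isTotal_tmul_three H K L)
    (fun _ _ => by rw [inner_tmul, inner_tmul, inner_tmul, inner_tmul, mul_right_comm])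

theorem flip_tmul (u : H) (e : K) (d : L) :
    flip H K L (tmul (tmul u e) d) = tmul (tmul u d) e :=
  isometryOfTotal_apply (fun p : (H × K) × L => tmul (tmul p.1.1 p.1.2) p.2) _ _ _ ((u, e), d)

end Tensor

/-! ### Symmetric Fock space -/

/-- A bundled complex inner product space. -/
structure InnerSp : Type (u + 1) where
  carrier : Type u
  [nacg : NormedAddCommGroup carrier]
  [ips : InnerProductSpace ℂ carrier]

attribute [instance] InnerSp.nacg InnerSp.ips

section Fock

variable (H : Type u) [NormedAddCommGroup H] [InnerProductSpace ℂ H]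

/-- The algebraic tensor powers of `H`: a copy of `ℂ` for `n = 0`, then `H ⊗ (H^{⊗ n})`. -/
def tensorPow : ℕ → InnerSp.{u}
  | 0 => ⟨EuclideanSpace ℂ PUnit.{u + 1}⟩
  | n + 1 => ⟨H ⊗[ℂ] (tensorPow n).carrier⟩

variable {H} in
/-- The vector `u^{⊗ n}`. -/
def powVec (u : H) : (n : ℕ) → (tensorPow H n).carrier
  | 0 => (EuclideanSpace.single PUnit.unit 1 : EuclideanSpace ℂ PUnit.{u + 1})
  | n + 1 => (u ⊗ₜ[ℂ] powVec u n : H ⊗[ℂ] (tensorPow H n).carrier)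

variable {H} in
theorem inner_powVec (u v : H) (n : ℕ) : ⟪powVec u n, powVec v n⟫_ℂ = ⟪u, v⟫_ℂ ^ n := by
  induction n with
  | zero =>
    change ⟪(EuclideanSpace.single PUnit.unit 1 : EuclideanSpace ℂ PUnit.{u + 1}),
      EuclideanSpace.single PUnit.unit 1⟫_ℂ = _
    simp
  | succ n ih =>
    change ⟪(u ⊗ₜ[ℂ] powVec u n : H ⊗[ℂ] (tensorPow H n).carrier), v ⊗ₜ[ℂ] powVec v n⟫_ℂ = _
    rw [TensorProduct.inner_tmul, ih, pow_succ']

variable {H} in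
theorem powVec_smul (c : ℂ) (u : H) (n : ℕ) : powVec (c • u) n = c ^ n • powVec u n := by
  induction n with
  | zero => rw [pow_zero, one_smul]; rfl
  | succ n ih =>
    change (c • u) ⊗ₜ[ℂ] powVec (c • u) n = c ^ (n + 1) • (u ⊗ₜ[ℂ] powVec u n)
    rw [ih, TensorProduct.tmul_smul, ← TensorProduct.smul_tmul', smul_smul, pow_succ]

/-- The algebraic symmetric tensors: the span of the vectors `u^{⊗ n}`. -/
def symTensors (n : ℕ) : Submodule ℂ (tensorPow H n).carrier :=
  Submodule.span ℂ (Set.range fun u : H => powVec u n)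

/-- The `n`-th symmetric tensor power of `H`: the closed span of the vectors `u^{⊗ n}`. -/
def SymPow (n : ℕ) : Type u := UniformSpace.Completion (symTensors H n)

instance (n : ℕ) : NormedAddCommGroup (SymPow H n) :=
  inferInstanceAs (NormedAddCommGroup (UniformSpace.Completion (symTensors H n)))

instance (n : ℕ) : InnerProductSpace ℂ (SymPow H n) :=
  inferInstanceAs (InnerProductSpace ℂ (UniformSpace.Completion (symTensors H n)))

instance (n : ℕ) : CompleteSpace (SymPow H n) :=
  inferInstanceAs (CompleteSpace (UniformSpace.Completion (symTensors H n)))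

/-- The algebraic symmetric tensors inside the symmetric tensor power. -/
def symIncl (n : ℕ) : symTensors H n →L[ℂ] SymPow H n :=
  (UniformSpace.Completion.toComplL :
    symTensors H n →L[ℂ] UniformSpace.Completion (symTensors H n))

variable {H} in
/-- `u^{⊗ n}` in the symmetric tensor power. -/
def symVec (u : H) (n : ℕ) : SymPow H n :=
  symIncl H n ⟨powVec u n, Submodule.subset_span ⟨u, rfl⟩⟩

variable {H} in
theorem inner_symVec (u v : H) (n : ℕ) : ⟪symVec u n, symVec v n⟫_ℂ = ⟪u, v⟫_ℂ ^ n :=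
  (UniformSpace.Completion.inner_coe _ _).trans (inner_powVec u v n)

variable {H} in
theorem symVec_smul (c : ℂ) (u : H) (n : ℕ) : symVec (c • u) n = c ^ n • symVec u n := by
  rw [symVec, symVec, ← map_smul]
  congr 1
  exact Subtype.ext (powVec_smul c u n)

variable {H} in
theorem isTotal_symVec (n : ℕ) : IsTotal (fun u : H => symVec u n) := by
  have hd : DenseRange (symIncl H n) := UniformSpace.Completion.denseRange_coe
  refine hd.mono ?_
  rintro _ ⟨⟨z, hz⟩, rfl⟩
  have key : ∀ z (hz : z ∈ symTensors H n), symIncl H n ⟨z, hz⟩ ∈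
      Submodule.span ℂ (Set.range fun u : H => symVec u n) := by
    intro z hz
    induction hz using Submodule.span_induction with
    | mem x hx =>
      obtain ⟨u, rfl⟩ := hx
      exact Submodule.subset_span ⟨u, rfl⟩
    | zero => exact (symIncl H n).map_zero ▸ Submodule.zero_mem _
    | add x y hx hy h1 h2 =>
      have := Submodule.add_mem _ h1 h2
      rwa [← map_add] at this
    | smul c x hx h =>
      have := Submodule.smul_mem _ c h
      rwa [← map_smul] at this
  exact key z hz

/-- The symmetric Fock space over `H`: the Hilbert space direct sum of its symmetric
tensor powers. -/
def Fock : Type u := lp (fun n : ℕ => SymPow H n) 2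

instance : NormedAddCommGroup (Fock H) :=
  inferInstanceAs (NormedAddCommGroup (lp (fun n : ℕ => SymPow H n) 2))

instance : InnerProductSpace ℂ (Fock H) :=
  inferInstanceAs (InnerProductSpace ℂ (lp (fun n : ℕ => SymPow H n) 2))

instance : CompleteSpace (Fock H) :=
  inferInstanceAs (CompleteSpace (lp (fun n : ℕ => SymPow H n) 2))

variable {H}

theorem norm_symVec (u : H) (n : ℕ) : ‖symVec u n‖ = ‖u‖ ^ n := by
  have h := inner_symVec u u n
  have h1 : ⟪symVec u n, symVec u n⟫_ℂ = (‖symVec u n‖ : ℂ) ^ 2 := inner_self_eq_norm_sq_to_K _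
  have h3 : ⟪u, u⟫_ℂ = (‖u‖ : ℂ) ^ 2 := inner_self_eq_norm_sq_to_K _
  rw [h1, h3] at h
  have h2 : ‖symVec u n‖ ^ 2 = (‖u‖ ^ n) ^ 2 := by
    rw [← pow_mul, mul_comm, pow_mul]
    exact_mod_cast h
  exact (sq_eq_sq₀ (norm_nonneg _) (by positivity)).1 h2

theorem hasSum_inner_lp (f g : lp (fun n : ℕ => SymPow H n) 2) :
    HasSum (fun n => ⟪f n, g n⟫_ℂ) ⟪f, g⟫_ℂ := lp.hasSum_inner f g

/-- The component of a Fock space vector in the `n`-th symmetric tensor power. -/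
def Fock.coord (f : Fock H) (n : ℕ) : SymPow H n :=
  (show lp (fun n : ℕ => SymPow H n) 2 from f) n

theorem hasSum_inner_fock (f g : Fock H) :
    HasSum (fun n => ⟪f.coord n, g.coord n⟫_ℂ) ⟪f, g⟫_ℂ := hasSum_inner_lp f g

theorem Fock.ext_zero (f : Fock H) (h : ∀ n, f.coord n = 0) : f = 0 := by
  have : (show lp (fun n : ℕ => SymPow H n) 2 from f) = 0 := lp.ext (funext h)
  exact this

theorem memlp_expSeq (u : H) :
    Memℓp (fun n => ((Real.sqrt (n.factorial : ℝ))⁻¹ : ℂ) • symVec u n) 2 := by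
  refine memℓp_gen ?_
  have h := Real.summable_pow_div_factorial (‖u‖ ^ 2)
  refine h.congr fun n => ?_
  rw [norm_smul, norm_symVec, norm_inv, Complex.norm_real, Real.norm_eq_abs,
    abs_of_nonneg (Real.sqrt_nonneg _)]
  simp only [ENNReal.toReal_ofNat, Real.rpow_ofNat]
  rw [mul_pow, inv_pow, Real.sq_sqrt (by positivity)]
  ring

/-- The unnormalised exponential vector `((n!)^{-1/2} u^{⊗ n})_n`. -/
def expSeq (u : H) : Fock H :=
  (⟨fun n => ((Real.sqrt (n.factorial : ℝ))⁻¹ : ℂ) • symVec u n, memlp_expSeq u⟩ :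
    lp (fun n : ℕ => SymPow H n) 2)

theorem coord_expSeq (u : H) (n : ℕ) :
    (expSeq u).coord n = ((Real.sqrt (n.factorial : ℝ))⁻¹ : ℂ) • symVec u n := rfl

/-- The normalised exponential vector
`ϖ(u) = exp (-‖u‖²/2) ((n!)^{-1/2} u^{⊗ n})_n`. -/
def coh (u : H) : Fock H := (Real.exp (-(‖u‖ ^ 2 / 2)) : ℂ) • expSeq u

theorem inner_expSeq (u v : H) : ⟪expSeq u, expSeq v⟫_ℂ = Complex.exp ⟪u, v⟫_ℂ := by
  refine (hasSum_inner_fock (expSeq u) (expSeq v)).unique ?_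
  have h2 : HasSum (fun n : ℕ => ⟪u, v⟫_ℂ ^ n / (n.factorial : ℂ)) (Complex.exp ⟪u, v⟫_ℂ) := by
    rw [Complex.exp_eq_exp_ℂ]
    exact NormedSpace.expSeries_div_hasSum_exp (𝔸 := ℂ) ⟪u, v⟫_ℂ
  refine h2.congr_fun fun n => ?_
  rw [coord_expSeq, coord_expSeq, inner_smul_left, inner_smul_right, inner_symVec]
  rw [← Complex.ofReal_inv, Complex.conj_ofReal, ← mul_assoc, ← Complex.ofReal_mul,
    ← mul_inv, Real.mul_self_sqrt (by positivity)]
  push_cast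
  ring

/-- `χ(u,v) = (‖u‖² + ‖v‖²)/2 - ⟨u,v⟩`. -/
def chi (u v : H) : ℂ := ((‖u‖ ^ 2 + ‖v‖ ^ 2) / 2 : ℝ) - ⟪u, v⟫_ℂ

theorem inner_coh (u v : H) : ⟪coh u, coh v⟫_ℂ = Complex.exp (-chi u v) := by
  rw [coh, coh, inner_smul_left, inner_smul_right, inner_expSeq, Complex.conj_ofReal,
    Complex.ofReal_exp, Complex.ofReal_exp, ← Complex.exp_add, ← Complex.exp_add, chi]
  congr 1
  push_cast
  ring

theorem IsTotal.eq_zero {X E : Type*} [NormedAddCommGroup E] [InnerProductSpace ℂ E]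
    {a : X → E} (ha : IsTotal a) {z : E} (h : ∀ x, ⟪z, a x⟫_ℂ = 0) : z = 0 := by
  refine Dense.eq_zero_of_inner_left (𝕜 := ℂ) ha fun v hv => ?_
  induction hv using Submodule.span_induction with
  | mem x hx => obtain ⟨y, rfl⟩ := hx; exact h y
  | zero => simp
  | add x y _ _ h1 h2 => rw [inner_add_right, h1, h2, add_zero]
  | smul c x _ h1 => rw [inner_smul_right, h1, mul_zero]

theorem isTotal_of_eq_zero {X E : Type*} [NormedAddCommGroup E] [InnerProductSpace ℂ E]
    [CompleteSpace E] {a : X → E} (h : ∀ z : E, (∀ x, ⟪z, a x⟫_ℂ = 0) → z = 0) :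
    IsTotal a := by
  unfold IsTotal
  rw [Submodule.dense_iff_topologicalClosure_eq_top, Submodule.topologicalClosure_eq_top_iff,
    Submodule.eq_bot_iff]
  intro z hz
  refine h z fun x => ?_
  rw [Submodule.mem_orthogonal'] at hz
  exact hz _ (Submodule.subset_span ⟨x, rfl⟩)

theorem eq_zero_of_hasSum_pow {c : ℕ → ℂ} (h : ∀ z : ℂ, HasSum (fun n => c n * z ^ n) 0) :
    c = 0 := by
  have hp : HasFPowerSeriesOnBall (0 : ℂ → ℂ) (FormalMultilinearSeries.ofScalars ℂ c) 0 1 := by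
    refine ⟨?_, one_pos, fun {y} _ => ?_⟩
    · refine FormalMultilinearSeries.le_radius_of_summable (r := 1) _ ?_
      simpa using (h 1).summable.norm
    · simpa [FormalMultilinearSeries.ofScalars_apply_eq
        , mul_comm] using h y
  have := hp.hasFPowerSeriesAt.eq_zero
  rwa [FormalMultilinearSeries.ofScalars_series_eq_zero] at this

theorem isTotal_coh : IsTotal (coh : H → Fock H) := by
  refine isTotal_of_eq_zero fun ξ hξ => ?_
  have hexp : ∀ u : H, ⟪ξ, expSeq u⟫_ℂ = 0 := by
    intro u
    have := hξ u
    rw [coh, inner_smul_right] at this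
    refine (mul_eq_zero.1 this).resolve_left ?_
    exact_mod_cast (Real.exp_pos _).ne'
  refine Fock.ext_zero ξ fun n => ?_
  refine (isTotal_symVec (H := H) n).eq_zero fun u => ?_
  have hc : (fun n => ⟪ξ.coord n, symVec u n⟫_ℂ * ((Real.sqrt (n.factorial : ℝ))⁻¹ : ℂ)) = 0 := by
    refine eq_zero_of_hasSum_pow fun z => ?_
    have h1 := hasSum_inner_fock ξ (expSeq (z • u))
    rw [hexp] at h1
    refine h1.congr_fun ?_
    intro n
    rw [coord_expSeq, symVec_smul, inner_smul_right, inner_smul_right]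
    ring
  have hn := congrFun hc n
  refine (mul_eq_zero.1 hn).resolve_right ?_
  have : (0 : ℝ) < Real.sqrt (n.factorial : ℝ) := Real.sqrt_pos.2 (by positivity)
  exact inv_ne_zero (by exact_mod_cast this.ne')

end Fock

/-! ### Matrix spaces, complete boundedness and matrix space liftings -/

section MatrixSpace

variable {H H' G G' K L : Type*}
  [NormedAddCommGroup H] [InnerProductSpace ℂ H] [CompleteSpace H]
  [NormedAddCommGroup H'] [InnerProductSpace ℂ H'] [CompleteSpace H']
  [NormedAddCommGroup G] [InnerProductSpace ℂ G] [CompleteSpace G]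
  [NormedAddCommGroup G'] [InnerProductSpace ℂ G'] [CompleteSpace G']
  [NormedAddCommGroup K] [InnerProductSpace ℂ K]
  [NormedAddCommGroup L] [InnerProductSpace ℂ L]

/-- The slice `E^x T E_y`. -/
def slice (x : L) (y : K) (T : H ⊗ₕ K →L[ℂ] H' ⊗ₕ L) : H →L[ℂ] H' :=
  (ket H' x).adjoint ∘L T ∘L ket H y

theorem inner_slice (x : L) (y : K) (T : H ⊗ₕ K →L[ℂ] H' ⊗ₕ L) (v' : H') (v : H) :
    ⟪v', slice x y T v⟫_ℂ = ⟪tmul v' x, T (tmul v y)⟫_ℂ := by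
  simp [slice, ContinuousLinearMap.adjoint_inner_right]

theorem clm_ext_inner {S T : H →L[ℂ] H'} (h : ∀ v' v, ⟪v', S v⟫_ℂ = ⟪v', T v⟫_ℂ) : S = T :=
  ContinuousLinearMap.ext fun v => ext_inner_left ℂ fun v' => h v' v

/-- The `K`-matrix space `V ⊗_M B(K)` over a space `V` of operators from `H` to `H'`: the
operators `T` from `H ⊗ K` to `H' ⊗ K` all of whose slices `E^x T E_y` belong to `V`. -/
def matrixSpace (V : Submodule ℂ (H →L[ℂ] H')) (K : Type*) [NormedAddCommGroup K]
    [InnerProductSpace ℂ K] : Submodule ℂ (H ⊗ₕ K →L[ℂ] H' ⊗ₕ K) where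
  carrier := {T | ∀ x y : K, slice x y T ∈ V}
  add_mem' {S T} hS hT x y := by
    have : slice x y (S + T) = slice x y S + slice x y T := by
      simp [slice, ContinuousLinearMap.comp_add, ContinuousLinearMap.add_comp]
    rw [this]
    exact V.add_mem (hS x y) (hT x y)
  zero_mem' x y := by simp [slice]
  smul_mem' c T hT x y := by
    have : slice x y (c • T) = c • slice x y T := by
      simp [slice, ContinuousLinearMap.smul_comp]
    rw [this]
    exact V.smul_mem c (hT x y)

/-- The slice `E^x T E_y ∈ V` of an element `T` of the matrix space over `V`. -/
def entry (V : Submodule ℂ (H →L[ℂ] H')) (x y : K) : matrixSpace V K →ₗ[ℂ] V where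
  toFun T := ⟨slice x y T.1, T.2 x y⟩
  map_add' S T := Subtype.ext (by
    simp [slice, ContinuousLinearMap.comp_add, ContinuousLinearMap.add_comp])
  map_smul' c T := Subtype.ext (by
    simp [slice, ContinuousLinearMap.smul_comp])

/-- The operator `H^n → H'^n` given by an `n × n` matrix of operators from `H` to `H'`. -/
def matOp {n : ℕ} (A : Fin n → Fin n → (H →L[ℂ] H')) :
    PiLp 2 (fun _ : Fin n => H) →L[ℂ] PiLp 2 (fun _ : Fin n => H') :=
  (PiLp.continuousLinearEquiv 2 ℂ (fun _ : Fin n => H')).symm.toContinuousLinearMap ∘L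
    (ContinuousLinearMap.pi fun i => ∑ j, A i j ∘L ContinuousLinearMap.proj j) ∘L
      (PiLp.continuousLinearEquiv 2 ℂ (fun _ : Fin n => H)).toContinuousLinearMap

theorem matOp_apply {n : ℕ} (A : Fin n → Fin n → (H →L[ℂ] H'))
    (v : PiLp 2 (fun _ : Fin n => H)) (i : Fin n) : matOp A v i = ∑ j, A i j (v j) := by
  simp [matOp]

/-- Complete boundedness of a linear map `φ` on a space `V` of operators: its matrix liftings
`φ^{(n)}` are bounded uniformly in `n`. -/
def IsCompletelyBounded {V : Submodule ℂ (H →L[ℂ] H')} (φ : V →ₗ[ℂ] (G →L[ℂ] G')) : Prop :=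
  ∃ C : ℝ, ∀ (n : ℕ) (A : Fin n → Fin n → V),
    ‖matOp fun i j => φ (A i j)‖ ≤ C * ‖matOp fun i j => (A i j : H →L[ℂ] H')‖

theorem norm_toLp_map_le {P Q : Type*} [NormedAddCommGroup P] [InnerProductSpace ℂ P]
    [NormedAddCommGroup Q] [InnerProductSpace ℂ Q] {n : ℕ} (T : P →L[ℂ] Q)
    (v : PiLp 2 fun _ : Fin n => P) :
    ‖(WithLp.toLp 2 fun i => T (v i) : PiLp 2 fun _ : Fin n => Q)‖ ≤ ‖T‖ * ‖v‖ := by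
  rw [PiLp.norm_eq_of_L2, PiLp.norm_eq_of_L2]
  refine Real.sqrt_le_iff.2 ⟨by positivity, ?_⟩
  rw [mul_pow, Real.sq_sqrt (by positivity), Finset.mul_sum]
  refine Finset.sum_le_sum fun i _ => ?_
  rw [← mul_pow]
  exact pow_le_pow_left₀ (norm_nonneg _) (T.le_opNorm _) 2

theorem norm_matOp_sandwich_le {n : ℕ} (R : H' →L[ℂ] G') (S : G →L[ℂ] H)
    (A : Fin n → Fin n → (H →L[ℂ] H')) :
    ‖matOp fun i j => R ∘L A i j ∘L S‖ ≤ ‖R‖ * ‖S‖ * ‖matOp A‖ := by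
  refine ContinuousLinearMap.opNorm_le_bound _ (by positivity) fun v => ?_
  obtain ⟨w, hw⟩ : ∃ w : PiLp 2 fun _ : Fin n => H, w = WithLp.toLp 2 fun j => S (v j) := ⟨_, rfl⟩
  have hwn : ‖w‖ ≤ ‖S‖ * ‖v‖ := by rw [hw]; exact norm_toLp_map_le S v
  have hwi : ∀ j, w j = S (v j) := fun j => by rw [hw]
  have h : matOp (fun i j => R ∘L A i j ∘L S) v = WithLp.toLp 2 fun i => R (matOp A w i) := by
    refine PiLp.ext fun i => ?_
    change _ = R (matOp A w i)
    rw [matOp_apply, matOp_apply, map_sum]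
    refine Finset.sum_congr rfl fun j _ => ?_
    rw [hwi]
    rfl
  have h1 : ‖matOp A w‖ ≤ ‖matOp A‖ * ‖w‖ := ContinuousLinearMap.le_opNorm (matOp A) w
  have h2 := norm_toLp_map_le R (matOp A w)
  rw [h]
  have hm : 0 ≤ ‖matOp A‖ := norm_nonneg (matOp A)
  have h3 : ‖matOp A‖ * ‖w‖ ≤ ‖matOp A‖ * (‖S‖ * ‖v‖) := mul_le_mul_of_nonneg_left hwn hm
  have h4 := mul_le_mul_of_nonneg_left (h1.trans h3) (norm_nonneg R)
  refine h2.trans (h4.trans (le_of_eq ?_))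
  ring

/-- `Φ` is the matrix space lifting `φ ⊗_M id_{B(K)}` if
`E^x Φ(T) E_y = φ (E^x T E_y)` for all `x`, `y` and `T`. -/
def IsLift {V : Submodule ℂ (H →L[ℂ] H')} (φ : V →ₗ[ℂ] (G →L[ℂ] G'))
    (Φ : matrixSpace V K →ₗ[ℂ] (G ⊗ₕ K →L[ℂ] G' ⊗ₕ K)) : Prop :=
  ∀ (x y : K) (T : matrixSpace V K), slice x y (Φ T) = φ (entry V x y T)

theorem inner_ext_tmul {z w : H ⊗ₕ K} (h : ∀ u e, ⟪z, tmul u e⟫_ℂ = ⟪w, tmul u e⟫_ℂ) :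
    z = w := by
  have ht : IsTotal (fun p : H × K => tmul p.1 p.2) :=
    isTotal_tmul (a := fun u : H => u) (b := fun e : K => e) isTotal_id isTotal_id
  rw [← sub_eq_zero]
  refine ht.eq_zero fun p => ?_
  rw [inner_sub_left, h, sub_self]

theorem clm_ext_tmul {E : Type*} [NormedAddCommGroup E] [NormedSpace ℂ E]
    {S T : H ⊗ₕ K →L[ℂ] E} (h : ∀ u e, S (tmul u e) = T (tmul u e)) : S = T := by
  have ht : IsTotal (fun p : H × K => tmul p.1 p.2) :=
    isTotal_tmul (a := fun u : H => u) (b := fun e : K => e) isTotal_id isTotal_id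
  refine ContinuousLinearMap.ext_on ht ?_
  rintro _ ⟨p, rfl⟩
  exact h _ _

theorem ext_slice {S T : H ⊗ₕ K →L[ℂ] H' ⊗ₕ L}
    (h : ∀ x y, slice x y S = slice x y T) : S = T := by
  refine clm_ext_tmul fun v y => inner_ext_tmul fun v' x => ?_
  rw [← inner_conj_symm, ← inner_conj_symm (T _), ← inner_slice, ← inner_slice, h]

theorem exists_repr (z : G ⊗[ℂ] K) : ∃ s : Finset K, ∀ (n : ℕ) (e : Fin n → K),
    (∀ x ∈ s, x ∈ Submodule.span ℂ (Set.range e)) → ∃ v : Fin n → G, z = ∑ i, v i ⊗ₜ[ℂ] e i := by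
  classical
  induction z with
  | zero => exact ⟨∅, fun n e _ => ⟨0, by simp⟩⟩
  | tmul u x =>
    refine ⟨{x}, fun n e h => ?_⟩
    obtain ⟨c, hc⟩ := (Submodule.mem_span_range_iff_exists_fun ℂ).1 (h x (by simp))
    refine ⟨fun i => c i • u, ?_⟩
    rw [← hc, TensorProduct.tmul_sum]
    simp [TensorProduct.smul_tmul]
  | add z w hz hw =>
    obtain ⟨s, hs⟩ := hz
    obtain ⟨t, ht⟩ := hw
    refine ⟨s ∪ t, fun n e h => ?_⟩
    obtain ⟨v, hv⟩ := hs n e fun x hx => h x (Finset.mem_union_left _ hx)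
    obtain ⟨w', hw'⟩ := ht n e fun x hx => h x (Finset.mem_union_right _ hx)
    exact ⟨v + w', by simp [hv, hw', TensorProduct.add_tmul, Finset.sum_add_distrib]⟩

theorem exists_orthonormal_repr (z : G ⊗[ℂ] K) (w : G' ⊗[ℂ] K) :
    ∃ (n : ℕ) (e : Fin n → K), Orthonormal ℂ e ∧
      (∃ v : Fin n → G, z = ∑ i, v i ⊗ₜ[ℂ] e i) ∧ ∃ v : Fin n → G', w = ∑ i, v i ⊗ₜ[ℂ] e i := by
  classical
  obtain ⟨s, hs⟩ := exists_repr z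
  obtain ⟨t, ht⟩ := exists_repr w
  let K0 : Submodule ℂ K := Submodule.span ℂ ((s ∪ t : Finset K) : Set K)
  have : FiniteDimensional ℂ K0 := FiniteDimensional.span_finset ℂ _
  let b := stdOrthonormalBasis ℂ K0
  have horth : Orthonormal ℂ (fun i => (b i : K)) :=
    b.orthonormal.comp_linearIsometry K0.subtypeₗᵢ
  have hmem : ∀ x ∈ s ∪ t, x ∈ Submodule.span ℂ (Set.range fun i => (b i : K)) := by
    intro x hx
    have hx0 : x ∈ K0 := Submodule.subset_span hx
    rw [Submodule.mem_span_range_iff_exists_fun]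
    refine ⟨fun i => b.repr ⟨x, hx0⟩ i, ?_⟩
    have := congrArg (K0.subtype) (b.sum_repr ⟨x, hx0⟩)
    simpa using this
  exact ⟨_, _, horth, hs _ _ fun x hx => hmem x (Finset.mem_union_left _ hx),
    ht _ _ fun x hx => hmem x (Finset.mem_union_right _ hx)⟩

theorem norm_eq_of_inner_eq {E F : Type*} [NormedAddCommGroup E] [InnerProductSpace ℂ E]
    [NormedAddCommGroup F] [InnerProductSpace ℂ F] {x : E} {y : F} (h : ⟪x, x⟫_ℂ = ⟪y, y⟫_ℂ) :
    ‖x‖ = ‖y‖ := by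
  rw [@norm_eq_sqrt_re_inner ℂ, h, ← @norm_eq_sqrt_re_inner ℂ]

theorem norm_sum_tmul {n : ℕ} {e : Fin n → K} (he : Orthonormal ℂ e)
    (v : Fin n → G) : ‖∑ i, v i ⊗ₜ[ℂ] e i‖ = ‖(WithLp.toLp 2 v : PiLp 2 fun _ : Fin n => G)‖ := by
  have h : ⟪∑ i, v i ⊗ₜ[ℂ] e i, ∑ i, v i ⊗ₜ[ℂ] e i⟫_ℂ
      = ⟪(WithLp.toLp 2 v : PiLp 2 fun _ : Fin n => G), WithLp.toLp 2 v⟫_ℂ := by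
    rw [sum_inner, PiLp.inner_apply]
    refine Finset.sum_congr rfl fun i _ => ?_
    rw [inner_sum, Finset.sum_eq_single i]
    · rw [TensorProduct.inner_tmul, inner_self_eq_norm_sq_to_K (e i), he.1 i]; simp
    · intro j _ hj
      rw [TensorProduct.inner_tmul, he.2 hj.symm, mul_zero]
    · simp
  exact norm_eq_of_inner_eq h

theorem norm_matOp_slice_le {n : ℕ} {e : Fin n → K} (he : Orthonormal ℂ e)
    (T : H ⊗ₕ K →L[ℂ] H' ⊗ₕ K) : ‖matOp fun i j => slice (e i) (e j) T‖ ≤ ‖T‖ := by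
  refine ContinuousLinearMap.opNorm_le_bound _ (norm_nonneg _) fun v => ?_
  obtain ⟨w, hw⟩ : ∃ w, w = matOp (fun i j => slice (e i) (e j) T) v := ⟨_, rfl⟩
  have hwi : ∀ i, w i = ∑ j, slice (e i) (e j) T (v j) := fun i => by rw [hw, matOp_apply]
  rw [← hw]
  have h1 : ⟪w, w⟫_ℂ = ⟪HTensor.incl (∑ i, w i ⊗ₜ[ℂ] e i), T (HTensor.incl (∑ i, v i ⊗ₜ[ℂ] e i))⟫_ℂ := by
    conv_lhs => rw [PiLp.inner_apply]
    rw [map_sum, sum_inner]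
    refine Finset.sum_congr rfl fun i _ => ?_
    have h0 : ⟪w i, w i⟫_ℂ = ⟪w i, ∑ j, slice (e i) (e j) T (v j)⟫_ℂ := by rw [← hwi]
    rw [h0, inner_sum, map_sum, map_sum, inner_sum]
    exact Finset.sum_congr rfl fun j _ => inner_slice _ _ _ _ _
  have h2 : ‖w‖ ^ 2 ≤ ‖w‖ * (‖T‖ * ‖v‖) := by
    have h3 : ‖w‖ ^ 2 = ‖⟪w, w⟫_ℂ‖ := by
      rw [inner_self_eq_norm_sq_to_K]; simp
    rw [h3, h1]
    refine (norm_inner_le_norm _ _).trans ?_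
    have e1 := norm_sum_tmul he (fun i => w i)
    have e2 := norm_sum_tmul he (fun i => v i)
    rw [HTensor.norm_incl, e1]
    refine mul_le_mul_of_nonneg_left ?_ (norm_nonneg _)
    refine (T.le_opNorm _).trans ?_
    rw [HTensor.norm_incl, e2]
  rcases eq_or_lt_of_le (norm_nonneg w) with h0 | h0
  · rw [← h0]; positivity
  · rw [sq] at h2
    exact le_of_mul_le_mul_left h2 h0

theorem tmul_smul (c : ℂ) (u : H) (e : K) : tmul u (c • e) = c • tmul u e := by
  simp [tmul]

theorem exists_op_of_bounded {E E' D D' : Type*}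
    [NormedAddCommGroup E] [InnerProductSpace ℂ E] [NormedAddCommGroup E'] [InnerProductSpace ℂ E']
    [NormedAddCommGroup D] [InnerProductSpace ℂ D] [CompleteSpace D]
    [NormedAddCommGroup D'] [InnerProductSpace ℂ D'] [CompleteSpace D']
    {ι : E →L[ℂ] D} (hd : DenseRange ι) (hι : ∀ x y, ⟪ι x, ι y⟫_ℂ = ⟪x, y⟫_ℂ)
    {ι' : E' →L[ℂ] D'} (hd' : DenseRange ι') (hι' : ∀ x y, ⟪ι' x, ι' y⟫_ℂ = ⟪x, y⟫_ℂ)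
    (B : E' →ₗ⋆[ℂ] E →ₗ[ℂ] ℂ) (C : ℝ) (hB : ∀ z w, ‖B z w‖ ≤ C * ‖z‖ * ‖w‖) :
    ∃ S : D →L[ℂ] D', ∀ z w, ⟪ι' z, S (ι w)⟫_ℂ = B z w := by
  have nι : ∀ x, ‖ι x‖ = ‖x‖ := fun x => by
    rw [@norm_eq_sqrt_re_inner ℂ, hι, ← @norm_eq_sqrt_re_inner ℂ]
  have nι' : ∀ x, ‖ι' x‖ = ‖x‖ := fun x => by
    rw [@norm_eq_sqrt_re_inner ℂ, hι', ← @norm_eq_sqrt_re_inner ℂ]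
  have hui : IsUniformInducing ι :=
    (AddMonoidHomClass.isometry_of_norm ι nι).isUniformInducing
  have hui' : IsUniformInducing ι' :=
    (AddMonoidHomClass.isometry_of_norm ι' nι').isUniformInducing
  let Bc : E' →L⋆[ℂ] (E →L[ℂ] ℂ) := B.mkContinuous₂ C hB
  let Bf : D →L[ℂ] E' →L⋆[ℂ] ℂ := Bc.flip.extend ι
  let Bg : D' →L⋆[ℂ] D →L[ℂ] ℂ := Bf.flip.extend ι'
  let R : D' →L[ℂ] D :=
    ((InnerProductSpace.toDual ℂ D).symm.toContinuousLinearEquiv.toContinuousLinearMap).comp Bg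
  refine ⟨R.adjoint, fun z w => ?_⟩
  rw [ContinuousLinearMap.adjoint_inner_right]
  have h1 : ⟪R (ι' z), ι w⟫_ℂ = Bg (ι' z) (ι w) := by
    change ⟪(InnerProductSpace.toDual ℂ D).symm (Bg (ι' z)), ι w⟫_ℂ = _
    rw [InnerProductSpace.toDual_symm_apply]
  rw [h1]
  have h2 : Bg (ι' z) = Bf.flip z := ContinuousLinearMap.extend_eq _ hd' hui' z
  rw [h2, ContinuousLinearMap.flip_apply]
  have h3 : Bf (ι w) = Bc.flip w := ContinuousLinearMap.extend_eq _ hd hui w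
  rw [h3, ContinuousLinearMap.flip_apply]
  rfl

/-- A bounded matrix of operators, in coordinate-free form, determines a bounded operator. -/
theorem exists_op_of_form (F : K →ₗ⋆[ℂ] K →ₗ[ℂ] (G →L[ℂ] G')) (C : ℝ)
    (hF : ∀ (n : ℕ) (e : Fin n → K), Orthonormal ℂ e → ‖matOp fun i j => F (e i) (e j)‖ ≤ C) :
    ∃ S : G ⊗ₕ K →L[ℂ] G' ⊗ₕ K, ∀ x y, slice x y S = F x y := by
  let B1 : G' → K → (G ⊗[ℂ] K →ₗ[ℂ] ℂ) := fun v' x =>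
    TensorProduct.lift (LinearMap.mk₂ ℂ (fun v y => ⟪v', F x y v⟫_ℂ)
      (fun v w y => by simp) (fun c v y => by simp)
      (fun v y z => by simp) (fun c v y => by simp))
  have hB1 : ∀ v' x v y, B1 v' x (v ⊗ₜ[ℂ] y) = ⟪v', F x y v⟫_ℂ := fun v' x v y => by simp [B1]
  let B : (G' ⊗[ℂ] K) →ₗ⋆[ℂ] (G ⊗[ℂ] K →ₗ[ℂ] ℂ) :=
    TensorProduct.lift (LinearMap.mk₂'ₛₗ (starRingEnd ℂ) (starRingEnd ℂ) B1
      (fun v w x => TensorProduct.ext' fun u y => by simp [hB1])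
      (fun c v x => TensorProduct.ext' fun u y => by simp [hB1, mul_comm])
      (fun v x z => TensorProduct.ext' fun u y => by simp [hB1])
      (fun c v x => TensorProduct.ext' fun u y => by simp [hB1]))
  have hB : ∀ v' x v y, B (v' ⊗ₜ[ℂ] x) (v ⊗ₜ[ℂ] y) = ⟪v', F x y v⟫_ℂ := fun v' x v y => by
    simp [B, hB1]
  have hbd : ∀ z w, ‖B z w‖ ≤ C * ‖z‖ * ‖w‖ := by
    intro z w
    obtain ⟨n, e, he, ⟨v', rfl⟩, ⟨v, rfl⟩⟩ := exists_orthonormal_repr z w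
    have h1 : B (∑ i, v' i ⊗ₜ[ℂ] e i) (∑ i, v i ⊗ₜ[ℂ] e i)
        = ⟪(WithLp.toLp 2 v' : PiLp 2 fun _ : Fin n => G'),
          matOp (fun i j => F (e i) (e j)) (WithLp.toLp 2 v)⟫_ℂ := by
      rw [PiLp.inner_apply, map_sum B, LinearMap.sum_apply]
      refine Finset.sum_congr rfl fun i _ => ?_
      rw [matOp_apply, inner_sum, map_sum]
      exact Finset.sum_congr rfl fun j _ => hB _ _ _ _
    rw [h1, norm_sum_tmul he, norm_sum_tmul he]
    refine (norm_inner_le_norm _ _).trans ?_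
    rw [mul_comm C, mul_assoc]
    refine mul_le_mul_of_nonneg_left ?_ (norm_nonneg _)
    have h2 := ContinuousLinearMap.le_opNorm (matOp fun i j => F (e i) (e j))
      (WithLp.toLp 2 v : PiLp 2 fun _ : Fin n => G)
    refine h2.trans ?_
    exact mul_le_mul_of_nonneg_right (hF n e he) (norm_nonneg _)
  obtain ⟨S, hS⟩ := exists_op_of_bounded
    (E := G ⊗[ℂ] K) (E' := G' ⊗[ℂ] K) (D := G ⊗ₕ K) (D' := G' ⊗ₕ K)
    HTensor.denseRange_incl HTensor.inner_incl HTensor.denseRange_incl HTensor.inner_incl B C hbd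
  refine ⟨S, fun x y => clm_ext_inner fun v' v => ?_⟩
  rw [inner_slice, ← hB]
  exact hS _ _

theorem exists_lift {V : Submodule ℂ (H →L[ℂ] H')} (φ : V →ₗ[ℂ] (G →L[ℂ] G'))
    (hφ : IsCompletelyBounded φ) :
    ∃ Φ : matrixSpace V K →ₗ[ℂ] (G ⊗ₕ K →L[ℂ] G' ⊗ₕ K), IsLift φ Φ := by
  obtain ⟨C, hC⟩ := hφ
  have key : ∀ T : matrixSpace V K, ∃ S : G ⊗ₕ K →L[ℂ] G' ⊗ₕ K,
      ∀ x y, slice x y S = φ (entry V x y T) := by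
    intro T
    let F : K →ₗ⋆[ℂ] K →ₗ[ℂ] (G →L[ℂ] G') :=
      LinearMap.mk₂'ₛₗ (starRingEnd ℂ) (RingHom.id ℂ) (fun x y => φ (entry V x y T))
        (fun x x' y => by
          rw [← map_add]
          congr 1
          refine Subtype.ext (clm_ext_inner fun v' v => ?_)
          change ⟪v', slice _ _ _ v⟫_ℂ = ⟪v', slice _ _ _ v + slice _ _ _ v⟫_ℂ
          simp only [inner_add_right, inner_slice, tmul_add, inner_add_left])
        (fun c x y => by
          rw [← map_smul]
          congr 1
          refine Subtype.ext (clm_ext_inner fun v' v => ?_)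
          change ⟪v', slice _ _ _ v⟫_ℂ = ⟪v', starRingEnd ℂ c • slice x y T.1 v⟫_ℂ
          simp only [inner_smul_right, inner_slice, tmul_smul, inner_smul_left])
        (fun x y y' => by
          rw [← map_add]
          congr 1
          refine Subtype.ext (clm_ext_inner fun v' v => ?_)
          change ⟪v', slice _ _ _ v⟫_ℂ = ⟪v', slice _ _ _ v + slice _ _ _ v⟫_ℂ
          simp only [inner_add_right, inner_slice, tmul_add, map_add])
        (fun c x y => by
          rw [← map_smul]
          congr 1
          refine Subtype.ext (clm_ext_inner fun v' v => ?_)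
          change ⟪v', slice _ _ _ v⟫_ℂ = ⟪v', c • slice x y T.1 v⟫_ℂ
          simp only [inner_smul_right, inner_slice, tmul_smul, map_smul])
    obtain ⟨S, hS⟩ := exists_op_of_form F (|C| * ‖T.1‖) fun n e he => by
      refine (hC n fun i j => entry V (e i) (e j) T).trans ?_
      have h1 := mul_le_mul_of_nonneg_right (le_abs_self C)
        (norm_nonneg (matOp fun i j => (entry V (e i) (e j) T : H →L[ℂ] H')))
      refine h1.trans ?_
      exact mul_le_mul_of_nonneg_left (norm_matOp_slice_le he T.1) (abs_nonneg _)
    exact ⟨S, hS⟩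
  choose Φ hΦ using key
  refine ⟨{ toFun := Φ, map_add' := fun S T => ?_, map_smul' := fun c T => ?_ },
    fun x y T => hΦ T x y⟩
  · refine ext_slice fun x y => ?_
    have h : slice x y (Φ S + Φ T) = slice x y (Φ S) + slice x y (Φ T) := by
      simp [slice, ContinuousLinearMap.comp_add, ContinuousLinearMap.add_comp]
    rw [h, hΦ, hΦ, hΦ, map_add, map_add]
  · refine ext_slice fun x y => ?_
    have h : slice x y (c • Φ T) = c • slice x y (Φ T) := by
      simp [slice, ContinuousLinearMap.smul_comp]
    rw [RingHom.id_apply, h, hΦ, hΦ, map_smul, map_smul]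

open Classical in
/-- The matrix space lifting `φ ⊗_M id_{B(K)}`, which exists and is unique for every completely
bounded `φ` (see `lift_spec` and `IsLift.unique`). -/
def lift {V : Submodule ℂ (H →L[ℂ] H')} (φ : V →ₗ[ℂ] (G →L[ℂ] G')) (K : Type*)
    [NormedAddCommGroup K] [InnerProductSpace ℂ K] :
    matrixSpace V K →ₗ[ℂ] (G ⊗ₕ K →L[ℂ] G' ⊗ₕ K) :=
  if h : ∃ Φ : matrixSpace V K →ₗ[ℂ] (G ⊗ₕ K →L[ℂ] G' ⊗ₕ K), IsLift φ Φ then h.choose else 0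

theorem lift_spec {V : Submodule ℂ (H →L[ℂ] H')} (φ : V →ₗ[ℂ] (G →L[ℂ] G'))
    (hφ : IsCompletelyBounded φ) : IsLift φ (lift φ K) := by
  have h := exists_lift (K := K) φ hφ
  rw [lift, dif_pos h]
  exact h.choose_spec

theorem IsLift.unique {V : Submodule ℂ (H →L[ℂ] H')} {φ : V →ₗ[ℂ] (G →L[ℂ] G')}
    {Φ Ψ : matrixSpace V K →ₗ[ℂ] (G ⊗ₕ K →L[ℂ] G' ⊗ₕ K)} (h : IsLift φ Φ) (h' : IsLift φ Ψ) :
    Φ = Ψ :=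
  LinearMap.ext fun T => ext_slice fun x y => (h x y T).trans (h' x y T).symm

end MatrixSpace

/-! ### Second quantisation, Weyl operators -/

section Weyl

variable {H K : Type*} [NormedAddCommGroup H] [InnerProductSpace ℂ H]
  [NormedAddCommGroup K] [InnerProductSpace ℂ K]

/-- The second quantisation `ϖ(u) ↦ ϖ(ι u)` of an isometry. -/
def fockMap (ι : H →ₗᵢ[ℂ] K) : Fock H →ₗᵢ[ℂ] Fock K :=
  isometryOfTotal coh (fun u => coh (ι u)) isTotal_coh
    (fun u v => by rw [inner_coh, inner_coh, chi, chi, ι.norm_map, ι.norm_map, ι.inner_map_map])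

theorem fockMap_coh (ι : H →ₗᵢ[ℂ] K) (u : H) : fockMap ι (coh u) = coh (ι u) :=
  isometryOfTotal_apply _ _ _ _ u

theorem inner_weyl (f g h : H) :
    ⟪Complex.exp (-(Complex.I * (⟪f, g⟫_ℂ).im)) • coh (f + g),
      Complex.exp (-(Complex.I * (⟪f, h⟫_ℂ).im)) • coh (f + h)⟫_ℂ = ⟪coh g, coh h⟫_ℂ := by
  rw [inner_smul_left, inner_smul_right, inner_coh, inner_coh, ← Complex.exp_conj,
    ← Complex.exp_add, ← Complex.exp_add]
  congr 1
  have h1 : (‖f + g‖ : ℝ) ^ 2 = ‖f‖ ^ 2 + 2 * (⟪f, g⟫_ℂ).re + ‖g‖ ^ 2 := by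
    simpa using norm_add_sq (𝕜 := ℂ) f g
  have h2 : (‖f + h‖ : ℝ) ^ 2 = ‖f‖ ^ 2 + 2 * (⟪f, h⟫_ℂ).re + ‖h‖ ^ 2 := by
    simpa using norm_add_sq (𝕜 := ℂ) f h
  have h3 : ⟪f, f⟫_ℂ = ((‖f‖ ^ 2 : ℝ) : ℂ) := by
    rw [inner_self_eq_norm_sq_to_K]; push_cast; rfl
  have h4 : ⟪g, f⟫_ℂ = starRingEnd ℂ ⟪f, g⟫_ℂ := (inner_conj_symm g f).symm
  rw [chi, chi, h1, h2, inner_add_left, inner_add_right, inner_add_right, h3, h4]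
  generalize ⟪f, g⟫_ℂ = a
  generalize ⟪f, h⟫_ℂ = b
  generalize ⟪g, h⟫_ℂ = c
  generalize ‖f‖ ^ 2 = p
  generalize ‖g‖ ^ 2 = q
  generalize ‖h‖ ^ 2 = r
  have ha : a = a.re + a.im * Complex.I := (Complex.re_add_im a).symm
  have hb : b = b.re + b.im * Complex.I := (Complex.re_add_im b).symm
  rw [ha, hb]
  apply Complex.ext
  · simp; ring
  · simp

/-- The Fock-Weyl operator `W(f) : ϖ(g) ↦ exp (-i Im ⟨f, g⟩) ϖ(f + g)`. -/
def weyl (f : H) : Fock H →ₗᵢ[ℂ] Fock H :=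
  isometryOfTotal coh (fun g => Complex.exp (-(Complex.I * (⟪f, g⟫_ℂ).im)) • coh (f + g))
    isTotal_coh (fun g h => inner_weyl f g h)

theorem weyl_coh (f g : H) :
    weyl f (coh g) = Complex.exp (-(Complex.I * (⟪f, g⟫_ℂ).im)) • coh (f + g) :=
  isometryOfTotal_apply _ _ _ _ g

theorem inner_coh_add {f f' g g' : H} (h : ⟪f, g'⟫_ℂ = 0) (h' : ⟪g, f'⟫_ℂ = 0)
    (h1 : ⟪f, g⟫_ℂ = 0) (h2 : ⟪f', g'⟫_ℂ = 0) :
    ⟪coh (f + g), coh (f' + g')⟫_ℂ = ⟪coh f, coh f'⟫_ℂ * ⟪coh g, coh g'⟫_ℂ := by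
  rw [inner_coh, inner_coh, inner_coh, ← Complex.exp_add]
  congr 1
  have e1 : ‖f + g‖ ^ 2 = ‖f‖ ^ 2 + ‖g‖ ^ 2 := by
    simpa [h1] using norm_add_sq (𝕜 := ℂ) f g
  have e2 : ‖f' + g'‖ ^ 2 = ‖f'‖ ^ 2 + ‖g'‖ ^ 2 := by
    simpa [h2] using norm_add_sq (𝕜 := ℂ) f' g'
  rw [chi, chi, chi, e1, e2, inner_add_left, inner_add_right, inner_add_right, h, h']
  push_cast
  ring

theorem coh_coe {E : Type*} [NormedAddCommGroup E] [InnerProductSpace ℂ E] (M : Submodule ℂ E)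
    (f g : M) : ⟪coh f, coh g⟫_ℂ = ⟪coh (f : E), coh (g : E)⟫_ℂ := by
  rw [inner_coh, inner_coh]; rfl

/-- For orthogonal subspaces `M₁`, `M₂` of `M`, the isometry
`(H ⊗ Fock M₁) ⊗ Fock M₂ → H ⊗ Fock M`, `(u ⊗ ϖ(f)) ⊗ ϖ(g) ↦ u ⊗ ϖ(f + g)`. -/
def fockFactor (H : Type*) [NormedAddCommGroup H] [InnerProductSpace ℂ H]
    {E : Type*} [NormedAddCommGroup E] [InnerProductSpace ℂ E]
    {M₁ M₂ M : Submodule ℂ E} (h₁ : M₁ ≤ M) (h₂ : M₂ ≤ M) (h : M₁ ⟂ M₂) :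
    (H ⊗ₕ Fock M₁) ⊗ₕ Fock M₂ →ₗᵢ[ℂ] H ⊗ₕ Fock M :=
  isometryOfTotal (fun p : (H × M₁) × M₂ => tmul (tmul p.1.1 (coh p.1.2)) (coh p.2))
    (fun p => tmul p.1.1 (coh (⟨p.1.2 + p.2, M.add_mem (h₁ p.1.2.2) (h₂ p.2.2)⟩ : M)))
    (isTotal_tmul (a := fun p : H × M₁ => tmul p.1 (coh p.2)) (b := fun g : M₂ => coh g)
      (isTotal_tmul (a := fun u : H => u) (b := fun f : M₁ => coh f) isTotal_id isTotal_coh)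
      isTotal_coh)
    (fun p q => by
      rw [inner_tmul, inner_tmul, inner_tmul, coh_coe, coh_coe, coh_coe, mul_assoc]
      congr 1
      have ho := fun (f : M₁) (g : M₂) =>
        (Submodule.isOrtho_iff_inner_eq.1 h) f.1 f.2 g.1 g.2
      exact inner_coh_add (ho _ _) (inner_eq_zero_symm.1 (ho _ _)) (ho _ _) (ho _ _))

theorem fockFactor_tmul {E : Type*} [NormedAddCommGroup E] [InnerProductSpace ℂ E]
    {M₁ M₂ M : Submodule ℂ E} (h₁ : M₁ ≤ M) (h₂ : M₂ ≤ M) (h : M₁ ⟂ M₂)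
    (u : H) (f : M₁) (g : M₂) :
    fockFactor H h₁ h₂ h (tmul (tmul u (coh f)) (coh g))
      = tmul u (coh (⟨f + g, M.add_mem (h₁ f.2) (h₂ g.2)⟩ : M)) :=
  isometryOfTotal_apply (fun p : (H × M₁) × M₂ => tmul (tmul p.1.1 (coh p.1.2)) (coh p.2))
    _ _ _ ((u, f), g)

end Weyl

/-! ### The noise space -/

section Noise

open MeasureTheory

variable (N : Type*) [NormedAddCommGroup N] [InnerProductSpace ℂ N]

/-- `L²(J; N)` for `J ⊆ ℝ`, realised as the space of those elements of `L²(ℝ; N)` which vanish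
almost everywhere off `J`. -/
def L2On (J : Set ℝ) : Submodule ℂ (Lp N 2 (volume : Measure ℝ)) where
  carrier := {f | ∀ᵐ s : ℝ, s ∉ J → f s = 0}
  add_mem' {f g} hf hg := by
    filter_upwards [hf, hg, Lp.coeFn_add f g] with s h1 h2 h3 hs
    rw [h3, Pi.add_apply, h1 hs, h2 hs, add_zero]
  zero_mem' := by
    filter_upwards [Lp.coeFn_zero N 2 (volume : Measure ℝ)] with s h _
    rw [h, Pi.zero_apply]
  smul_mem' c f hf := by
    filter_upwards [hf, Lp.coeFn_smul c f] with s h1 h2 hs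
    rw [h2, Pi.smul_apply, h1 hs, smul_zero]

variable {N}

theorem L2On_mono {J J' : Set ℝ} (h : J ⊆ J') : L2On N J ≤ L2On N J' := by
  intro f hf
  change ∀ᵐ s : ℝ, s ∉ J' → f s = 0
  have hf' : ∀ᵐ s : ℝ, s ∉ J → f s = 0 := hf
  filter_upwards [hf'] with s h1 hs using h1 fun h2 => hs (h h2)

theorem L2On_isOrtho {J J' : Set ℝ} (h : Disjoint J J') : L2On N J ⟂ L2On N J' := by
  rw [Submodule.isOrtho_iff_inner_eq]
  intro f hf g hg
  rw [L2.inner_def]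
  refine integral_eq_zero_of_ae ?_
  filter_upwards [hf, hg] with s h1 h2
  by_cases hs : s ∈ J
  · rw [h2 (Set.disjoint_left.1 h hs), inner_zero_right, Pi.zero_apply]
  · rw [h1 hs, inner_zero_left, Pi.zero_apply]

variable (N) in
/-- The symmetric Fock space over `L²(J; N)`. -/
abbrev FockOn (J : Set ℝ) := Fock (L2On N J)

variable (N) in
/-- The symmetric Fock space over `L²(ℝ₊; N)`. -/
abbrev NoiseFock := FockOn N (Set.Ici 0)

/-- The element `x_{[0,t[}` of `L²(ℝ₊; N)`: the constant `x` on `[0,t[` and zero elsewhere. -/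
def ind (x : N) (t : ℝ≥0) : L2On N (Set.Ici 0) :=
  ⟨indicatorConstLp 2 (measurableSet_Ico (a := (0 : ℝ)) (b := t))
    (by rw [Real.volume_Ico]; exact ENNReal.ofReal_ne_top) x, by
    have h := indicatorConstLp_coeFn_notMem (p := 2) (μ := (volume : Measure ℝ))
      (hs := measurableSet_Ico (a := (0 : ℝ)) (b := t))
      (hμs := by rw [Real.volume_Ico]; exact ENNReal.ofReal_ne_top) (c := x)
    filter_upwards [h] with s hs hs'
    exact hs fun hm => hs' hm.1⟩

/-- Translation by `r` on `L²(ℝ; N)`. -/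
def translate (r : ℝ≥0) :
    Lp N 2 (volume : Measure ℝ) →ₗᵢ[ℂ] Lp N 2 (volume : Measure ℝ) :=
  Lp.compMeasurePreservingₗᵢ ℂ (fun s : ℝ => s - r) (measurePreserving_sub_right volume (r : ℝ))

theorem translate_mem (r : ℝ≥0) {f : Lp N 2 (volume : Measure ℝ)} (hf : f ∈ L2On N (Set.Ici 0)) :
    translate r f ∈ L2On N (Set.Ici (r : ℝ)) := by
  have hmp := measurePreserving_sub_right volume (r : ℝ)
  have h1 := hmp.quasiMeasurePreserving.ae hf
  have h2 : ∀ᵐ s : ℝ, translate r f s = f (s - r) := Lp.coeFn_compMeasurePreserving f hmp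
  filter_upwards [h1, h2] with s h1 h2 hs
  rw [h2, h1]
  simpa using hs

/-- The right shift `s_r : L²(ℝ₊; N) → L²([r,∞[; N)`. -/
def shiftL2 (r : ℝ≥0) : L2On N (Set.Ici 0) →ₗᵢ[ℂ] L2On N (Set.Ici (r : ℝ)) where
  toFun f := ⟨translate r f.1, translate_mem r f.2⟩
  map_add' f g := Subtype.ext (map_add (translate r) f.1 g.1)
  map_smul' c f := Subtype.ext (map_smul (translate r) c f.1)
  norm_map' f := (translate r).norm_map f.1

/-- The inclusion `L²(J; N) → L²(J'; N)` for `J ⊆ J'`. -/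
def inclL2 {J J' : Set ℝ} (h : J ⊆ J') : L2On N J →ₗᵢ[ℂ] L2On N J' where
  toLinearMap := Submodule.inclusion (L2On_mono h)
  norm_map' _ := rfl

/-- For disjoint `J₁, J₂ ⊆ ℝ₊`, the isometry `(H ⊗ Fock_{J₁}) ⊗ Fock_{J₂} → H ⊗ Fock`,
`(u ⊗ ϖ(f)) ⊗ ϖ(g) ↦ u ⊗ ϖ(f + g)`, which is surjective if `J₁ ∪ J₂ = ℝ₊` and is then the
natural identification of these spaces. -/
def factor (N H : Type*) [NormedAddCommGroup N] [InnerProductSpace ℂ N]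
    [NormedAddCommGroup H] [InnerProductSpace ℂ H]
    (J₁ J₂ : Set ℝ) (h₁ : J₁ ⊆ Set.Ici 0) (h₂ : J₂ ⊆ Set.Ici 0) (h : Disjoint J₁ J₂) :
    (H ⊗ₕ FockOn N J₁) ⊗ₕ FockOn N J₂ →ₗᵢ[ℂ] H ⊗ₕ NoiseFock N :=
  fockFactor H (L2On_mono h₁) (L2On_mono h₂) (L2On_isOrtho h)

theorem Ico_sub (r : ℝ≥0) : Set.Ico (0 : ℝ) r ⊆ Set.Ici 0 := fun _ h => h.1

theorem Ici_sub (r : ℝ≥0) : Set.Ici (r : ℝ) ⊆ Set.Ici 0 :=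
  fun _ h => le_trans r.2 h

theorem disj (r : ℝ≥0) : Disjoint (Set.Ico (0 : ℝ) r) (Set.Ici (r : ℝ)) :=
  Set.disjoint_left.2 fun _ h h' => not_le_of_gt h.2 h'

/-- The identification `(H ⊗ Fock_{[0,r[}) ⊗ Fock_{[r,∞[} = H ⊗ Fock`. -/
def factorPF (N H : Type*) [NormedAddCommGroup N] [InnerProductSpace ℂ N]
    [NormedAddCommGroup H] [InnerProductSpace ℂ H] (r : ℝ≥0) :
    (H ⊗ₕ FockOn N (Set.Ico (0 : ℝ) r)) ⊗ₕ FockOn N (Set.Ici (r : ℝ)) →ₗᵢ[ℂ] H ⊗ₕ NoiseFock N :=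
  factor N H _ _ (Ico_sub r) (Ici_sub r) (disj r)

/-- The identification `(H ⊗ Fock_{[r,∞[}) ⊗ Fock_{[0,r[} = H ⊗ Fock`. -/
def factorFP (N H : Type*) [NormedAddCommGroup N] [InnerProductSpace ℂ N]
    [NormedAddCommGroup H] [InnerProductSpace ℂ H] (r : ℝ≥0) :
    (H ⊗ₕ FockOn N (Set.Ici (r : ℝ))) ⊗ₕ FockOn N (Set.Ico (0 : ℝ) r) →ₗᵢ[ℂ] H ⊗ₕ NoiseFock N :=
  factor N H _ _ (Ici_sub r) (Ico_sub r) (disj r).symm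

end Noise

/-! ### Quantum stochastic processes and cocycles -/

section Operators

variable {A A' B B' : Type*}
  [NormedAddCommGroup A] [InnerProductSpace ℂ A] [CompleteSpace A]
  [NormedAddCommGroup A'] [InnerProductSpace ℂ A'] [CompleteSpace A']
  [NormedAddCommGroup B] [InnerProductSpace ℂ B] [CompleteSpace B]
  [NormedAddCommGroup B'] [InnerProductSpace ℂ B'] [CompleteSpace B']

/-- The map `T ↦ R T S` on operators. -/
def sandwich (R : A' →L[ℂ] B') (S : B →L[ℂ] A) : (A →L[ℂ] A') →ₗ[ℂ] (B →L[ℂ] B') where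
  toFun T := R ∘L T ∘L S
  map_add' T T' := by simp [ContinuousLinearMap.comp_add, ContinuousLinearMap.add_comp]
  map_smul' c T := by simp [ContinuousLinearMap.smul_comp]

/-- Transport `T ↦ U' T U*` of operators along isometries. -/
def transport (U' : A' →ₗᵢ[ℂ] B') (U : A →ₗᵢ[ℂ] B) : (A →L[ℂ] A') →ₗ[ℂ] (B →L[ℂ] B') :=
  sandwich U'.toContinuousLinearMap U.toContinuousLinearMap.adjoint

end Operators

section Cocycles

variable {N H H' E : Type*}
  [NormedAddCommGroup N] [InnerProductSpace ℂ N]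
  [NormedAddCommGroup H] [InnerProductSpace ℂ H] [CompleteSpace H]
  [NormedAddCommGroup H'] [InnerProductSpace ℂ H'] [CompleteSpace H']
  [NormedAddCommGroup E] [InnerProductSpace ℂ E] [CompleteSpace E]

/-- Adaptedness at time `t`: `T` belongs to `V ⊗_M B(Fock_{[0,t[}) ⊗ I_{[t,∞[}`. -/
def IsAdapted (V : Submodule ℂ (H →L[ℂ] H')) (t : ℝ≥0)
    (T : H ⊗ₕ NoiseFock N →L[ℂ] H' ⊗ₕ NoiseFock N) : Prop :=
  ∃ S ∈ matrixSpace V (FockOn N (Set.Ico (0 : ℝ) t)),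
    T = transport (factorPF N H' t) (factorPF N H t) (opTensor S (ContinuousLinearMap.id ℂ _))

/-- The identification of operators from `H ⊗ Fock` to `H' ⊗ Fock` with operators from
`H ⊗ Fock_{[r,∞[}` to `H' ⊗ Fock_{[r,∞[}` through the right shift by `r`. -/
def shiftOp (r : ℝ≥0) : (H ⊗ₕ NoiseFock N →L[ℂ] H' ⊗ₕ NoiseFock N) →ₗ[ℂ]
    (H ⊗ₕ FockOn N (Set.Ici (r : ℝ)) →L[ℂ] H' ⊗ₕ FockOn N (Set.Ici (r : ℝ))) :=
  sandwich
    (opTensor (ContinuousLinearMap.id ℂ H') (fockMap (shiftL2 (N := N) r)).toContinuousLinearMap)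
    (opTensor (ContinuousLinearMap.id ℂ H)
      (fockMap (shiftL2 (N := N) r)).toContinuousLinearMap).adjoint

/-- The shift `σ_r` on operators from `H ⊗ Fock` to `H' ⊗ Fock`: shift to `Fock_{[r,∞[}` and
tensor with the identity operator of `Fock_{[0,r[}`. -/
def sigma (r : ℝ≥0) (T : H ⊗ₕ NoiseFock N →L[ℂ] H' ⊗ₕ NoiseFock N) :
    H ⊗ₕ NoiseFock N →L[ℂ] H' ⊗ₕ NoiseFock N :=
  transport (factorFP N H' r) (factorFP N H r) (opTensor (shiftOp r T) (ContinuousLinearMap.id ℂ _))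

theorem adjoint_opTensor_id {F F' : Type*}
    [NormedAddCommGroup F] [InnerProductSpace ℂ F] [CompleteSpace F]
    [NormedAddCommGroup F'] [InnerProductSpace ℂ F'] [CompleteSpace F']
    (R : F →L[ℂ] F') (v : H) (y : F') :
    (opTensor (ContinuousLinearMap.id ℂ H) R).adjoint (tmul v y) = tmul v (R.adjoint y) := by
  refine inner_ext_tmul fun u e => ?_
  rw [ContinuousLinearMap.adjoint_inner_left, opTensor_tmul, inner_tmul, inner_tmul,
    ContinuousLinearMap.adjoint_inner_left, ContinuousLinearMap.id_apply]

theorem slice_sandwich {F F' : Type*}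
    [NormedAddCommGroup F] [InnerProductSpace ℂ F] [CompleteSpace F]
    [NormedAddCommGroup F'] [InnerProductSpace ℂ F'] [CompleteSpace F']
    (R : F →L[ℂ] F') (x y : F') (T : H ⊗ₕ F →L[ℂ] H' ⊗ₕ F) :
    slice x y (sandwich (opTensor (ContinuousLinearMap.id ℂ H') R)
      (opTensor (ContinuousLinearMap.id ℂ H) R).adjoint T)
      = slice (R.adjoint x) (R.adjoint y) T := by
  refine clm_ext_inner fun v' v => ?_
  rw [inner_slice, inner_slice]
  change ⟪_, opTensor _ R (T ((opTensor _ R).adjoint (tmul v y)))⟫_ℂ = _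
  rw [← ContinuousLinearMap.adjoint_inner_left, adjoint_opTensor_id, adjoint_opTensor_id]

/-- `shiftOp`, as a map from `V ⊗_M B(Fock)` to `V ⊗_M B(Fock_{[r,∞[})`: the shift `σ_r`, under
the identification of the latter with the range of `σ_r`. -/
def shiftMS (V : Submodule ℂ (H →L[ℂ] H')) (r : ℝ≥0) :
    matrixSpace V (NoiseFock N) →ₗ[ℂ] matrixSpace V (FockOn N (Set.Ici (r : ℝ))) :=
  (shiftOp r).restrict fun T hT x y => by
    rw [shiftOp, slice_sandwich]
    exact hT _ _

/-- The compression to `H ⊗ Fock_{[0,r[} → H' ⊗ Fock_{[0,r[}` of an operator from `H ⊗ Fock` to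
`H' ⊗ Fock`, where `Fock_{[0,r[}` is included in `Fock` through `ϖ(f) ↦ ϖ(f)`. If
`T = S ⊗ I_{[r,∞[}` then this is `S`. -/
def compress (r : ℝ≥0) : (H ⊗ₕ NoiseFock N →L[ℂ] H' ⊗ₕ NoiseFock N) →ₗ[ℂ]
    (H ⊗ₕ FockOn N (Set.Ico (0 : ℝ) r) →L[ℂ] H' ⊗ₕ FockOn N (Set.Ico (0 : ℝ) r)) :=
  sandwich
    (opTensor (ContinuousLinearMap.id ℂ H')
      (fockMap (inclL2 (N := N) (Ico_sub r))).toContinuousLinearMap).adjoint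
    (opTensor (ContinuousLinearMap.id ℂ H)
      (fockMap (inclL2 (N := N) (Ico_sub r))).toContinuousLinearMap)

theorem IsCompletelyBounded.compress {V : Submodule ℂ (H →L[ℂ] H')} (r : ℝ≥0)
    {φ : V →ₗ[ℂ] (H ⊗ₕ NoiseFock N →L[ℂ] H' ⊗ₕ NoiseFock N)} (hφ : IsCompletelyBounded φ) :
    IsCompletelyBounded (QS.compress r ∘ₗ φ) := by
  obtain ⟨C, hC⟩ := hφ
  refine ⟨‖(opTensor (ContinuousLinearMap.id ℂ H')
      (fockMap (inclL2 (N := N) (Ico_sub r))).toContinuousLinearMap).adjoint‖ *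
    ‖opTensor (ContinuousLinearMap.id ℂ H)
      (fockMap (inclL2 (N := N) (Ico_sub r))).toContinuousLinearMap‖ * C, fun n A => ?_⟩
  refine (norm_matOp_sandwich_le _ _ fun i j => φ (A i j)).trans ?_
  rw [mul_assoc _ C]
  exact mul_le_mul_of_nonneg_left (hC n A) (by positivity)

/-- The map `k̂_r = φ ⊗_M id_{B(Fock_{[r,∞[})}` on `V ⊗_M B(Fock_{[r,∞[})`, for an adapted
`φ = k_r`, viewed as a map into `V ⊗_M B(Fock_{[0,r[})`; the values are regarded as operators from
`H ⊗ Fock` to `H' ⊗ Fock`. -/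
def hat {V : Submodule ℂ (H →L[ℂ] H')} (r : ℝ≥0)
    (φ : V →ₗ[ℂ] (H ⊗ₕ NoiseFock N →L[ℂ] H' ⊗ₕ NoiseFock N)) :
    matrixSpace V (FockOn N (Set.Ici (r : ℝ))) →ₗ[ℂ]
      (H ⊗ₕ NoiseFock N →L[ℂ] H' ⊗ₕ NoiseFock N) :=
  transport (factorPF N H' r) (factorPF N H r) ∘ₗ
    lift (compress r ∘ₗ φ) (FockOn N (Set.Ici (r : ℝ)))

/-- Completely bounded quantum stochastic processes on `V`. -/
structure IsQSProcess (V : Submodule ℂ (H →L[ℂ] H'))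
    (k : ℝ≥0 → V →ₗ[ℂ] (H ⊗ₕ NoiseFock N →L[ℂ] H' ⊗ₕ NoiseFock N)) : Prop where
  cb : ∀ t, IsCompletelyBounded (k t)
  mem : ∀ t a, k t a ∈ matrixSpace V (NoiseFock N)
  adapted : ∀ t a, IsAdapted V t (k t a)

/-- Quantum stochastic cocycles on `V`: `k_0(a) = a ⊗ I` and `k_{r+t} = k̂_r ∘ σ_r ∘ k_t`. -/
structure IsQSCocycle (V : Submodule ℂ (H →L[ℂ] H'))
    (k : ℝ≥0 → V →ₗ[ℂ] (H ⊗ₕ NoiseFock N →L[ℂ] H' ⊗ₕ NoiseFock N)) : Prop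
    extends IsQSProcess V k where
  zero : ∀ a : V, k 0 a = opTensor (a : H →L[ℂ] H') (ContinuousLinearMap.id ℂ (NoiseFock N))
  cocycle : ∀ r t a, k (r + t) a = hat r (k r) (shiftMS (N := N) V r ⟨k t a, mem t a⟩)

/-- The maps `𝒫^{x,y}_t(a) = E(x_{[0,t[})* k_t(a) E(y_{[0,t[})` on `V` associated with a process
`k` on `V`, for `x, y` in the noise dimension space. -/
def IsQSProcess.assocMap {V : Submodule ℂ (H →L[ℂ] H')}
    {k : ℝ≥0 → V →ₗ[ℂ] (H ⊗ₕ NoiseFock N →L[ℂ] H' ⊗ₕ NoiseFock N)} (hk : IsQSProcess V k)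
    (x y : N) (t : ℝ≥0) : Module.End ℂ V :=
  entry V (coh (ind x t)) (coh (ind y t)) ∘ₗ
    (k t).codRestrict (matrixSpace V (NoiseFock N)) (hk.mem t)

/-- One-parameter semigroups. -/
def IsSemigroup {M : Type*} [Monoid M] (P : ℝ≥0 → M) : Prop :=
  P 0 = 1 ∧ ∀ s t, P (s + t) = P s * P t

/-- Bounded quantum stochastic processes on the Hilbert space `H`. -/
def IsOpProcess (X : ℝ≥0 → H ⊗ₕ NoiseFock N →L[ℂ] H ⊗ₕ NoiseFock N) : Prop :=
  ∀ t, IsAdapted ⊤ t (X t)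

/-- Left quantum stochastic cocycles on `H`. -/
structure IsLeftOpCocycle (X : ℝ≥0 → H ⊗ₕ NoiseFock N →L[ℂ] H ⊗ₕ NoiseFock N) : Prop where
  process : IsOpProcess X
  zero : X 0 = 1
  cocycle : ∀ r t, X (r + t) = X r * sigma r (X t)

/-- Right quantum stochastic cocycles on `H`. -/
structure IsRightOpCocycle (X : ℝ≥0 → H ⊗ₕ NoiseFock N →L[ℂ] H ⊗ₕ NoiseFock N) : Prop where
  process : IsOpProcess X
  zero : X 0 = 1
  cocycle : ∀ r t, X (r + t) = sigma r (X t) * X r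

/-- The operators `X^{x,y}_t = E(x_{[0,t[})* X_t E(y_{[0,t[})` on `H` associated with an operator
process `X` on `H`. -/
def assocOp (X : ℝ≥0 → H ⊗ₕ NoiseFock N →L[ℂ] H ⊗ₕ NoiseFock N) (x y : N) (t : ℝ≥0) :
    H →L[ℂ] H :=
  slice (coh (ind x t)) (coh (ind y t)) (X t)

/-- The lifting `φ^E : V ⊗_M B(E) → V ⊗_M B(E ⊗ Fock)` of `φ : V → V ⊗_M B(Fock)`: the matrix
space lifting followed by the tensor flip exchanging `Fock` and `E`. -/
def flipLift {V : Submodule ℂ (H →L[ℂ] H')}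
    (φ : V →ₗ[ℂ] (H ⊗ₕ NoiseFock N →L[ℂ] H' ⊗ₕ NoiseFock N)) (E : Type*)
    [NormedAddCommGroup E] [InnerProductSpace ℂ E] [CompleteSpace E] :
    matrixSpace V E →ₗ[ℂ]
      ((H ⊗ₕ E) ⊗ₕ NoiseFock N →L[ℂ] (H' ⊗ₕ E) ⊗ₕ NoiseFock N) :=
  transport (flip H' (NoiseFock N) E) (flip H (NoiseFock N) E) ∘ₗ lift φ E

/-- The operator `I_H ⊗ S` on `(H ⊗ E) ⊗ F = H ⊗ (E ⊗ F)`. -/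
def ampliate (H : Type*) [NormedAddCommGroup H] [InnerProductSpace ℂ H] [CompleteSpace H]
    {F : Type*} [NormedAddCommGroup F] [InnerProductSpace ℂ F]
    (S : E ⊗ₕ F →L[ℂ] E ⊗ₕ F) : (H ⊗ₕ E) ⊗ₕ F →L[ℂ] (H ⊗ₕ E) ⊗ₕ F :=
  (assoc H E F).toContinuousLinearMap.adjoint ∘L opTensor (ContinuousLinearMap.id ℂ H) S ∘L
    (assoc H E F).toContinuousLinearMap

end Cocycles

/-! ### The Weyl process of a map into the noise dimension space -/

section WeylProcess

variable {N I : Type*} [NormedAddCommGroup N] [InnerProductSpace ℂ N]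

/-- The Hilbert space `l²(I)`. -/
abbrev ell2 (I : Type*) := lp (fun _ : I => ℂ) 2

open Classical in
/-- The standard orthonormal basis of `l²(I)`. -/
def delta (α : I) : ell2 I := lp.single 2 α (1 : ℂ)

theorem inner_delta_self (α : I) : ⟪delta α, delta α⟫_ℂ = 1 := by
  classical
  rw [delta, lp.inner_single_left]
  simp

theorem inner_delta_ne {α β : I} (h : α ≠ β) : ⟪delta α, delta β⟫_ℂ = 0 := by
  classical
  rw [delta, delta, lp.inner_single_left]
  simp [lp.single_apply, h]

theorem isTotal_delta : IsTotal (delta : I → ell2 I) := by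
  classical
  refine isTotal_of_eq_zero fun z hz => lp.ext (funext fun α => ?_)
  have := hz α
  rw [delta, lp.inner_single_right] at this
  simpa using this

theorem inner_weylIsometry (Γ : I → N) (t : ℝ≥0) (p q : I × NoiseFock N) :
    ⟪tmul (delta p.1) (weyl (ind (Γ p.1) t) p.2), tmul (delta q.1) (weyl (ind (Γ q.1) t) q.2)⟫_ℂ
      = ⟪tmul (delta p.1) p.2, tmul (delta q.1) q.2⟫_ℂ := by
  rw [inner_tmul, inner_tmul]
  by_cases h : p.1 = q.1
  · rw [h, LinearIsometry.inner_map_map]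
  · rw [inner_delta_ne h, zero_mul, zero_mul]

/-- The operator `W^Γ_t : δ^α ⊗ ξ ↦ δ^α ⊗ W(Γ(α)_{[0,t[}) ξ` on `l²(I) ⊗ Fock`. -/
def weylIsometry (Γ : I → N) (t : ℝ≥0) :
    ell2 I ⊗ₕ NoiseFock N →ₗᵢ[ℂ] ell2 I ⊗ₕ NoiseFock N :=
  isometryOfTotal (fun p : I × NoiseFock N => tmul (delta p.1) p.2)
    (fun p => tmul (delta p.1) (weyl (ind (Γ p.1) t) p.2))
    (isTotal_tmul (a := delta) (b := fun ξ : NoiseFock N => ξ) isTotal_delta isTotal_id)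
    (inner_weylIsometry Γ t)

/-- The process `W^Γ` on `l²(I)`. -/
def weylProcess (Γ : I → N) (t : ℝ≥0) : ell2 I ⊗ₕ NoiseFock N →L[ℂ] ell2 I ⊗ₕ NoiseFock N :=
  (weylIsometry Γ t).toContinuousLinearMap

theorem weylProcess_tmul (Γ : I → N) (t : ℝ≥0) (α : I) (ξ : NoiseFock N) :
    weylProcess Γ t (tmul (delta α) ξ) = tmul (delta α) (weyl (ind (Γ α) t) ξ) :=
  isometryOfTotal_apply (fun p : I × NoiseFock N => tmul (delta p.1) p.2)
    (fun p => tmul (delta p.1) (weyl (ind (Γ p.1) t) p.2))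
    (isTotal_tmul (a := delta) (b := fun ξ : NoiseFock N => ξ) isTotal_delta isTotal_id)
    (inner_weylIsometry Γ t) (α, ξ)

variable {H H' : Type*}
  [NormedAddCommGroup H] [InnerProductSpace ℂ H] [CompleteSpace H]
  [NormedAddCommGroup H'] [InnerProductSpace ℂ H'] [CompleteSpace H']

/-- The maps `K^Γ_t = (I ⊗ W^Γ_t)* k^{l²(I)}_t(·) (I ⊗ W^Γ_t)` on `V ⊗_M B(l²(I))`. -/
def perturbedLift {V : Submodule ℂ (H →L[ℂ] H')} (Γ : I → N)
    (k : ℝ≥0 → V →ₗ[ℂ] (H ⊗ₕ NoiseFock N →L[ℂ] H' ⊗ₕ NoiseFock N)) (t : ℝ≥0) :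
    matrixSpace V (ell2 I) →ₗ[ℂ]
      ((H ⊗ₕ ell2 I) ⊗ₕ NoiseFock N →L[ℂ] (H' ⊗ₕ ell2 I) ⊗ₕ NoiseFock N) :=
  sandwich (ampliate H' (weylProcess Γ t)).adjoint (ampliate H (weylProcess Γ t)) ∘ₗ
    flipLift (k t) (ell2 I)

end WeylProcess

end QS

end

open scoped TensorProduct InnerProductSpace NNReal ENNReal

noncomputable section

namespace QS

set_option linter.unusedSectionVars false

attribute [-instance] WithCStarModule.instCStarModuleComplex


/-! ### Slices and total families -/

section Slices

variable {H H' G G' K L : Type*}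
  [NormedAddCommGroup H] [InnerProductSpace ℂ H] [CompleteSpace H]
  [NormedAddCommGroup H'] [InnerProductSpace ℂ H'] [CompleteSpace H']
  [NormedAddCommGroup G] [InnerProductSpace ℂ G] [CompleteSpace G]
  [NormedAddCommGroup G'] [InnerProductSpace ℂ G'] [CompleteSpace G']
  [NormedAddCommGroup K] [InnerProductSpace ℂ K]
  [NormedAddCommGroup L] [InnerProductSpace ℂ L]

/-! Exponential vectors turn orthogonal sums of functions into tensor products. Hence every operator
involved is determined by its slices between vectors `coh (join r f g)`, where `f` lives on [0,r[
and `g` is shifted so as to start at time `r`. In these coordinates adaptedness is a factorisation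
of slices (`IsAdapted.slice_coh_join` and its converse), the shift and the map k̂_r have explicit
formulas (`sigma_tmul_coh_join`, `slice_hat_shiftMS`), and the cocycle identities reduce to
identities between scalar phases.

The constant function on [0,r+t[ is the join of the constant functions on [0,r[ and [0,t[
(`ind_add_time`), and inner products add over joins (`inner_join`). So W(x_{[0,r+t[}) acts
separately on past and future, and its phase is the product of the two phases
(`weyl_ind_add_coh_join`). Applied on each δ^α, this is the cocycle identity for W^Γ. The two
actions concern different pieces of the join, so either order is allowed, which gives the left and
the right identity. Unitarity holds because W^{-Γ} is a right inverse of the isometry W^Γ.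

The associated semigroups of W^Γ are diagonal, with eigenvalues exp(tλ_α), where λ_α has real part
-‖x - Γ(α) - y‖²/2 (`re_weylExponent`). Closeness to the identity at one positive time bounds these
real parts, hence Γ. Conversely, a bounded Γ gives bounded λ_α in the left half-plane, where exp is
a contraction, so the semigroup is Lipschitz.

For the perturbed lifting everything rests on `slice_slice_perturbedLift`: the (α,β) entry of a
slice of K^Γ_t(A) at ξ, η is the slice of k_t(a^α_β) at W(Γ(α)_{[0,t[})ξ and W(Γ(β)_{[0,t[})η. The
cocycle property of k and the splitting of the Weyl phases then give that of K^Γ, and ξ = η = vacuum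
gives the Schur action. Two analytic facts complete the argument. A finite matrix over V ⊗_M B(K) is
an element of V ⊗_M B(K ⊗ ℂⁿ), so liftings are completely bounded (`IsCompletelyBounded.lift`).
Since V is closed, membership of a matrix space can be checked on a basis
(`mem_matrixSpace_of_isTotal`). -/

theorem smul_tmul (c : ℂ) (u : H) (e : K) : tmul (c • u) e = c • tmul u e := by
  rw [tmul, ← TensorProduct.smul_tmul', map_smul]
  rfl

theorem IsTotal.eq_of_inner {X E : Type*} [NormedAddCommGroup E] [InnerProductSpace ℂ E]
    {a : X → E} (ha : IsTotal a) {z w : E} (h : ∀ x, ⟪z, a x⟫_ℂ = ⟪w, a x⟫_ℂ) : z = w := by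
  rw [← sub_eq_zero]
  exact ha.eq_zero fun x => by rw [inner_sub_left, h, sub_self]

theorem IsTotal.clm_ext {X E F : Type*} [NormedAddCommGroup E] [InnerProductSpace ℂ E]
    [NormedAddCommGroup F] [NormedSpace ℂ F] {a : X → E} (ha : IsTotal a) {S T : E →L[ℂ] F}
    (h : ∀ x, S (a x) = T (a x)) : S = T := by
  refine ContinuousLinearMap.ext_on ha ?_
  rintro _ ⟨x, rfl⟩
  exact h x

/-- Tensors with second factor in a total family are total. This allows operators to be compared on
exponential vectors of the noise and on the basis of l²(I) only. -/
theorem ext_slice_of_isTotal {X Y : Type*} {a : X → L} {b : Y → K} (ha : IsTotal a)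
    (hb : IsTotal b) {S T : H ⊗ₕ K →L[ℂ] H' ⊗ₕ L}
    (h : ∀ i j, slice (a i) (b j) S = slice (a i) (b j) T) : S = T := by
  refine (isTotal_tmul (a := fun u : H => u) isTotal_id hb).clm_ext fun p => ?_
  refine (isTotal_tmul (a := fun u : H' => u) isTotal_id ha).eq_of_inner fun q => ?_
  rw [← inner_conj_symm, ← inner_conj_symm (T _), ← inner_slice, ← inner_slice, h]

theorem slice_add_left (x x' : L) (y : K) (T : H ⊗ₕ K →L[ℂ] H' ⊗ₕ L) :
    slice (x + x') y T = slice x y T + slice x' y T := by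
  refine clm_ext_inner fun v' v => ?_
  rw [add_apply, inner_add_right]
  simp only [inner_slice, tmul_add, inner_add_left]

theorem slice_smul_left (c : ℂ) (x : L) (y : K) (T : H ⊗ₕ K →L[ℂ] H' ⊗ₕ L) :
    slice (c • x) y T = starRingEnd ℂ c • slice x y T := by
  refine clm_ext_inner fun v' v => ?_
  rw [smul_apply, inner_smul_right]
  simp only [inner_slice, tmul_smul, inner_smul_left]

theorem slice_add_right (x : L) (y y' : K) (T : H ⊗ₕ K →L[ℂ] H' ⊗ₕ L) :
    slice x (y + y') T = slice x y T + slice x y' T := by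
  refine clm_ext_inner fun v' v => ?_
  rw [add_apply, inner_add_right]
  simp only [inner_slice, tmul_add, map_add, inner_add_right]

theorem slice_smul_right (c : ℂ) (x : L) (y : K) (T : H ⊗ₕ K →L[ℂ] H' ⊗ₕ L) :
    slice x (c • y) T = c • slice x y T := by
  refine clm_ext_inner fun v' v => ?_
  rw [smul_apply, inner_smul_right]
  simp only [inner_slice, tmul_smul, map_smul, inner_smul_right]

theorem slice_zero_left (y : K) (T : H ⊗ₕ K →L[ℂ] H' ⊗ₕ L) : slice (0 : L) y T = 0 := by
  simpa using slice_smul_left 0 (0 : L) y T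

theorem slice_zero_right (x : L) (T : H ⊗ₕ K →L[ℂ] H' ⊗ₕ L) : slice x (0 : K) T = 0 := by
  simpa using slice_smul_right 0 x (0 : K) T

theorem slice_smul (c : ℂ) (x : L) (y : K) (T : H ⊗ₕ K →L[ℂ] H' ⊗ₕ L) :
    slice x y (c • T) = c • slice x y T := by
  simp [slice, ContinuousLinearMap.smul_comp]

theorem slice_sum {ι : Type*} (s : Finset ι) (x : L) (y : K)
    (T : ι → (H ⊗ₕ K →L[ℂ] H' ⊗ₕ L)) :
    slice x y (∑ i ∈ s, T i) = ∑ i ∈ s, slice x y (T i) := by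
  simp only [slice, ContinuousLinearMap.finsetSum_comp, ContinuousLinearMap.comp_finsetSum]

theorem slice_opTensor_id (x y : K) (S : H →L[ℂ] H') :
    slice x y (opTensor S (ContinuousLinearMap.id ℂ K)) = ⟪x, y⟫_ℂ • S := by
  refine clm_ext_inner fun v' v => ?_
  rw [inner_slice, opTensor_tmul, inner_tmul, smul_apply, inner_smul_right,
    mul_comm]
  rfl

/-- Continuity here is in operator norm. It makes slices norm continuous in each vector, as needed
to exploit norm closedness of the operator space. -/
theorem continuous_ket : Continuous fun e : K => ket H e := by
  unfold ket
  exact continuous_const.clm_comp (TensorProduct.mkL ℂ H K).flip.continuous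

theorem continuous_slice_left (y : K) (T : H ⊗ₕ K →L[ℂ] H' ⊗ₕ L) :
    Continuous fun x : L => slice x y T := by
  unfold slice
  exact (ContinuousLinearMap.adjoint.continuous.comp continuous_ket).clm_comp continuous_const

theorem continuous_slice_right (x : L) (T : H ⊗ₕ K →L[ℂ] H' ⊗ₕ L) :
    Continuous fun y : K => slice x y T := by
  unfold slice
  exact continuous_const.clm_comp (continuous_const.clm_comp continuous_ket)

/-- Over a closed space of operators, membership of a matrix space may be tested on a
total family. -/
theorem mem_matrixSpace_of_isTotal {V : Submodule ℂ (H →L[ℂ] H')}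
    (hV : IsClosed (V : Set (H →L[ℂ] H'))) {X : Type*} {a : X → K} (ha : IsTotal a)
    {T : H ⊗ₕ K →L[ℂ] H' ⊗ₕ K} (h : ∀ i j, slice (a i) (a j) T ∈ V) : T ∈ matrixSpace V K := by
  -- One variable at a time: the vectors giving a slice in V form a subspace, closed because V is
  -- closed, and it contains the total family.
  have h1 : ∀ (x : K) (j : X), slice x (a j) T ∈ V := by
    intro x j
    refine ha.induction (P := fun x => slice x (a j) T ∈ V) (fun x hx => ?_)
      (hV.preimage (continuous_slice_left _ _)) x
    induction hx using Submodule.span_induction with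
    | mem x hx => obtain ⟨i, rfl⟩ := hx; exact h i j
    | zero => rw [slice_zero_left]; exact V.zero_mem
    | add x y _ _ h1 h2 => rw [slice_add_left]; exact V.add_mem h1 h2
    | smul c x _ h1 => rw [slice_smul_left]; exact V.smul_mem _ h1
  intro x y
  refine ha.induction (P := fun y => slice x y T ∈ V) (fun y hy => ?_)
    (hV.preimage (continuous_slice_right _ _)) y
  induction hy using Submodule.span_induction with
  | mem y hy => obtain ⟨j, rfl⟩ := hy; exact h1 x j
  | zero => rw [slice_zero_right]; exact V.zero_mem
  | add x y _ _ h1 h2 => rw [slice_add_right]; exact V.add_mem h1 h2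
  | smul c x _ h1 => rw [slice_smul_right]; exact V.smul_mem _ h1

/-- The tensor and Fock space identifications are given as isometries without inverses. U*U = I is
what allows transported operators to be evaluated on vectors in the range of U. -/
theorem adjoint_linearIsometry_apply {E F : Type*} [NormedAddCommGroup E]
    [InnerProductSpace ℂ E] [CompleteSpace E] [NormedAddCommGroup F] [InnerProductSpace ℂ F]
    [CompleteSpace F] (U : E →ₗᵢ[ℂ] F) (z : E) : U.toContinuousLinearMap.adjoint (U z) = z := by
  refine ext_inner_right ℂ fun w => ?_
  rw [ContinuousLinearMap.adjoint_inner_left]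
  exact U.inner_map_map z w

end Slices

/-! ### Complete boundedness of matrix space liftings -/

section Lift

variable {H H' G G' K L : Type*}
  [NormedAddCommGroup H] [InnerProductSpace ℂ H] [CompleteSpace H]
  [NormedAddCommGroup H'] [InnerProductSpace ℂ H'] [CompleteSpace H']
  [NormedAddCommGroup G] [InnerProductSpace ℂ G] [CompleteSpace G]
  [NormedAddCommGroup G'] [InnerProductSpace ℂ G'] [CompleteSpace G']
  [NormedAddCommGroup K] [InnerProductSpace ℂ K]

/-- An operator on a Hilbert space tensor product is bounded by the supremum of the norms of its
finite matrices of slices. -/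
theorem norm_le_of_matOp_slice_le {S : G ⊗ₕ K →L[ℂ] G' ⊗ₕ K} {C : ℝ} (hC : 0 ≤ C)
    (h : ∀ (n : ℕ) (e : Fin n → K), Orthonormal ℂ e →
      ‖matOp fun i j => slice (e i) (e j) S‖ ≤ C) : ‖S‖ ≤ C := by
  -- Two algebraic tensors expand over one common finite orthonormal family of `K`, so their matrix
  -- element is that of a finite matrix of slices.
  have hbd : ∀ (z : G' ⊗[ℂ] K) (w : G ⊗[ℂ] K),
      ‖⟪HTensor.incl z, S (HTensor.incl w)⟫_ℂ‖ ≤ C * ‖z‖ * ‖w‖ := by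
    intro z w
    obtain ⟨n, e, he, ⟨v', rfl⟩, ⟨v, rfl⟩⟩ := exists_orthonormal_repr z w
    have h1 : ⟪HTensor.incl (∑ i, v' i ⊗ₜ[ℂ] e i), S (HTensor.incl (∑ i, v i ⊗ₜ[ℂ] e i))⟫_ℂ
        = ⟪(WithLp.toLp 2 v' : PiLp 2 fun _ : Fin n => G'),
          matOp (fun i j => slice (e i) (e j) S) (WithLp.toLp 2 v)⟫_ℂ := by
      rw [PiLp.inner_apply, map_sum, sum_inner]
      refine Finset.sum_congr rfl fun i _ => ?_
      rw [matOp_apply, inner_sum, map_sum, map_sum, inner_sum]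
      exact Finset.sum_congr rfl fun j _ => (inner_slice _ _ _ _ _).symm
    rw [h1, norm_sum_tmul he, norm_sum_tmul he, mul_comm C, mul_assoc]
    refine (norm_inner_le_norm _ _).trans ?_
    refine mul_le_mul_of_nonneg_left ?_ (norm_nonneg _)
    exact (ContinuousLinearMap.le_opNorm (matOp fun i j => slice (e i) (e j) S)
      (WithLp.toLp 2 v : PiLp 2 fun _ : Fin n => G)).trans
      (mul_le_mul_of_nonneg_right (h n e he) (norm_nonneg _))
  have h2 : ∀ (z : G' ⊗ₕ K) (w : G ⊗ₕ K), ‖⟪z, S w⟫_ℂ‖ ≤ C * ‖z‖ * ‖w‖ := by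
    intro z w
    refine HTensor.denseRange_incl.induction (P := fun z => ‖⟪z, S w⟫_ℂ‖ ≤ C * ‖z‖ * ‖w‖) ?_
      (isClosed_le (by fun_prop) (by fun_prop)) z
    rintro _ ⟨z, rfl⟩
    refine HTensor.denseRange_incl.induction
      (P := fun w => ‖⟪HTensor.incl z, S w⟫_ℂ‖ ≤ C * ‖HTensor.incl z‖ * ‖w‖) ?_
      (isClosed_le (by fun_prop) (by fun_prop)) w
    rintro _ ⟨w, rfl⟩
    rw [HTensor.norm_incl, HTensor.norm_incl]
    exact hbd z w
  refine ContinuousLinearMap.opNorm_le_bound _ hC fun w => ?_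
  -- Testing the form bound against `S w` itself turns it into an operator bound, after cancelling a
  -- factor ‖S w‖.
  have h3 := h2 (S w) w
  have h4 : ‖⟪S w, S w⟫_ℂ‖ = ‖S w‖ * ‖S w‖ := by
    rw [inner_self_eq_norm_sq_to_K]; simp [sq]
  rw [h4, mul_comm C, mul_assoc] at h3
  rcases eq_or_lt_of_le (norm_nonneg (S w)) with h0 | h0
  · rw [← h0]; positivity
  · exact le_of_mul_le_mul_left h3 h0

/-- Along an orthonormal family the slices of the lifting are φ applied entrywise to the slices of
`T`, and the matrix of those slices has norm at most ‖T‖. The constant `C` is not assumed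
nonnegative, hence the absolute value. -/
theorem norm_lift_le {V : Submodule ℂ (H →L[ℂ] H')} {φ : V →ₗ[ℂ] (G →L[ℂ] G')} {C : ℝ}
    (hC : ∀ (n : ℕ) (A : Fin n → Fin n → V),
      ‖matOp fun i j => φ (A i j)‖ ≤ C * ‖matOp fun i j => (A i j : H →L[ℂ] H')‖)
    (T : matrixSpace V K) : ‖lift φ K T‖ ≤ |C| * ‖T.1‖ := by
  refine norm_le_of_matOp_slice_le (by positivity) fun n e he => ?_
  simp only [lift_spec φ ⟨C, hC⟩ (e _) (e _) T]
  refine (hC n fun i j => entry V (e i) (e j) T).trans ?_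
  refine (mul_le_mul_of_nonneg_right (le_abs_self C) (norm_nonneg
    (matOp fun i j => (entry V (e i) (e j) T : H →L[ℂ] H')))).trans ?_
  exact mul_le_mul_of_nonneg_left (norm_matOp_slice_le he T.1) (abs_nonneg _)

/-- The isometry `z ↦ z ⊗ eᵢ` from `H ⊗ K` to `H ⊗ (K ⊗ ℂⁿ)`. -/
def corner (H K : Type*) [NormedAddCommGroup H] [InnerProductSpace ℂ H]
    [NormedAddCommGroup K] [InnerProductSpace ℂ K] {n : ℕ} (i : Fin n) :
    H ⊗ₕ K →L[ℂ] H ⊗ₕ (K ⊗ₕ EuclideanSpace ℂ (Fin n)) :=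
  (assoc H K _).toContinuousLinearMap ∘L ket (H ⊗ₕ K) (EuclideanSpace.single i 1)

theorem inner_corner {n : ℕ} (i j : Fin n) (z w : H ⊗ₕ K) :
    ⟪corner H K i z, corner H K j w⟫_ℂ = if i = j then ⟪z, w⟫_ℂ else 0 := by
  change ⟪assoc H K _ (tmul z _), assoc H K _ (tmul w _)⟫_ℂ = _
  rw [LinearIsometry.inner_map_map, inner_tmul]
  simp [EuclideanSpace.inner_single_left]

theorem adjoint_corner_corner {n : ℕ} (i j : Fin n) (z : H ⊗ₕ K) :
    (corner H K i).adjoint (corner H K j z) = if i = j then z else 0 := by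
  refine ext_inner_left ℂ fun w => ?_
  rw [ContinuousLinearMap.adjoint_inner_right, inner_corner]
  split_ifs <;> simp

theorem corner_tmul {n : ℕ} (i : Fin n) (u : H) (x : K) :
    corner H K i (tmul u x) = tmul u (ket K (EuclideanSpace.single i 1) x) :=
  assoc_tmul _ _ _

theorem adjoint_corner_tmul [CompleteSpace K] {n : ℕ} (i : Fin n) (v : H)
    (x : K ⊗ₕ EuclideanSpace ℂ (Fin n)) : (corner H K i).adjoint (tmul v x)
      = tmul v ((ket K (EuclideanSpace.single i 1)).adjoint x) := by
  refine inner_ext_tmul fun u e => ?_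
  rw [ContinuousLinearMap.adjoint_inner_left, corner_tmul, inner_tmul, inner_tmul,
    ContinuousLinearMap.adjoint_inner_left]

/-- Slicing an operator placed at position (i,j) only slices its entry. Thus both membership of a
matrix space and the action of a lifting can be read off entrywise. -/
theorem slice_corner [CompleteSpace K] {n : ℕ} (i j : Fin n) (A : H ⊗ₕ K →L[ℂ] H' ⊗ₕ K)
    (x y : K ⊗ₕ EuclideanSpace ℂ (Fin n)) :
    slice x y (corner H' K i ∘L A ∘L (corner H K j).adjoint)
      = slice ((ket K (EuclideanSpace.single i 1)).adjoint x)
          ((ket K (EuclideanSpace.single j 1)).adjoint y) A := by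
  refine clm_ext_inner fun v' v => ?_
  rw [inner_slice, inner_slice]
  change ⟪_, corner H' K i (A ((corner H K j).adjoint (tmul v y)))⟫_ℂ = _
  rw [← ContinuousLinearMap.adjoint_inner_left, adjoint_corner_tmul, adjoint_corner_tmul]

/-- The isometry `(z_i) ↦ ∑ z_i ⊗ eᵢ` from `(H ⊗ K)ⁿ` to `H ⊗ (K ⊗ ℂⁿ)`. -/
def corners (H K : Type*) [NormedAddCommGroup H] [InnerProductSpace ℂ H]
    [NormedAddCommGroup K] [InnerProductSpace ℂ K] (n : ℕ) :
    PiLp 2 (fun _ : Fin n => H ⊗ₕ K) →L[ℂ] H ⊗ₕ (K ⊗ₕ EuclideanSpace ℂ (Fin n)) :=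
  ∑ i, corner H K i ∘L PiLp.proj 2 (fun _ : Fin n => H ⊗ₕ K) i

theorem corners_apply {n : ℕ} (z : PiLp 2 (fun _ : Fin n => H ⊗ₕ K)) :
    corners H K n z = ∑ i, corner H K i (z i) := by
  simp [corners]

theorem norm_corners_apply {n : ℕ} (z : PiLp 2 (fun _ : Fin n => H ⊗ₕ K)) :
    ‖corners H K n z‖ = ‖z‖ := by
  refine norm_eq_of_inner_eq ?_
  rw [corners_apply, sum_inner, PiLp.inner_apply]
  refine Finset.sum_congr rfl fun i _ => ?_
  rw [inner_sum, Finset.sum_eq_single i]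
  · rw [inner_corner, if_pos rfl]
  · intro j _ hj
    rw [inner_corner, if_neg hj.symm]
  · simp

theorem norm_corners_le (n : ℕ) : ‖corners H K n‖ ≤ 1 :=
  ContinuousLinearMap.opNorm_le_bound _ zero_le_one fun z => by rw [norm_corners_apply, one_mul]

/-- The operator from `H ⊗ (K ⊗ ℂⁿ)` to `H' ⊗ (K ⊗ ℂⁿ)` with matrix `A`. -/
def ofCorners {n : ℕ} (A : Fin n → Fin n → (H ⊗ₕ K →L[ℂ] H' ⊗ₕ K)) :
    H ⊗ₕ (K ⊗ₕ EuclideanSpace ℂ (Fin n)) →L[ℂ] H' ⊗ₕ (K ⊗ₕ EuclideanSpace ℂ (Fin n)) :=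
  ∑ i, ∑ j, corner H' K i ∘L A i j ∘L (corner H K j).adjoint

/-- Since the corners are orthonormal copies of `H ⊗ K`, the map `corners` intertwines the matrix
acting on the n-fold sum with the single operator acting on `H ⊗ (K ⊗ ℂⁿ)`. Being isometric, it lets
norms be compared. -/
theorem ofCorners_corners {n : ℕ} (A : Fin n → Fin n → (H ⊗ₕ K →L[ℂ] H' ⊗ₕ K))
    (z : PiLp 2 (fun _ : Fin n => H ⊗ₕ K)) :
    ofCorners A (corners H K n z) = corners H' K n (matOp A z) := by
  rw [corners_apply (H := H')]
  simp only [ofCorners, sum_apply]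
  refine Finset.sum_congr rfl fun i _ => ?_
  rw [matOp_apply, map_sum]
  refine Finset.sum_congr rfl fun j _ => ?_
  have h : (corner H K j).adjoint (corners H K n z) = z j := by
    rw [corners_apply, map_sum]
    simp [adjoint_corner_corner]
  change corner H' K i (A i j ((corner H K j).adjoint _)) = _
  rw [h]

theorem norm_matOp_le_norm_ofCorners {n : ℕ} (A : Fin n → Fin n → (H ⊗ₕ K →L[ℂ] H' ⊗ₕ K)) :
    ‖matOp A‖ ≤ ‖ofCorners A‖ := by
  refine ContinuousLinearMap.opNorm_le_bound _ (norm_nonneg _) fun z => ?_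
  have h := ContinuousLinearMap.le_opNorm (ofCorners A) (corners H K n z)
  rw [ofCorners_corners, norm_corners_apply, norm_corners_apply] at h
  exact h

theorem corners_adjoint_apply {n : ℕ} (x : H ⊗ₕ (K ⊗ₕ EuclideanSpace ℂ (Fin n))) (i : Fin n) :
    (corners H K n).adjoint x i = (corner H K i).adjoint x := by
  refine ext_inner_left ℂ fun w => ?_
  rw [ContinuousLinearMap.adjoint_inner_right]
  have h := ContinuousLinearMap.adjoint_inner_right (corners H K n)
    (PiLp.single 2 i w : PiLp 2 (fun _ : Fin n => H ⊗ₕ K)) x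
  have h2 : corners H K n (PiLp.single 2 i w : PiLp 2 (fun _ : Fin n => H ⊗ₕ K))
      = corner H K i w := by
    rw [corners_apply, Finset.sum_eq_single i]
    · simp
    · intro j _ hj; simp [hj]
    · simp
  rw [h2, PiLp.inner_apply, Finset.sum_eq_single i] at h
  · simpa using h
  · intro j _ hj; simp [hj]
  · simp

theorem norm_ofCorners_le {n : ℕ} (A : Fin n → Fin n → (H ⊗ₕ K →L[ℂ] H' ⊗ₕ K)) :
    ‖ofCorners A‖ ≤ ‖matOp A‖ := by
  -- The operator is the matrix conjugated by a contraction on each side, so its norm cannot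
  -- increase.
  have h : ofCorners A = corners H' K n ∘L matOp A ∘L (corners H K n).adjoint := by
    refine ContinuousLinearMap.ext fun x => ?_
    change _ = corners H' K n (matOp A ((corners H K n).adjoint x))
    rw [corners_apply]
    simp only [ofCorners, sum_apply, matOp_apply, map_sum,
      corners_adjoint_apply]
    rfl
  rw [h]
  refine (ContinuousLinearMap.opNorm_comp_le _ _).trans ?_
  have h1 : ‖(corners H K n).adjoint‖ ≤ 1 := by
    rw [LinearIsometryEquiv.norm_map]
    exact norm_corners_le n
  have h2 := ContinuousLinearMap.opNorm_comp_le (matOp A) (corners H K n).adjoint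
  calc ‖corners H' K n‖ * ‖matOp A ∘L (corners H K n).adjoint‖
      ≤ 1 * (‖matOp A‖ * 1) := by
        refine mul_le_mul (norm_corners_le n) (h2.trans ?_)
          (norm_nonneg (matOp A ∘L (corners H K n).adjoint)) zero_le_one
        exact mul_le_mul_of_nonneg_left h1 (norm_nonneg (matOp A))
    _ = ‖matOp A‖ := by ring

/-- Matrix space liftings of completely bounded maps are completely bounded. -/
theorem IsCompletelyBounded.lift {K : Type*} [NormedAddCommGroup K] [InnerProductSpace ℂ K]
    [CompleteSpace K] {V : Submodule ℂ (H →L[ℂ] H')} {φ : V →ₗ[ℂ] (G →L[ℂ] G')}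
    (hφ : IsCompletelyBounded φ) : IsCompletelyBounded (QS.lift φ K) := by
  obtain ⟨C, hC⟩ := id hφ
  refine ⟨|C|, fun n A => ?_⟩
  have hslice : ∀ x y, slice x y (ofCorners fun i j => (A i j : H ⊗ₕ K →L[ℂ] H' ⊗ₕ K))
      = ∑ i, ∑ j, slice ((ket K (EuclideanSpace.single i 1)).adjoint x)
          ((ket K (EuclideanSpace.single j 1)).adjoint y) (A i j).1 := fun x y => by
    simp only [ofCorners, slice_sum, slice_corner]
  have hmem : (ofCorners fun i j => (A i j : H ⊗ₕ K →L[ℂ] H' ⊗ₕ K))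
      ∈ matrixSpace V (K ⊗ₕ EuclideanSpace ℂ (Fin n)) := fun x y => by
    rw [hslice]
    exact Submodule.sum_mem _ fun i _ => Submodule.sum_mem _ fun j _ => (A i j).2 _ _
  -- The n-th matrix lifting of the lifting over `K` is the lifting over `K ⊗ ℂⁿ`. As `norm_lift_le`
  -- has the same constant for every Hilbert space, it bounds all matrix levels at once.
  have hlift : QS.lift φ (K ⊗ₕ EuclideanSpace ℂ (Fin n)) ⟨_, hmem⟩
      = ofCorners fun i j => QS.lift φ K (A i j) := by
    refine ext_slice fun x y => ?_
    rw [lift_spec φ hφ]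
    simp only [ofCorners, slice_sum, slice_corner, lift_spec φ hφ _ _ (A _ _)]
    simp only [← map_sum]
    congr 1
    refine Subtype.ext ((hslice x y).trans ?_)
    simp only [AddSubmonoidClass.coe_finsetSum]
    rfl
  refine (norm_matOp_le_norm_ofCorners _).trans ?_
  rw [← hlift]
  exact (norm_lift_le hC _).trans (mul_le_mul_of_nonneg_left (norm_ofCorners_le _) (abs_nonneg C))

theorem IsCompletelyBounded.sandwich {B B' : Type*}
    [NormedAddCommGroup B] [InnerProductSpace ℂ B] [CompleteSpace B]
    [NormedAddCommGroup B'] [InnerProductSpace ℂ B'] [CompleteSpace B']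
    {V : Submodule ℂ (H →L[ℂ] H')} {φ : V →ₗ[ℂ] (G →L[ℂ] G')}
    (hφ : IsCompletelyBounded φ) (R : G' →L[ℂ] B') (S : B →L[ℂ] G) :
    IsCompletelyBounded (QS.sandwich R S ∘ₗ φ) := by
  obtain ⟨C, hC⟩ := hφ
  refine ⟨‖R‖ * ‖S‖ * C, fun n A => ?_⟩
  refine (norm_matOp_sandwich_le _ _ fun i j => φ (A i j)).trans ?_
  rw [mul_assoc _ C]
  exact mul_le_mul_of_nonneg_left (hC n A) (by positivity)

end Lift

/-! ### Transport along isometries -/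

section Transport

variable {H H' : Type*}
  [NormedAddCommGroup H] [InnerProductSpace ℂ H] [CompleteSpace H]
  [NormedAddCommGroup H'] [InnerProductSpace ℂ H'] [CompleteSpace H']

theorem inner_transport {A A' B B' : Type*}
    [NormedAddCommGroup A] [InnerProductSpace ℂ A] [CompleteSpace A]
    [NormedAddCommGroup A'] [InnerProductSpace ℂ A'] [CompleteSpace A']
    [NormedAddCommGroup B] [InnerProductSpace ℂ B] [CompleteSpace B]
    [NormedAddCommGroup B'] [InnerProductSpace ℂ B'] [CompleteSpace B']
    (U' : A' →ₗᵢ[ℂ] B') (U : A →ₗᵢ[ℂ] B) (R : A →L[ℂ] A') (z : A') (w : A) :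
    ⟪U' z, transport U' U R (U w)⟫_ℂ = ⟪z, R w⟫_ℂ := by
  change ⟪U' z, U' (R (U.toContinuousLinearMap.adjoint (U w)))⟫_ℂ = _
  rw [LinearIsometry.inner_map_map, adjoint_linearIsometry_apply]

theorem slice_adjoint_sandwich {F F' : Type*}
    [NormedAddCommGroup F] [InnerProductSpace ℂ F] [CompleteSpace F]
    [NormedAddCommGroup F'] [InnerProductSpace ℂ F'] [CompleteSpace F']
    (R : F →ₗᵢ[ℂ] F') {x y : F} {x' y' : F'} (hx : R x = x') (hy : R y = y')
    (T : H ⊗ₕ F' →L[ℂ] H' ⊗ₕ F') : slice x y (sandwich (opTensor (ContinuousLinearMap.id ℂ H') R.toContinuousLinearMap).adjoint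
      (opTensor (ContinuousLinearMap.id ℂ H) R.toContinuousLinearMap) T)
      = slice x' y' T := by
  subst hx hy
  refine clm_ext_inner fun v' v => ?_
  rw [inner_slice, inner_slice]
  change ⟪_, ContinuousLinearMap.adjoint _ (T (opTensor _ _ _))⟫_ℂ = _
  rw [ContinuousLinearMap.adjoint_inner_right, opTensor_tmul, opTensor_tmul]
  rfl

theorem slice_sandwich_linearIsometry {F F' : Type*}
    [NormedAddCommGroup F] [InnerProductSpace ℂ F] [CompleteSpace F]
    [NormedAddCommGroup F'] [InnerProductSpace ℂ F'] [CompleteSpace F']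
    (R : F →ₗᵢ[ℂ] F') {x y : F} {x' y' : F'} (hx : R x = x') (hy : R y = y')
    (T : H ⊗ₕ F →L[ℂ] H' ⊗ₕ F) : slice x' y' (sandwich (opTensor (ContinuousLinearMap.id ℂ H') R.toContinuousLinearMap)
      (opTensor (ContinuousLinearMap.id ℂ H) R.toContinuousLinearMap).adjoint T)
      = slice x y T := by
  rw [← hx, ← hy, slice_sandwich, adjoint_linearIsometry_apply, adjoint_linearIsometry_apply]

/-- The common mechanism for all splittings of Fock space: if the isometries send split product
vectors to product vectors, a slice of the transported operator is an iterated slice of the original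
one. -/
theorem slice_transport {A A' L F F' : Type*}
    [NormedAddCommGroup A] [InnerProductSpace ℂ A] [CompleteSpace A]
    [NormedAddCommGroup A'] [InnerProductSpace ℂ A'] [CompleteSpace A']
    [NormedAddCommGroup L] [InnerProductSpace ℂ L]
    [NormedAddCommGroup F] [InnerProductSpace ℂ F]
    [NormedAddCommGroup F'] [InnerProductSpace ℂ F']
    (U' : (A' ⊗ₕ L) ⊗ₕ F →ₗᵢ[ℂ] H' ⊗ₕ F') (U : (A ⊗ₕ L) ⊗ₕ F →ₗᵢ[ℂ] H ⊗ₕ F')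
    (R : (A ⊗ₕ L) ⊗ₕ F →L[ℂ] (A' ⊗ₕ L) ⊗ₕ F) {x y : F'} {x₁ y₁ : L} {x₂ y₂ : F}
    {w' : H' → A'} {w : H → A} (h' : ∀ v, U' (tmul (tmul (w' v) x₁) x₂) = tmul v x)
    (h : ∀ v, U (tmul (tmul (w v) y₁) y₂) = tmul v y) (v' : H') (v : H) :
    ⟪v', slice x y (transport U' U R) v⟫_ℂ = ⟪w' v', slice x₁ y₁ (slice x₂ y₂ R) (w v)⟫_ℂ := by
  rw [inner_slice, inner_slice, inner_slice, ← h, ← h', inner_transport]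

/-- Used for operators that send product vectors to scalar multiples of product vectors; for the
Weyl process, `c` is the Weyl phase. -/
theorem transport_opTensor_tmul {F F' G : Type*}
    [NormedAddCommGroup F] [InnerProductSpace ℂ F] [CompleteSpace F]
    [NormedAddCommGroup F'] [InnerProductSpace ℂ F'] [CompleteSpace F']
    [NormedAddCommGroup G] [InnerProductSpace ℂ G] [CompleteSpace G]
    (U' : (H' ⊗ₕ F) ⊗ₕ F' →ₗᵢ[ℂ] H' ⊗ₕ G) (U : (H ⊗ₕ F) ⊗ₕ F' →ₗᵢ[ℂ] H ⊗ₕ G)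
    {T : H ⊗ₕ F →L[ℂ] H' ⊗ₕ F} {v : H} {v' : H'} {c : ℂ} {x : F} {x' : F} {y : F'} {z z' : G}
    (hT : T (tmul v x) = c • tmul v' x') (hU : U (tmul (tmul v x) y) = tmul v z)
    (hU' : U' (tmul (tmul v' x') y) = tmul v' z') :
    transport U' U (opTensor T (ContinuousLinearMap.id ℂ F')) (tmul v z) = c • tmul v' z' := by
  change U' (opTensor T (ContinuousLinearMap.id ℂ F')
    (U.toContinuousLinearMap.adjoint (tmul v z))) = _
  rw [← hU, adjoint_linearIsometry_apply, opTensor_tmul, hT, smul_tmul, map_smul,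
    ContinuousLinearMap.id_apply, hU']

theorem sandwich_opTensor_tmul {F F' : Type*}
    [NormedAddCommGroup F] [InnerProductSpace ℂ F] [CompleteSpace F]
    [NormedAddCommGroup F'] [InnerProductSpace ℂ F'] [CompleteSpace F']
    (R : F →ₗᵢ[ℂ] F') {T : H ⊗ₕ F →L[ℂ] H' ⊗ₕ F} {v : H} {v' : H'} {c : ℂ} {x x' : F}
    {y y' : F'} (hT : T (tmul v x) = c • tmul v' x') (hy : R x = y) (hy' : R x' = y') :
    sandwich (opTensor (ContinuousLinearMap.id ℂ H') R.toContinuousLinearMap)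
      (opTensor (ContinuousLinearMap.id ℂ H) R.toContinuousLinearMap).adjoint T (tmul v y)
      = c • tmul v' y' := by
  subst hy hy'
  change opTensor (ContinuousLinearMap.id ℂ H') R.toContinuousLinearMap
    (T ((opTensor (ContinuousLinearMap.id ℂ H) R.toContinuousLinearMap).adjoint _)) = _
  rw [adjoint_opTensor_id, adjoint_linearIsometry_apply, hT, map_smul, opTensor_tmul]
  rfl

/-- The slices of an operator of the form `S ⊗ I`, transported. -/
theorem slice_transport_opTensor_id {F P M : Type*}
    [NormedAddCommGroup F] [InnerProductSpace ℂ F]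
    [NormedAddCommGroup P] [InnerProductSpace ℂ P]
    [NormedAddCommGroup M] [InnerProductSpace ℂ M]
    (U' : (H' ⊗ₕ P) ⊗ₕ F →ₗᵢ[ℂ] H' ⊗ₕ M) (U : (H ⊗ₕ P) ⊗ₕ F →ₗᵢ[ℂ] H ⊗ₕ M)
    (S : H ⊗ₕ P →L[ℂ] H' ⊗ₕ P) {x y : M} {x₁ y₁ : P} {x₂ y₂ : F}
    (h' : ∀ v, U' (tmul (tmul v x₁) x₂) = tmul v x)
    (h : ∀ v, U (tmul (tmul v y₁) y₂) = tmul v y) :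
    slice x y (transport U' U (opTensor S (ContinuousLinearMap.id ℂ F)))
      = ⟪x₂, y₂⟫_ℂ • slice x₁ y₁ S := by
  refine clm_ext_inner fun v' v => ?_
  rw [slice_transport U' U _ (w' := fun v => v) (w := fun v => v) h' h, slice_opTensor_id,
    slice_smul]

/-- The slices of the transported lifting of the compression of a completely bounded map. -/
theorem slice_transport_lift {F P M : Type*}
    [NormedAddCommGroup F] [InnerProductSpace ℂ F]
    [NormedAddCommGroup P] [InnerProductSpace ℂ P]
    [NormedAddCommGroup M] [InnerProductSpace ℂ M]
    (U' : (H' ⊗ₕ P) ⊗ₕ F →ₗᵢ[ℂ] H' ⊗ₕ M) (U : (H ⊗ₕ P) ⊗ₕ F →ₗᵢ[ℂ] H ⊗ₕ M)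
    {V : Submodule ℂ (H →L[ℂ] H')} {φ : V →ₗ[ℂ] (H ⊗ₕ P →L[ℂ] H' ⊗ₕ P)}
    (hφ : IsCompletelyBounded φ) {x y : M} {x₁ y₁ : P} {x₂ y₂ : F}
    (h' : ∀ v, U' (tmul (tmul v x₁) x₂) = tmul v x)
    (h : ∀ v, U (tmul (tmul v y₁) y₂) = tmul v y) (T : matrixSpace V F) :
    slice x y (transport U' U (lift φ F T)) = slice x₁ y₁ (φ (entry V x₂ y₂ T)) := by
  refine clm_ext_inner fun v' v => ?_
  rw [slice_transport U' U _ (w' := fun v => v) (w := fun v => v) h' h, lift_spec φ hφ]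

end Transport

/-! ### The splitting of the noise space at a time -/

section Join

open MeasureTheory

variable {N : Type*} [NormedAddCommGroup N] [InnerProductSpace ℂ N]

/-- The concatenation at time `r` of `f` on `[0,r[` with the right shift of `g`. -/
def join (r : ℝ≥0) (f : L2On N (Set.Ico (0 : ℝ) r)) (g : L2On N (Set.Ici 0)) :
    L2On N (Set.Ici 0) :=
  inclL2 (Ico_sub r) f + inclL2 (Ici_sub r) (shiftL2 r g)

theorem join_add (r : ℝ≥0) (f f' : L2On N (Set.Ico (0 : ℝ) r)) (g g' : L2On N (Set.Ici 0)) :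
    join r f g + join r f' g' = join r (f + f') (g + g') := by
  simp only [join, map_add]
  abel

theorem join_zero_right (r : ℝ≥0) (f : L2On N (Set.Ico (0 : ℝ) r)) :
    join r f 0 = inclL2 (Ico_sub r) f := by
  simp [join]

/-- The cross terms vanish because [0,r[ and [r,∞[ are disjoint, and the shift preserves inner
products. This additivity is the source of multiplicativity for exponential vectors and for Weyl
phases. -/
theorem inner_join (r : ℝ≥0) (f f' : L2On N (Set.Ico (0 : ℝ) r)) (g g' : L2On N (Set.Ici 0)) :
    ⟪join r f g, join r f' g'⟫_ℂ = ⟪f, f'⟫_ℂ + ⟪g, g'⟫_ℂ := by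
  have ho : ∀ (f : L2On N (Set.Ico (0 : ℝ) r)) (g : L2On N (Set.Ici 0)),
      ⟪inclL2 (Ico_sub r) f, inclL2 (Ici_sub r) (shiftL2 r g)⟫_ℂ = 0 := fun f g =>
    Submodule.isOrtho_iff_inner_eq.1 (L2On_isOrtho (N := N) (disj r)) _ f.2 _ (shiftL2 r g).2
  have ho' : ⟪inclL2 (Ici_sub r) (shiftL2 r g), inclL2 (Ico_sub r) f'⟫_ℂ = 0 := by
    rw [← inner_conj_symm, ho, map_zero]
  rw [join, join, inner_add_left, inner_add_right, inner_add_right, ho, ho', add_zero, zero_add,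
    LinearIsometry.inner_map_map, LinearIsometry.inner_map_map,
    LinearIsometry.inner_map_map]

/-- The preimage is the translate by `r` in the opposite direction. Surjectivity is what permits
every future function to be written as a shifted one. -/
theorem exists_shiftL2_eq (r : ℝ≥0) (g : L2On N (Set.Ici (r : ℝ))) :
    ∃ g' : L2On N (Set.Ici 0), shiftL2 r g' = g := by
  have hmp := measurePreserving_add_right (volume : Measure ℝ) (r : ℝ)
  have hmp' := measurePreserving_sub_right (volume : Measure ℝ) (r : ℝ)
  have h2 : ∀ᵐ s : ℝ, Lp.compMeasurePreserving (fun s : ℝ => s + r) hmp g.1 s = g.1 (s + r) :=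
    Lp.coeFn_compMeasurePreserving g.1 hmp
  refine ⟨⟨Lp.compMeasurePreserving (fun s : ℝ => s + r) hmp g.1, ?_⟩, Subtype.ext (Lp.ext ?_)⟩
  · have h1 := hmp.quasiMeasurePreserving.ae g.2
    filter_upwards [h1, h2] with s h1 h2 hs
    rw [h2, h1]
    simpa using hs
  · have h3 : ∀ᵐ s : ℝ, translate r (Lp.compMeasurePreserving (fun s : ℝ => s + r) hmp g.1) s
        = Lp.compMeasurePreserving (fun s : ℝ => s + r) hmp g.1 (s - r) :=
      Lp.coeFn_compMeasurePreserving _ hmp'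
    have h4 := hmp'.quasiMeasurePreserving.ae h2
    filter_upwards [h3, h4] with s h3 h4
    rw [sub_add_cancel] at h4
    exact h3.trans h4

/-- Cut `f` at time `r`: its restriction to [0,r[ is the past part, and the remainder is supported
in [r,∞[. Consequently exponential vectors of joins are all the exponential vectors. -/
theorem exists_join_eq (r : ℝ≥0) (f : L2On N (Set.Ici 0)) :
    ∃ (f₁ : L2On N (Set.Ico (0 : ℝ) r)) (f₂ : L2On N (Set.Ici 0)), join r f₁ f₂ = f := by
  have hm := (Lp.memLp f.1).indicator (measurableSet_Ico (a := (0 : ℝ)) (b := r))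
  have h1 : (hm.toLp _ : Lp N 2 (volume : Measure ℝ)) ∈ L2On N (Set.Ico (0 : ℝ) r) := by
    change ∀ᵐ s : ℝ, s ∉ Set.Ico (0 : ℝ) r → _
    filter_upwards [hm.coeFn_toLp] with s hs hs'
    rw [hs, Set.indicator_of_notMem hs']
  have h2 : f.1 - hm.toLp _ ∈ L2On N (Set.Ici (r : ℝ)) := by
    change ∀ᵐ s : ℝ, s ∉ Set.Ici (r : ℝ) → _
    have hf : ∀ᵐ s : ℝ, s ∉ Set.Ici (0 : ℝ) → f.1 s = 0 := f.2
    filter_upwards [hm.coeFn_toLp, Lp.coeFn_sub f.1 (hm.toLp _), hf] with s h3 h4 h5 hs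
    rw [h4, Pi.sub_apply, h3]
    by_cases h0 : s ∈ Set.Ici (0 : ℝ)
    · rw [Set.indicator_of_mem (show s ∈ Set.Ico (0 : ℝ) r from ⟨h0, not_le.1 hs⟩), sub_self]
    · rw [Set.indicator_of_notMem (fun h => h0 h.1), h5 h0, sub_zero]
  obtain ⟨g, hg⟩ := exists_shiftL2_eq r ⟨_, h2⟩
  refine ⟨⟨_, h1⟩, g, Subtype.ext ?_⟩
  rw [join, hg]
  exact add_sub_cancel _ f.1

/-- The constant function `x` as an element of `L²([0,t[; N)`. -/
def indIco (x : N) (t : ℝ≥0) : L2On N (Set.Ico (0 : ℝ) t) :=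
  ⟨(ind x t).1, by
    have h := indicatorConstLp_coeFn_notMem (p := 2) (μ := (volume : Measure ℝ))
      (hs := measurableSet_Ico (a := (0 : ℝ)) (b := t))
      (hμs := by rw [Real.volume_Ico]; exact ENNReal.ofReal_ne_top) (c := x)
    exact h⟩

theorem inclL2_indIco (x : N) (t : ℝ≥0) : inclL2 (Ico_sub t) (indIco x t) = ind x t := rfl

/-- A constant function on [0,r+t[ looks the same after time `r` as at the start. This stationarity
underlies both the cocycle identity for W^Γ and the semigroup property of associated maps. -/
theorem ind_add_time (x : N) (r t : ℝ≥0) :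
    ind x (r + t) = join r (indIco x r) (ind x t) := by
  refine Subtype.ext (Lp.ext ?_)
  change _ =ᵐ[volume] (((ind x r).1 + translate r (ind x t).1 : Lp N 2 (volume : Measure ℝ)) :
    ℝ → N)
  have hmp := measurePreserving_sub_right (volume : Measure ℝ) (r : ℝ)
  have h0 : ∀ t : ℝ≥0, ∀ᵐ s : ℝ, (ind x t).1 s = (Set.Ico (0 : ℝ) t).indicator (fun _ => x) s :=
    fun t => indicatorConstLp_coeFn (p := 2) (μ := (volume : Measure ℝ))
      (hs := measurableSet_Ico (a := (0 : ℝ)) (b := t))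
      (hμs := by rw [Real.volume_Ico]; exact ENNReal.ofReal_ne_top)
  have h1 : ∀ᵐ s : ℝ, translate r (ind x t).1 s = (ind x t).1 (s - r) :=
    Lp.coeFn_compMeasurePreserving _ hmp
  filter_upwards [h0 (r + t), h0 r, h1, hmp.quasiMeasurePreserving.ae (h0 t),
    Lp.coeFn_add (ind x r).1 (translate r (ind x t).1)] with s h2 h3 h4 h5 h6
  rw [h6, Pi.add_apply, h2, h3, h4, h5]
  simp only [Set.indicator, Set.mem_Ico, NNReal.coe_add, sub_nonneg]
  have hr := r.2
  have ht := t.2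
  by_cases hs : s < r
  · have e1 : s < r + t := lt_of_lt_of_le hs (le_add_of_nonneg_right ht)
    simp [hs, e1, not_le.2 hs]
  · have e1 : (0 : ℝ) ≤ s := le_trans hr (not_lt.1 hs)
    simp [hs, e1, not_lt.1 hs, sub_lt_iff_lt_add']

/-- The two times are kept distinct so that joint continuity in them yields continuity of `ind x`;
equal times give the linear growth behind the semigroup exponents. -/
theorem inner_ind_ind (x y : N) (s t : ℝ≥0) :
    ⟪ind x s, ind y t⟫_ℂ = (min s t : ℝ≥0) * ⟪x, y⟫_ℂ := by
  have h0 : ∀ᵐ u : ℝ, (ind y t).1 u = (Set.Ico (0 : ℝ) t).indicator (fun _ => y) u :=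
    indicatorConstLp_coeFn (p := 2) (μ := (volume : Measure ℝ))
      (hs := measurableSet_Ico (a := (0 : ℝ)) (b := t))
      (hμs := by rw [Real.volume_Ico]; exact ENNReal.ofReal_ne_top)
  have h1 : ⟪ind x s, ind y t⟫_ℂ = ∫ u in Set.Ico (0 : ℝ) s, ⟪x, (ind y t).1 u⟫_ℂ :=
    L2.inner_indicatorConstLp_eq_setIntegral_inner ℂ (ind y t).1 measurableSet_Ico x
      (by rw [Real.volume_Ico]; exact ENNReal.ofReal_ne_top)
  have h2 : ∫ u in Set.Ico (0 : ℝ) s, ⟪x, (ind y t).1 u⟫_ℂ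
      = ∫ u in Set.Ico (0 : ℝ) s, (Set.Ico (0 : ℝ) t).indicator (fun _ => ⟪x, y⟫_ℂ) u := by
    refine integral_congr_ae (ae_restrict_of_ae ?_)
    filter_upwards [h0] with u hu
    rw [hu]
    by_cases h : u ∈ Set.Ico (0 : ℝ) t <;> simp [h]
  rw [h1, h2, setIntegral_indicator measurableSet_Ico, setIntegral_const, Set.Ico_inter_Ico,
    Measure.real, Real.volume_Ico, sup_idem, sub_zero, ENNReal.toReal_ofReal (by positivity)]
  simp

theorem inner_ind (x y : N) (t : ℝ≥0) : ⟪ind x t, ind y t⟫_ℂ = t * ⟪x, y⟫_ℂ := by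
  rw [inner_ind_ind, min_self]

theorem ind_zero (x : N) : ind x 0 = 0 := by
  rw [← inner_self_eq_zero (𝕜 := ℂ), inner_ind]
  simp

theorem ind_zero_left (t : ℝ≥0) : ind (0 : N) t = 0 := by
  rw [← inner_self_eq_zero (𝕜 := ℂ), inner_ind, inner_zero_left, mul_zero]

theorem ind_add (x y : N) (t : ℝ≥0) : ind (x + y) t = ind x t + ind y t :=
  Subtype.ext (indicatorConstLp_add (p := 2) (μ := volume) (hs := measurableSet_Ico)
    (hμs := by rw [Real.volume_Ico]; exact ENNReal.ofReal_ne_top) (c := x) (c' := y)).symm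

/-- ‖F t - F s‖² is a combination of inner products of values of `F`, so a continuous kernel forces
a norm continuous map. -/
theorem continuous_of_continuous_inner {T E : Type*} [TopologicalSpace T] [NormedAddCommGroup E]
    [InnerProductSpace ℂ E] {F : T → E} (h : Continuous fun p : T × T => ⟪F p.1, F p.2⟫_ℂ) :
    Continuous F := by
  have h1 : ∀ a b : T → T, Continuous a → Continuous b →
      Continuous fun t => ⟪F (a t), F (b t)⟫_ℂ := fun a b ha hb => h.comp (ha.prodMk hb)
  refine continuous_iff_continuousAt.2 fun s => ?_
  refine tendsto_iff_norm_sub_tendsto_zero.2 ?_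
  have h2 : Continuous fun t => ‖F t - F s‖ := by
    simp only [@norm_eq_sqrt_re_inner ℂ, inner_sub_left, inner_sub_right]
    have c1 := h1 id id continuous_id continuous_id
    have c2 := h1 id (fun _ => s) continuous_id continuous_const
    have c3 := h1 (fun _ => s) id continuous_const continuous_id
    exact Real.continuous_sqrt.comp (Complex.continuous_re.comp
      ((c1.sub c3).sub (c2.sub continuous_const)))
  simpa using h2.tendsto s

theorem continuous_ind (x : N) : Continuous fun t : ℝ≥0 => ind x t := by
  refine continuous_of_continuous_inner ?_
  simp only [inner_ind_ind]
  fun_prop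

theorem continuous_coh {E : Type*} [NormedAddCommGroup E] [InnerProductSpace ℂ E] :
    Continuous (coh : E → Fock E) := by
  refine continuous_of_continuous_inner ?_
  simp only [inner_coh, chi]
  fun_prop

theorem inner_coh_self {E : Type*} [NormedAddCommGroup E] [InnerProductSpace ℂ E] (u : E) :
    ⟪coh u, coh u⟫_ℂ = 1 := by
  have h : ⟪u, u⟫_ℂ = (‖u‖ : ℂ) ^ 2 := inner_self_eq_norm_sq_to_K _
  rw [inner_coh, chi, h]
  simp

theorem inner_coh_join (r : ℝ≥0) (f f' : L2On N (Set.Ico (0 : ℝ) r))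
    (g g' : L2On N (Set.Ici 0)) :
    ⟪coh (join r f g), coh (join r f' g')⟫_ℂ = ⟪coh f, coh f'⟫_ℂ * ⟪coh g, coh g'⟫_ℂ := by
  have hn : ∀ (f : L2On N (Set.Ico (0 : ℝ) r)) (g : L2On N (Set.Ici 0)),
      ‖join r f g‖ ^ 2 = ‖f‖ ^ 2 + ‖g‖ ^ 2 := fun f g => by
    have h := inner_join r f f g g
    rw [inner_self_eq_norm_sq_to_K (𝕜 := ℂ) (join r f g), inner_self_eq_norm_sq_to_K (𝕜 := ℂ) f,
      inner_self_eq_norm_sq_to_K (𝕜 := ℂ) g] at h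
    exact_mod_cast h
  rw [inner_coh, inner_coh, inner_coh, ← Complex.exp_add, chi, chi, chi, inner_join, hn, hn]
  congr 1
  push_cast
  ring

end Join

/-! ### Slices at exponential vectors -/

section CohSlices

variable {N H H' : Type*} [NormedAddCommGroup N] [InnerProductSpace ℂ N]
  [NormedAddCommGroup H] [InnerProductSpace ℂ H] [CompleteSpace H]
  [NormedAddCommGroup H'] [InnerProductSpace ℂ H'] [CompleteSpace H']

theorem factorPF_tmul (r : ℝ≥0) (u : H) (f : L2On N (Set.Ico (0 : ℝ) r))
    (g : L2On N (Set.Ici 0)) :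
    factorPF N H r (tmul (tmul u (coh f)) (coh (shiftL2 r g))) = tmul u (coh (join r f g)) :=
  fockFactor_tmul (L2On_mono (Ico_sub r)) (L2On_mono (Ici_sub r)) (L2On_isOrtho (disj r)) u f
    (shiftL2 r g)

theorem factorFP_tmul (r : ℝ≥0) (u : H) (f : L2On N (Set.Ico (0 : ℝ) r))
    (g : L2On N (Set.Ici 0)) :
    factorFP N H r (tmul (tmul u (coh (shiftL2 r g))) (coh f)) = tmul u (coh (join r f g)) := by
  refine (fockFactor_tmul (L2On_mono (Ici_sub r)) (L2On_mono (Ico_sub r))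
    (L2On_isOrtho (disj r).symm) u (shiftL2 r g) f).trans ?_
  congr 2
  exact Subtype.ext (add_comm _ _)

end CohSlices

section CohSlices

variable {N H H' : Type*} [NormedAddCommGroup N] [InnerProductSpace ℂ N]
  [NormedAddCommGroup H] [InnerProductSpace ℂ H] [CompleteSpace H]
  [NormedAddCommGroup H'] [InnerProductSpace ℂ H'] [CompleteSpace H']

theorem slice_compress (r : ℝ≥0) (f f' : L2On N (Set.Ico (0 : ℝ) r))
    (T : H ⊗ₕ NoiseFock N →L[ℂ] H' ⊗ₕ NoiseFock N) :
    slice (coh f) (coh f') (compress r T)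
      = slice (coh (inclL2 (Ico_sub r) f)) (coh (inclL2 (Ico_sub r) f')) T :=
  slice_adjoint_sandwich (fockMap (inclL2 (N := N) (Ico_sub r))) (fockMap_coh _ f)
    (fockMap_coh _ f') T

theorem slice_shiftOp (r : ℝ≥0) (g g' : L2On N (Set.Ici 0))
    (T : H ⊗ₕ NoiseFock N →L[ℂ] H' ⊗ₕ NoiseFock N) :
    slice (coh (shiftL2 r g)) (coh (shiftL2 r g')) (shiftOp r T) = slice (coh g) (coh g') T :=
  slice_sandwich_linearIsometry (fockMap (shiftL2 (N := N) r)) (fockMap_coh _ g)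
    (fockMap_coh _ g') T

/-- Since each noise function is a join at time `r`, it suffices to compare slices in the
coordinates adapted to that time. -/
theorem ext_slice_coh_join (r : ℝ≥0) {S T : H ⊗ₕ NoiseFock N →L[ℂ] H' ⊗ₕ NoiseFock N}
    (h : ∀ (f : L2On N (Set.Ico (0 : ℝ) r)) (g : L2On N (Set.Ici 0))
      (f' : L2On N (Set.Ico (0 : ℝ) r)) (g' : L2On N (Set.Ici 0)), slice (coh (join r f g)) (coh (join r f' g')) S
      = slice (coh (join r f g)) (coh (join r f' g')) T) : S = T := by
  refine ext_slice_of_isTotal isTotal_coh isTotal_coh fun f f' => ?_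
  obtain ⟨f, g, rfl⟩ := exists_join_eq r f
  obtain ⟨f', g', rfl⟩ := exists_join_eq r f'
  exact h f g f' g'

/-- The operator `S ⊗ I_{[r,∞[}` in terms of its slices. -/
theorem slice_transport_opTensor (r : ℝ≥0) (f f' : L2On N (Set.Ico (0 : ℝ) r))
    (g g' : L2On N (Set.Ici 0))
    (S : H ⊗ₕ FockOn N (Set.Ico (0 : ℝ) r) →L[ℂ] H' ⊗ₕ FockOn N (Set.Ico (0 : ℝ) r)) :
    slice (coh (join r f g)) (coh (join r f' g')) (transport (factorPF N H' r) (factorPF N H r)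
      (opTensor S (ContinuousLinearMap.id ℂ _))) = ⟪coh g, coh g'⟫_ℂ • slice (coh f) (coh f') S := by
  have h : ⟪coh (shiftL2 r g), coh (shiftL2 r g')⟫_ℂ = ⟪coh g, coh g'⟫_ℂ := by
    rw [inner_coh, inner_coh, chi, chi, LinearIsometry.inner_map_map, LinearIsometry.norm_map,
      LinearIsometry.norm_map]
  exact (slice_transport_opTensor_id (factorPF N H' r) (factorPF N H r) S
    (fun v => factorPF_tmul r v f g) (fun v => factorPF_tmul r v f' g')).trans
      (congrArg (fun c : ℂ => c • slice (coh f) (coh f') S) h)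

/-- With `T = S ⊗ I` the future contributes only an inner product. The slices of `S` are recovered
from `T` by putting the vacuum, a unit vector, in the future. -/
theorem IsAdapted.slice_coh_join {V : Submodule ℂ (H →L[ℂ] H')} {r : ℝ≥0}
    {T : H ⊗ₕ NoiseFock N →L[ℂ] H' ⊗ₕ NoiseFock N} (hT : IsAdapted V r T)
    (f f' : L2On N (Set.Ico (0 : ℝ) r)) (g g' : L2On N (Set.Ici 0)) :
    slice (coh (join r f g)) (coh (join r f' g')) T
      = ⟪coh g, coh g'⟫_ℂ •
        slice (coh (inclL2 (Ico_sub r) f)) (coh (inclL2 (Ico_sub r) f')) T := by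
  obtain ⟨S, _, hS⟩ := hT
  have h0 : slice (coh (inclL2 (Ico_sub r) f)) (coh (inclL2 (Ico_sub r) f')) T
      = ⟪coh (shiftL2 (N := N) r 0), coh (shiftL2 r 0)⟫_ℂ • slice (coh f) (coh f') S :=
    (congrArg (fun A => slice _ _ A) hS).trans
      (slice_transport_opTensor_id (factorPF N H' r) (factorPF N H r) S
        (fun v => (factorPF_tmul r v f 0).trans
          (congrArg (fun f => tmul v (coh f)) (join_zero_right r f)))
        (fun v => (factorPF_tmul r v f' 0).trans
          (congrArg (fun f => tmul v (coh f)) (join_zero_right r f'))))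
  have h2 := h0.trans ((congrArg (fun c : ℂ => c • slice (coh f) (coh f') S)
    (inner_coh_self _)).trans (one_smul ℂ _))
  exact (congrArg (fun A => slice _ _ A) hS).trans ((slice_transport_opTensor r f f' g g' S).trans
    (congrArg (fun A : H →L[ℂ] H' => ⟪coh g, coh g'⟫_ℂ • A) h2.symm))

/-- The operator on the past is the compression of `T` to Fock space over [0,r[; the factorisation
hypothesis says precisely that its ampliation has the slices of `T`. -/
theorem isAdapted_of_slice_coh_join {V : Submodule ℂ (H →L[ℂ] H')} {r : ℝ≥0}
    {T : H ⊗ₕ NoiseFock N →L[ℂ] H' ⊗ₕ NoiseFock N} (hT : T ∈ matrixSpace V (NoiseFock N))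
    (h : ∀ (f f' : L2On N (Set.Ico (0 : ℝ) r)) (g g' : L2On N (Set.Ici 0)),
      slice (coh (join r f g)) (coh (join r f' g')) T = ⟪coh g, coh g'⟫_ℂ •
        slice (coh (inclL2 (Ico_sub r) f)) (coh (inclL2 (Ico_sub r) f')) T) :
    IsAdapted V r T := by
  have hS : compress r T ∈ matrixSpace V (FockOn N (Set.Ico (0 : ℝ) r)) := fun x y => by
    have e := slice_adjoint_sandwich (fockMap (inclL2 (N := N) (Ico_sub r))) (x := x) (y := y)
      rfl rfl T
    exact Eq.mpr (congrArg (· ∈ V) e) (hT _ _)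
  refine ⟨compress r T, hS, ext_slice_coh_join r fun f g f' g' => ?_⟩
  refine (h f f' g g').trans (Eq.trans ?_ (slice_transport_opTensor r f f' g g' _).symm)
  exact congrArg (fun A : H →L[ℂ] H' => ⟪coh g, coh g'⟫_ℂ • A) (slice_compress r f f' T).symm

/-- The slices of `k̂_r`. -/
theorem slice_hat {V : Submodule ℂ (H →L[ℂ] H')} (r : ℝ≥0)
    {φ : V →ₗ[ℂ] (H ⊗ₕ NoiseFock N →L[ℂ] H' ⊗ₕ NoiseFock N)} (hφ : IsCompletelyBounded φ)
    (T : matrixSpace V (FockOn N (Set.Ici (r : ℝ)))) (f f' : L2On N (Set.Ico (0 : ℝ) r))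
    (g g' : L2On N (Set.Ici 0)) :
    slice (coh (join r f g)) (coh (join r f' g')) (hat r φ T)
      = slice (coh (inclL2 (Ico_sub r) f)) (coh (inclL2 (Ico_sub r) f'))
          (φ (entry V (coh (shiftL2 r g)) (coh (shiftL2 r g')) T)) := by
  have h := slice_transport_lift (factorPF N H' r) (factorPF N H r) (hφ.compress r)
    (fun v => factorPF_tmul r v f g) (fun v => factorPF_tmul r v f' g') T
  exact h.trans (slice_compress r f f' _)

/-- The slices of `k̂_r (σ_r (T))`. -/
theorem slice_hat_shiftMS {V : Submodule ℂ (H →L[ℂ] H')} (r : ℝ≥0)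
    {φ : V →ₗ[ℂ] (H ⊗ₕ NoiseFock N →L[ℂ] H' ⊗ₕ NoiseFock N)} (hφ : IsCompletelyBounded φ)
    (T : matrixSpace V (NoiseFock N)) (f f' : L2On N (Set.Ico (0 : ℝ) r))
    (g g' : L2On N (Set.Ici 0)) :
    slice (coh (join r f g)) (coh (join r f' g')) (hat r φ (shiftMS (N := N) V r T))
      = slice (coh (inclL2 (Ico_sub r) f)) (coh (inclL2 (Ico_sub r) f'))
          (φ (entry V (coh g) (coh g') T)) := by
  have h : entry V (coh (shiftL2 r g)) (coh (shiftL2 r g')) (shiftMS (N := N) V r T)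
      = entry V (coh g) (coh g') T := Subtype.ext (slice_shiftOp r g g' T.1)
  exact (slice_hat r hφ _ f f' g g').trans (congrArg (fun a => slice _ _ (φ a)) h)

/-- The action of `σ_r(T)` on exponential vectors. -/
theorem sigma_tmul_coh_join (r : ℝ≥0) {T : H ⊗ₕ NoiseFock N →L[ℂ] H' ⊗ₕ NoiseFock N} {v : H}
    {v' : H'} {c : ℂ} {g g' : L2On N (Set.Ici 0)}
    (hT : T (tmul v (coh g)) = c • tmul v' (coh g')) (f : L2On N (Set.Ico (0 : ℝ) r)) :
    sigma r T (tmul v (coh (join r f g))) = c • tmul v' (coh (join r f g')) := by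
  have h := sandwich_opTensor_tmul (fockMap (shiftL2 (N := N) r)) hT (fockMap_coh _ g)
    (fockMap_coh _ g')
  exact transport_opTensor_tmul (factorFP N H' r) (factorFP N H r) h (factorFP_tmul r v f g)
    (factorFP_tmul r v' f g')

end CohSlices

/-! ### Weyl operators -/

section WeylOperators

variable {E : Type*} [NormedAddCommGroup E] [InnerProductSpace ℂ E]

/-- The phase `exp (-i Im ⟨f, g⟩)`. -/
def weylPhase (f g : E) : ℂ := Complex.exp (-(Complex.I * (⟪f, g⟫_ℂ).im))

theorem weyl_coh' (f g : E) : weyl f (coh g) = weylPhase f g • coh (f + g) := weyl_coh f g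

theorem weyl_zero (ξ : Fock E) : weyl 0 ξ = ξ := by
  have h : (weyl (0 : E)).toContinuousLinearMap = ContinuousLinearMap.id ℂ (Fock E) := by
    refine isTotal_coh.clm_ext fun g => ?_
    change weyl 0 (coh g) = coh g
    rw [weyl_coh', weylPhase, inner_zero_left, zero_add]
    simp
  exact DFunLike.congr_fun h ξ

/-- The two phases cancel, because ⟨f, f⟩ is real. -/
theorem weyl_weyl_neg (f : E) (ξ : Fock E) : weyl f (weyl (-f) ξ) = ξ := by
  have h : (weyl f).toContinuousLinearMap ∘L (weyl (-f)).toContinuousLinearMap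
      = ContinuousLinearMap.id ℂ (Fock E) := by
    refine isTotal_coh.clm_ext fun g => ?_
    change weyl f (weyl (-f) (coh g)) = coh g
    have h0 : (⟪f, f⟫_ℂ).im = 0 := inner_self_im (𝕜 := ℂ) f
    rw [weyl_coh', map_smul, weyl_coh', smul_smul, weylPhase, weylPhase, ← Complex.exp_add,
      inner_neg_left, inner_add_right, inner_neg_right, add_neg_cancel_left, Complex.neg_im,
      Complex.add_im, Complex.neg_im, h0]
    simp
  exact DFunLike.congr_fun h ξ

end WeylOperators

/-! ### Weyl operators of constant functions, split at a time -/

section WeylNoise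

variable {N : Type*} [NormedAddCommGroup N] [InnerProductSpace ℂ N]

/-- The function defining the operator vanishes after time `r`, so neither the future part nor the
phase sees `g`. This is the adaptedness of the Weyl process. -/
theorem weyl_ind_coh_join (x : N) (r : ℝ≥0) (f : L2On N (Set.Ico (0 : ℝ) r))
    (g : L2On N (Set.Ici 0)) :
    weyl (ind x r) (coh (join r f g))
      = weylPhase (indIco x r) f • coh (join r (indIco x r + f) g) := by
  have h : ind x r = join r (indIco x r) 0 := by rw [join_zero_right, inclL2_indIco]
  rw [weyl_coh', h, weylPhase, inner_join, inner_zero_left, add_zero, join_add, zero_add,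
    weylPhase]

theorem weyl_ind_coh_inclL2 (x : N) (r : ℝ≥0) (f : L2On N (Set.Ico (0 : ℝ) r)) :
    weyl (ind x r) (coh (inclL2 (Ico_sub r) f))
      = weylPhase (indIco x r) f • coh (inclL2 (Ico_sub r) (indIco x r + f)) := by
  have h := weyl_ind_coh_join x r f 0
  rwa [join_zero_right, join_zero_right] at h

/-- The imaginary part of an inner product of joins is the sum of the past and future contributions,
so the phase is a product. This is the cocycle identity on exponential vectors. -/
theorem weyl_ind_add_coh_join (x : N) (r t : ℝ≥0) (f : L2On N (Set.Ico (0 : ℝ) r))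
    (g : L2On N (Set.Ici 0)) :
    weyl (ind x (r + t)) (coh (join r f g))
      = (weylPhase (indIco x r) f * weylPhase (ind x t) g) •
        coh (join r (indIco x r + f) (ind x t + g)) := by
  rw [weyl_coh', ind_add_time, weylPhase, inner_join, join_add, weylPhase, weylPhase,
    ← Complex.exp_add]
  congr 2
  rw [Complex.add_im]
  push_cast
  ring

end WeylNoise

/-! ### The Weyl process -/

section WeylProcessCocycle

variable {N I : Type*} [NormedAddCommGroup N] [InnerProductSpace ℂ N] (Γ : I → N)

theorem weylProcess_tmul_coh (t : ℝ≥0) (α : I) (g : L2On N (Set.Ici 0)) :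
    weylProcess Γ t (tmul (delta α) (coh g))
      = weylPhase (ind (Γ α) t) g • tmul (delta α) (coh (ind (Γ α) t + g)) := by
  rw [weylProcess_tmul, weyl_coh', tmul_smul]

theorem weylProcess_clm_ext {S T : ell2 I ⊗ₕ NoiseFock N →L[ℂ] ell2 I ⊗ₕ NoiseFock N}
    (h : ∀ (α : I) (g : L2On N (Set.Ici 0)),
      S (tmul (delta α) (coh g)) = T (tmul (delta α) (coh g))) : S = T :=
  (isTotal_tmul isTotal_delta isTotal_coh).clm_ext fun p => h p.1 p.2

theorem weylProcess_zero : weylProcess Γ 0 = 1 := by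
  refine weylProcess_clm_ext fun α g => ?_
  rw [weylProcess_tmul, ind_zero, weyl_zero]
  rfl

theorem weylProcess_mul_weylProcess_neg (t : ℝ≥0) :
    weylProcess Γ t * weylProcess (-Γ) t = 1 := by
  refine weylProcess_clm_ext fun α g => ?_
  have h : ind ((-Γ) α) t = -ind (Γ α) t := by
    rw [eq_neg_iff_add_eq_zero, ← ind_add, Pi.neg_apply, neg_add_cancel, ind_zero_left]
  change weylProcess Γ t (weylProcess (-Γ) t _) = _
  rw [weylProcess_tmul, weylProcess_tmul, h, weyl_weyl_neg]
  rfl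

/-- An isometry with a right inverse is unitary: the right inverse must be the adjoint. -/
theorem weylProcess_mem_unitary (t : ℝ≥0) :
    weylProcess Γ t ∈ unitary (ell2 I ⊗ₕ NoiseFock N →L[ℂ] ell2 I ⊗ₕ NoiseFock N) := by
  have h1 : star (weylProcess Γ t) * weylProcess Γ t = 1 :=
    ContinuousLinearMap.ext fun z => adjoint_linearIsometry_apply (weylIsometry Γ t) z
  have h2 := weylProcess_mul_weylProcess_neg Γ t
  have h3 : star (weylProcess Γ t) = weylProcess (-Γ) t := left_inv_eq_right_inv h1 h2
  exact Unitary.mem_iff.2 ⟨h1, by rw [h3, h2]⟩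

/-- Every slice of W^Γ over the noise is diagonal in the basis of l²(I), which reduces statements
about the process to scalar ones. -/
theorem slice_weylProcess_delta (t : ℝ≥0) (ξ η : NoiseFock N) (α : I) :
    slice ξ η (weylProcess Γ t) (delta α) = ⟪ξ, weyl (ind (Γ α) t) η⟫_ℂ • delta α := by
  refine ext_inner_left ℂ fun v => ?_
  rw [inner_slice, weylProcess_tmul, inner_tmul, inner_smul_right, mul_comm]

theorem isOpProcess_weylProcess : IsOpProcess (weylProcess Γ) := by
  intro t
  refine isAdapted_of_slice_coh_join (fun _ _ => Submodule.mem_top) fun f f' g g' => ?_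
  refine isTotal_delta.clm_ext fun α => ?_
  rw [smul_apply, slice_weylProcess_delta, slice_weylProcess_delta, smul_smul]
  congr 1
  rw [weyl_ind_coh_join, weyl_ind_coh_inclL2, inner_smul_right, inner_smul_right, inner_coh_join,
    ← join_zero_right, ← join_zero_right, inner_coh_join, inner_coh_self]
  ring

theorem weylProcess_ext_join (r : ℝ≥0)
    {S T : ell2 I ⊗ₕ NoiseFock N →L[ℂ] ell2 I ⊗ₕ NoiseFock N}
    (h : ∀ (α : I) (f : L2On N (Set.Ico (0 : ℝ) r)) (g : L2On N (Set.Ici 0)),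
      S (tmul (delta α) (coh (join r f g))) = T (tmul (delta α) (coh (join r f g)))) : S = T := by
  refine weylProcess_clm_ext fun α g => ?_
  obtain ⟨f, g, rfl⟩ := exists_join_eq r g
  exact h α f g

theorem isLeftOpCocycle_weylProcess : IsLeftOpCocycle (weylProcess Γ) where
  process := isOpProcess_weylProcess Γ
  zero := weylProcess_zero Γ
  cocycle r t := by
    refine weylProcess_ext_join r fun α f g => ?_
    change _ = weylProcess Γ r (sigma r (weylProcess Γ t) _)
    rw [sigma_tmul_coh_join r (weylProcess_tmul_coh Γ t α g) f, map_smul, weylProcess_tmul,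
      weylProcess_tmul, weyl_ind_add_coh_join, weyl_ind_coh_join, tmul_smul, tmul_smul, smul_smul,
      mul_comm]

/-- The shifted factor alters only the future of a join and `weylProcess Γ r` only its past, each
with a phase depending only on its own part. Reversing their order therefore changes nothing. -/
theorem isRightOpCocycle_weylProcess : IsRightOpCocycle (weylProcess Γ) where
  process := isOpProcess_weylProcess Γ
  zero := weylProcess_zero Γ
  cocycle r t := by
    refine weylProcess_ext_join r fun α f g => ?_
    change _ = sigma r (weylProcess Γ t) (weylProcess Γ r _)
    rw [weylProcess_tmul, weylProcess_tmul, weyl_ind_coh_join, tmul_smul, map_smul,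
      sigma_tmul_coh_join r (weylProcess_tmul_coh Γ t α g) (indIco (Γ α) r + f),
      weyl_ind_add_coh_join, tmul_smul, smul_smul]

theorem continuous_weylProcess_apply (ξ : ell2 I ⊗ₕ NoiseFock N) :
    Continuous fun t : ℝ≥0 => weylProcess Γ t ξ := by
  have ht : IsTotal (fun p : I × L2On N (Set.Ici 0) => tmul (delta p.1) (coh p.2)) :=
    isTotal_tmul isTotal_delta isTotal_coh
  -- On combinations of vectors δ^α ⊗ ϖ(g), continuity follows from that of the phase and of the
  -- exponential vector.
  have hbase : ∀ ζ ∈ Submodule.span ℂ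
      (Set.range fun p : I × L2On N (Set.Ici 0) => tmul (delta p.1) (coh p.2)),
      Continuous fun t : ℝ≥0 => weylProcess Γ t ζ := by
    intro ζ hζ
    induction hζ using Submodule.span_induction with
    | mem ζ hζ =>
      obtain ⟨p, rfl⟩ := hζ
      simp only [weylProcess_tmul_coh, weylPhase]
      have h1 := continuous_ind (Γ p.1)
      have h2 : Continuous fun t : ℝ≥0 => tmul (delta p.1) (coh (ind (Γ p.1) t + p.2)) :=
        (HTensor.incl ∘L (TensorProduct.mkL ℂ (ell2 I) (NoiseFock N) (delta p.1))).continuous.comp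
          (continuous_coh.comp (h1.add continuous_const))
      have h3 : Continuous fun t : ℝ≥0 => ⟪ind (Γ p.1) t, p.2⟫_ℂ := h1.inner continuous_const
      have h4 := Complex.continuous_ofReal.comp (Complex.continuous_im.comp h3)
      exact (Complex.continuous_exp.comp (continuous_const.mul h4).neg).smul h2
    | zero => simpa using continuous_const
    | add x y _ _ h1 h2 => simp only [map_add]; exact h1.add h2
    | smul c x _ h1 => simp only [map_smul]; exact h1.const_smul c
  refine continuous_iff_continuousAt.2 fun t₀ => Metric.continuousAt_iff.2 fun ε hε => ?_
  obtain ⟨ζ, hζ, hd⟩ := Metric.mem_closure_iff.1 (ht ξ) (ε / 3) (by positivity)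
  obtain ⟨δ, hδ, h⟩ := Metric.continuousAt_iff.1 (hbase ζ hζ).continuousAt (ε / 3) (by positivity)
  refine ⟨δ, hδ, fun {t} hts => ?_⟩
  -- Isometry makes the approximation error independent of time, so continuity passes from a dense
  -- set to all vectors.
  have e : ∀ s, dist (weylProcess Γ s ξ) (weylProcess Γ s ζ) = dist ξ ζ :=
    fun s => (weylIsometry Γ s).dist_map ξ ζ
  calc dist (weylProcess Γ t ξ) (weylProcess Γ t₀ ξ)
      ≤ dist (weylProcess Γ t ξ) (weylProcess Γ t ζ)
        + dist (weylProcess Γ t ζ) (weylProcess Γ t₀ ζ)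
        + dist (weylProcess Γ t₀ ζ) (weylProcess Γ t₀ ξ) := dist_triangle4 _ _ _ _
    _ < ε / 3 + ε / 3 + ε / 3 := by
      rw [e, dist_comm (weylProcess Γ t₀ ζ), e]
      linarith [h hts]
    _ = ε := by ring

end WeylProcessCocycle

/-! ### Diagonal operators and the associated semigroups of the Weyl process -/

section Diagonal

theorem inner_self_eq_ofReal_norm_sq {E : Type*} [NormedAddCommGroup E] [InnerProductSpace ℂ E]
    (u : E) : ⟪u, u⟫_ℂ = (‖u‖ : ℂ) ^ 2 :=
  inner_self_eq_norm_sq_to_K u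

variable {I : Type*}

theorem norm_delta (α : I) : ‖delta α‖ = 1 := by
  have h : ‖delta α‖ ^ 2 = 1 := by
    have h := inner_delta_self α
    rw [inner_self_eq_ofReal_norm_sq] at h
    exact_mod_cast h
  exact (pow_eq_one_iff_of_nonneg (norm_nonneg _) two_ne_zero).1 h

theorem inner_delta_left (α : I) (z : ell2 I) : ⟪delta α, z⟫_ℂ = z α := by
  classical
  rw [delta, lp.inner_single_left]
  simp

/-- The adjoint is also diagonal, with conjugate entries; pairing with δ^α then gives the
coordinates on every vector, without a basis expansion. -/
theorem diagonal_apply {D : ell2 I →L[ℂ] ell2 I} {d : I → ℂ}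
    (h : ∀ α, D (delta α) = d α • delta α) (z : ell2 I) (α : I) : D z α = d α * z α := by
  have h1 : D.adjoint (delta α) = starRingEnd ℂ (d α) • delta α := by
    refine isTotal_delta.eq_of_inner fun β => ?_
    rw [ContinuousLinearMap.adjoint_inner_left, h, inner_smul_right, inner_smul_left,
      Complex.conj_conj]
    by_cases hαβ : α = β
    · rw [hαβ]
    · rw [inner_delta_ne hαβ, mul_zero, mul_zero]
  rw [← inner_delta_left, ← ContinuousLinearMap.adjoint_inner_left, h1, inner_smul_left,
    inner_delta_left, Complex.conj_conj]

theorem norm_diagonal_le {D : ell2 I →L[ℂ] ell2 I} {d : I → ℂ}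
    (h : ∀ α, D (delta α) = d α • delta α) {c : ℝ} (hc : 0 ≤ c) (hd : ∀ α, ‖d α‖ ≤ c) :
    ‖D‖ ≤ c := by
  refine ContinuousLinearMap.opNorm_le_bound _ hc fun z => ?_
  refine lp.norm_le_of_forall_sum_le (by simp) (by positivity) fun s => ?_
  have hz := lp.sum_rpow_le_norm_rpow (p := 2) (by simp) z s
  simp only [ENNReal.toReal_ofNat, Real.rpow_ofNat] at hz ⊢
  calc ∑ i ∈ s, ‖D z i‖ ^ 2 ≤ ∑ i ∈ s, c ^ 2 * ‖z i‖ ^ 2 := by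
        refine Finset.sum_le_sum fun i _ => ?_
        rw [diagonal_apply h, norm_mul, mul_pow]
        gcongr
        exact hd i
    _ = c ^ 2 * ∑ i ∈ s, ‖z i‖ ^ 2 := by rw [Finset.mul_sum]
    _ ≤ c ^ 2 * ‖z‖ ^ 2 := by gcongr
    _ = (c * ‖z‖) ^ 2 := by ring

end Diagonal

/-- The closed left half-plane is convex and |exp'| is at most 1 on it. -/
theorem norm_exp_sub_exp_le {z w : ℂ} (hz : z.re ≤ 0) (hw : w.re ≤ 0) :
    ‖Complex.exp z - Complex.exp w‖ ≤ ‖z - w‖ := by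
  have h := (convex_halfSpace_re_le 0).norm_image_sub_le_of_norm_deriv_le (𝕜 := ℂ)
    (f := Complex.exp) (C := 1) (fun _ _ => Complex.differentiableAt_exp)
    (fun u hu => by
      rw [Complex.deriv_exp, Complex.norm_exp]
      exact Real.exp_le_one_iff.2 hu) hw hz
  rwa [one_mul] at h

/-! ### Associated semigroups of the Weyl process -/

section WeylSemigroups

variable {N I : Type*} [NormedAddCommGroup N] [InnerProductSpace ℂ N] (Γ : I → N)

/-- The exponent `-i Im ⟨c, y⟩ - χ(x, c + y)` of the associated semigroups of a Weyl process. -/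
def weylExponent (c x y : N) : ℂ := -(Complex.I * (⟪c, y⟫_ℂ).im) - chi x (c + y)

theorem re_chi {E : Type*} [NormedAddCommGroup E] [InnerProductSpace ℂ E] (u v : E) :
    (chi u v).re = ‖u - v‖ ^ 2 / 2 := by
  have h : ‖u - v‖ ^ 2 = ‖u‖ ^ 2 - 2 * (⟪u, v⟫_ℂ).re + ‖v‖ ^ 2 := norm_sub_sq (𝕜 := ℂ) u v
  rw [chi, Complex.sub_re, Complex.ofReal_re, h]
  ring

/-- The Weyl phase is unimodular, so only the overlap of exponential vectors contributes. The
formula serves both directions: it is never positive, and it tends to -∞ as ‖c‖ grows. -/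
theorem re_weylExponent (c x y : N) : (weylExponent c x y).re = -(‖x - (c + y)‖ ^ 2 / 2) := by
  rw [weylExponent, Complex.sub_re, re_chi]
  simp

theorem chi_ind (x y : N) (t : ℝ≥0) : chi (ind x t) (ind y t) = t * chi x y := by
  have hn : ∀ x : N, ‖ind x t‖ ^ 2 = t * ‖x‖ ^ 2 := fun x => by
    have h := inner_ind x x t
    rw [inner_self_eq_ofReal_norm_sq (ind x t), inner_self_eq_ofReal_norm_sq x] at h
    exact_mod_cast h
  rw [chi, chi, inner_ind, hn, hn]
  push_cast
  ring

theorem assocOp_weylProcess_delta (x y : N) (t : ℝ≥0) (α : I) :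
    assocOp (weylProcess Γ) x y t (delta α)
      = Complex.exp (t * weylExponent (Γ α) x y) • delta α := by
  rw [assocOp, slice_weylProcess_delta, weyl_coh', inner_smul_right, inner_coh, weylPhase,
    ← ind_add, chi_ind, inner_ind, ← Complex.exp_add, weylExponent]
  congr 2
  rw [show (((t : ℝ) : ℂ) * ⟪Γ α, y⟫_ℂ).im = t * (⟪Γ α, y⟫_ℂ).im by simp]
  push_cast
  ring

theorem isSemigroup_assocOp_weylProcess (x y : N) :
    IsSemigroup (assocOp (weylProcess Γ) x y) := by
  refine ⟨isTotal_delta.clm_ext fun α => ?_, fun s t => isTotal_delta.clm_ext fun α => ?_⟩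
  · rw [assocOp_weylProcess_delta]
    simp
  · change _ = assocOp (weylProcess Γ) x y s (assocOp (weylProcess Γ) x y t (delta α))
    rw [assocOp_weylProcess_delta, assocOp_weylProcess_delta, map_smul,
      assocOp_weylProcess_delta, smul_smul, ← Complex.exp_add, NNReal.coe_add]
    push_cast
    rw [add_mul, add_comm]

theorem bounded_of_continuous_assocOp {x y : N}
    (h : Continuous (assocOp (weylProcess Γ) x y)) : ∃ C : ℝ, ∀ α, ‖Γ α‖ ≤ C := by
  obtain ⟨δ, hδ, hd⟩ := Metric.continuousAt_iff.1 (h.continuousAt (x := 0)) (1 / 2) (by norm_num)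
  -- Any time in ]0,δ[ would do; at it the semigroup is within 1/2 of the identity in norm, so each
  -- eigenvalue has modulus above 1/2.
  obtain ⟨t, ht⟩ : ∃ t : ℝ≥0, (t : ℝ) = δ / 2 := ⟨⟨δ / 2, by positivity⟩, rfl⟩
  have ht0 : (0 : ℝ) < t := by rw [ht]; positivity
  have hdt := hd (x := t) (by
    rw [NNReal.dist_eq, NNReal.coe_zero, sub_zero, abs_of_pos ht0, ht]
    linarith)
  rw [dist_eq_norm, (isSemigroup_assocOp_weylProcess Γ x y).1] at hdt
  refine ⟨(2 / t + 1) + ‖x‖ + ‖y‖, fun α => ?_⟩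
  have h1 : ‖Complex.exp (t * weylExponent (Γ α) x y) - 1‖ < 1 / 2 := by
    have h2 := (assocOp (weylProcess Γ) x y t - 1).le_opNorm (delta α)
    rw [norm_delta, mul_one, sub_apply, assocOp_weylProcess_delta, one_apply_eq_self,
      show ∀ c : ℂ, c • delta α - delta α = (c - 1) • delta α from
        fun c => by rw [sub_smul, one_smul], norm_smul, norm_delta, mul_one] at h2
    exact h2.trans_lt hdt
  have h2 : 1 / 2 < ‖Complex.exp (t * weylExponent (Γ α) x y)‖ := by
    have h3 := norm_sub_norm_le (1 : ℂ) (1 - Complex.exp (t * weylExponent (Γ α) x y))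
    rw [norm_one, sub_sub_cancel, norm_sub_rev] at h3
    linarith
  rw [Complex.norm_exp, Complex.re_ofReal_mul, re_weylExponent] at h2
  set q := ‖x - (Γ α + y)‖ with hq
  have hexp : Real.exp (t * (q ^ 2 / 2)) < 2 := by
    have h4 := Real.exp_pos (t * (q ^ 2 / 2))
    rw [mul_neg, Real.exp_neg, one_div] at h2
    exact (inv_lt_inv₀ two_pos h4).1 h2
  -- From 1 + u ≤ exp u < 2.
  have h5 : t * (q ^ 2 / 2) < 1 := by
    linarith [Real.add_one_le_exp (t * (q ^ 2 / 2))]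
  have h6 : q ^ 2 ≤ 2 / t := by
    rw [le_div_iff₀ ht0]
    linarith
  -- Since (q - 1)² ≥ 0 and q ≥ 0, q ≤ 2q ≤ q² + 1, which avoids a square root in the bound.
  have h7 : q ≤ 2 / t + 1 := by nlinarith [sq_nonneg (q - 1), norm_nonneg (x - (Γ α + y))]
  calc ‖Γ α‖ = ‖x - y - (x - (Γ α + y))‖ := by congr 1; abel
    _ ≤ ‖x - y‖ + q := norm_sub_le _ _
    _ ≤ (‖x‖ + ‖y‖) + (2 / t + 1) := add_le_add (norm_sub_le _ _) h7
    _ = (2 / t + 1) + ‖x‖ + ‖y‖ := by ring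

theorem norm_weylExponent_le (c x y : N) :
    ‖weylExponent c x y‖
      ≤ ‖c‖ * ‖y‖ + ((‖x‖ ^ 2 + (‖c‖ + ‖y‖) ^ 2) / 2 + ‖x‖ * (‖c‖ + ‖y‖)) := by
  have h1 : ‖c + y‖ ≤ ‖c‖ + ‖y‖ := norm_add_le c y
  have h2 : ‖-(Complex.I * ((⟪c, y⟫_ℂ).im : ℂ))‖ ≤ ‖c‖ * ‖y‖ := by
    rw [norm_neg, norm_mul, Complex.norm_I, one_mul, Complex.norm_real]
    exact (Complex.abs_im_le_norm _).trans (norm_inner_le_norm _ _)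
  have h3 : ‖chi x (c + y)‖ ≤ (‖x‖ ^ 2 + (‖c‖ + ‖y‖) ^ 2) / 2 + ‖x‖ * (‖c‖ + ‖y‖) := by
    rw [chi]
    refine (norm_sub_le _ _).trans (add_le_add ?_ ?_)
    · rw [Complex.norm_real, Real.norm_of_nonneg (by positivity)]
      gcongr
    · exact (norm_inner_le_norm _ _).trans (by gcongr)
  exact (norm_sub_le _ _).trans (add_le_add h2 h3)

theorem continuous_assocOp_of_bounded (x y : N) {C : ℝ} (hC : ∀ α, ‖Γ α‖ ≤ C) :
    Continuous (assocOp (weylProcess Γ) x y) := by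
  obtain ⟨M, hM⟩ : ∃ M : ℝ, ∀ α, ‖weylExponent (Γ α) x y‖ ≤ M := by
    -- The bound of `norm_weylExponent_le` is increasing in ‖c‖, so ‖c‖ is replaced by |C|. The
    -- absolute value matters when the index set is empty, as `C` may then be negative.
    refine ⟨|C| * ‖y‖ + ((‖x‖ ^ 2 + (|C| + ‖y‖) ^ 2) / 2 + ‖x‖ * (|C| + ‖y‖)), fun α => ?_⟩
    have h := (hC α).trans (le_abs_self C)
    refine (norm_weylExponent_le _ _ _).trans ?_
    gcongr
  have hre : ∀ (t : ℝ≥0) α, ((t : ℂ) * weylExponent (Γ α) x y).re ≤ 0 := fun t α => by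
    rw [Complex.re_ofReal_mul, re_weylExponent]
    exact mul_nonpos_of_nonneg_of_nonpos t.2 (neg_nonpos.2 (by positivity))
  refine LipschitzWith.continuous (K := Real.toNNReal |M|) (LipschitzWith.of_dist_le_mul
    fun s t => ?_)
  rw [dist_eq_norm, Real.coe_toNNReal _ (abs_nonneg M)]
  refine norm_diagonal_le (d := fun α => Complex.exp (s * weylExponent (Γ α) x y)
    - Complex.exp (t * weylExponent (Γ α) x y)) (fun α => ?_) (by positivity) fun α => ?_
  · rw [sub_apply, assocOp_weylProcess_delta, assocOp_weylProcess_delta, sub_smul]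
  · refine (norm_exp_sub_exp_le (hre s α) (hre t α)).trans ?_
    rw [← sub_mul, norm_mul, mul_comm, NNReal.dist_eq, ← Complex.ofReal_sub, Complex.norm_real,
      Real.norm_eq_abs]
    gcongr
    exact (hM α).trans (le_abs_self M)

end WeylSemigroups

/-! ### Quantum stochastic cocycles in terms of slices at exponential vectors -/

section CocycleSlices

variable {N H H' : Type*} [NormedAddCommGroup N] [InnerProductSpace ℂ N]
  [NormedAddCommGroup H] [InnerProductSpace ℂ H] [CompleteSpace H]
  [NormedAddCommGroup H'] [InnerProductSpace ℂ H'] [CompleteSpace H']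
  {V : Submodule ℂ (H →L[ℂ] H')}
  {k : ℝ≥0 → V →ₗ[ℂ] (H ⊗ₕ NoiseFock N →L[ℂ] H' ⊗ₕ NoiseFock N)}

/-- The cocycle identity in coordinates: the future slice of k_t(a) is an element of V, to which k_r
is applied before slicing over the past. -/
theorem IsQSCocycle.slice_coh_join (hk : IsQSCocycle V k) (r t : ℝ≥0) (a : V)
    (f f' : L2On N (Set.Ico (0 : ℝ) r)) (g g' : L2On N (Set.Ici 0)) :
    slice (coh (join r f g)) (coh (join r f' g')) (k (r + t) a)
      = slice (coh (inclL2 (Ico_sub r) f)) (coh (inclL2 (Ico_sub r) f'))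
          (k r (entry V (coh g) (coh g') ⟨k t a, hk.mem t a⟩)) :=
  (congrArg (fun A => slice _ _ A) (hk.cocycle r t a)).trans
    (slice_hat_shiftMS r (hk.cb r) ⟨k t a, hk.mem t a⟩ f f' g g')

/-- Constant functions split at time `r` into constant functions, so the sliced cocycle identity
becomes composition. It applies in particular to the vacuum slices of the perturbed cocycle. -/
theorem IsQSCocycle.isSemigroup_assocMap (hk : IsQSCocycle V k) (x y : N) :
    IsSemigroup (hk.toIsQSProcess.assocMap x y) := by
  refine ⟨LinearMap.ext fun a => Subtype.ext ?_, fun r t => LinearMap.ext fun a => Subtype.ext ?_⟩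
  · change slice (coh (ind x 0)) (coh (ind y 0)) (k 0 a) = a
    rw [hk.zero, slice_opTensor_id, ind_zero, ind_zero, inner_coh_self, one_smul]
  · change slice (coh (ind x (r + t))) (coh (ind y (r + t))) (k (r + t) a) = _
    rw [ind_add_time, ind_add_time]
    exact hk.slice_coh_join r t a (indIco x r) (indIco y r) (ind x t) (ind y t)

end CocycleSlices

/-! ### Perturbation of a cocycle by a Weyl process -/

section Perturbation

variable {H H' : Type*}
  [NormedAddCommGroup H] [InnerProductSpace ℂ H] [CompleteSpace H]
  [NormedAddCommGroup H'] [InnerProductSpace ℂ H'] [CompleteSpace H']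

theorem slice_of_eq_smul {K L : Type*} [NormedAddCommGroup K] [InnerProductSpace ℂ K]
    [NormedAddCommGroup L] [InnerProductSpace ℂ L] {c d : ℂ} {x x' : L} {y y' : K}
    (hx : x = c • x') (hy : y = d • y') (T : H ⊗ₕ K →L[ℂ] H' ⊗ₕ L) :
    slice x y T = (starRingEnd ℂ c * d) • slice x' y' T := by
  rw [hx, hy, slice_smul_left, slice_smul_right, smul_smul]

theorem ampliate_tmul {E F : Type*} [NormedAddCommGroup E] [InnerProductSpace ℂ E]
    [CompleteSpace E] [NormedAddCommGroup F] [InnerProductSpace ℂ F]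
    {S : E ⊗ₕ F →L[ℂ] E ⊗ₕ F} {e e' : E} {x x' : F} (hS : S (tmul e x) = tmul e' x') (v : H) :
    ampliate H S (tmul (tmul v e) x) = tmul (tmul v e') x' := by
  change (assoc H E F).toContinuousLinearMap.adjoint (opTensor (ContinuousLinearMap.id ℂ H) S
    (assoc H E F (tmul (tmul v e) x))) = _
  rw [assoc_tmul, opTensor_tmul, hS, ContinuousLinearMap.id_apply, ← assoc_tmul,
    adjoint_linearIsometry_apply]

/-- The tensor flip merely interchanges the order of slicing over the two factors. -/
theorem slice_slice_flip {K E : Type*} [NormedAddCommGroup K] [InnerProductSpace ℂ K]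
    [CompleteSpace K] [NormedAddCommGroup E] [InnerProductSpace ℂ E] [CompleteSpace E]
    (L : (H ⊗ₕ K) ⊗ₕ E →L[ℂ] (H' ⊗ₕ K) ⊗ₕ E) (e d : E) (x y : K) :
    slice e d (slice x y (transport (flip H' K E) (flip H K E) L))
      = slice x y (slice e d L) := by
  refine clm_ext_inner fun v' v => ?_
  rw [inner_slice, inner_slice, inner_slice, inner_slice, ← flip_tmul v' x e, ← flip_tmul v y d,
    inner_transport]

theorem slice_slice_sandwich_ampliate {E F : Type*} [NormedAddCommGroup E]
    [InnerProductSpace ℂ E] [CompleteSpace E] [NormedAddCommGroup F] [InnerProductSpace ℂ F]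
    {S : E ⊗ₕ F →L[ℂ] E ⊗ₕ F} {e e' d d' : E} {x x' y y' : F}
    (he : S (tmul e x) = tmul e' x') (hd : S (tmul d y) = tmul d' y')
    (T : (H ⊗ₕ E) ⊗ₕ F →L[ℂ] (H' ⊗ₕ E) ⊗ₕ F) :
    slice e d (slice x y (sandwich (ampliate H' S).adjoint (ampliate H S) T))
      = slice e' d' (slice x' y' T) := by
  refine clm_ext_inner fun v' v => ?_
  rw [inner_slice, inner_slice, inner_slice, inner_slice]
  change ⟪_, (ampliate H' S).adjoint (T (ampliate H S _))⟫_ℂ = _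
  rw [ContinuousLinearMap.adjoint_inner_right, ampliate_tmul he, ampliate_tmul hd]

variable {N I : Type*} [NormedAddCommGroup N] [InnerProductSpace ℂ N] (Γ : I → N)
  {V : Submodule ℂ (H →L[ℂ] H')}
  {k : ℝ≥0 → V →ₗ[ℂ] (H ⊗ₕ NoiseFock N →L[ℂ] H' ⊗ₕ NoiseFock N)}

/-- Conjugation by W^Γ moves Weyl operators onto the slicing vectors, the flip exchanges the slices,
and the defining property of the lifting isolates one matrix entry. This reduces every property of
K^Γ to one of k. -/
theorem slice_slice_perturbedLift (hk : IsQSProcess V k) (t : ℝ≥0) (A : matrixSpace V (ell2 I))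
    (α β : I) (ξ η : NoiseFock N) :
    slice (delta α) (delta β) (slice ξ η (perturbedLift Γ k t A))
      = slice (weyl (ind (Γ α) t) ξ) (weyl (ind (Γ β) t) η)
          (k t (entry V (delta α) (delta β) A)) :=
  (slice_slice_sandwich_ampliate (weylProcess_tmul Γ t α ξ) (weylProcess_tmul Γ t β η) _).trans
    ((slice_slice_flip (lift (k t) (ell2 I) A) (delta α) (delta β) _ _).trans
      (congrArg (fun T => slice _ _ T) (lift_spec (k t) (hk.cb t) (delta α) (delta β) A)))

theorem isCompletelyBounded_perturbedLift (hk : IsQSProcess V k) (t : ℝ≥0) :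
    IsCompletelyBounded (perturbedLift Γ k t) :=
  (((hk.cb t).lift (K := ell2 I)).sandwich _ _).sandwich _ _

/-- Only the slices at basis vectors of l²(I) are accessible directly; closedness of V extends
membership to all slices. -/
theorem perturbedLift_mem (hV : IsClosed (V : Set (H →L[ℂ] H'))) (hk : IsQSProcess V k)
    (t : ℝ≥0) (A : matrixSpace V (ell2 I)) :
    perturbedLift Γ k t A ∈ matrixSpace (matrixSpace V (ell2 I)) (NoiseFock N) := by
  intro ξ η
  refine mem_matrixSpace_of_isTotal hV isTotal_delta fun α β => ?_
  exact Eq.mpr (congrArg (· ∈ V) (slice_slice_perturbedLift Γ hk t A α β ξ η)) (hk.mem t _ _ _)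

theorem isAdapted_perturbedLift (hV : IsClosed (V : Set (H →L[ℂ] H'))) (hk : IsQSProcess V k)
    (t : ℝ≥0) (A : matrixSpace V (ell2 I)) :
    IsAdapted (matrixSpace V (ell2 I)) t (perturbedLift Γ k t A) := by
  refine isAdapted_of_slice_coh_join (perturbedLift_mem Γ hV hk t A) fun f f' g g' => ?_
  refine ext_slice_of_isTotal isTotal_delta isTotal_delta fun α β => ?_
  refine (slice_slice_perturbedLift Γ hk t A α β _ _).trans ?_
  refine (slice_of_eq_smul (weyl_ind_coh_join _ _ _ _) (weyl_ind_coh_join _ _ _ _) _).trans ?_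
  refine Eq.trans ?_ (slice_smul _ _ _ _).symm
  refine Eq.trans ?_ (congrArg (fun T : H →L[ℂ] H' => ⟪coh g, coh g'⟫_ℂ • T)
    (slice_slice_perturbedLift Γ hk t A α β _ _)).symm
  refine Eq.trans ?_ (congrArg (fun T : H →L[ℂ] H' => ⟪coh g, coh g'⟫_ℂ • T)
    (slice_of_eq_smul (weyl_ind_coh_inclL2 _ _ _) (weyl_ind_coh_inclL2 _ _ _) _)).symm
  -- The Weyl phases at the join and at its past part coincide, so adaptedness of k yields the
  -- factorisation up to commuting scalars.
  refine (congrArg (fun T : H →L[ℂ] H' => _ • T)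
    ((hk.adapted t (entry V (delta α) (delta β) A)).slice_coh_join _ _ _ _)).trans ?_
  exact smul_comm _ _ _

theorem perturbedLift_zero (hk : IsQSCocycle V k) (A : matrixSpace V (ell2 I)) :
    perturbedLift Γ k 0 A = opTensor (A : H ⊗ₕ ell2 I →L[ℂ] H' ⊗ₕ ell2 I)
      (ContinuousLinearMap.id ℂ (NoiseFock N)) := by
  refine ext_slice fun ξ η => ext_slice_of_isTotal isTotal_delta isTotal_delta fun α β => ?_
  refine (slice_slice_perturbedLift Γ hk.toIsQSProcess 0 A α β ξ η).trans ?_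
  rw [ind_zero, ind_zero, weyl_zero, weyl_zero, hk.zero, slice_opTensor_id, slice_opTensor_id]
  exact (slice_smul _ _ _ _).symm

theorem isQSProcess_perturbedLift (hV : IsClosed (V : Set (H →L[ℂ] H')))
    (hk : IsQSProcess V k) : IsQSProcess (matrixSpace V (ell2 I)) (perturbedLift Γ k) where
  cb := isCompletelyBounded_perturbedLift Γ hk
  mem := perturbedLift_mem Γ hV hk
  adapted := isAdapted_perturbedLift Γ hV hk

/-- This is the form in which a slice of K^Γ_t(A) enters k_r: an element of V, with the phases of
the interval [0,t[ as a scalar that linearity can extract. -/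
theorem entry_entry_perturbedLift (hV : IsClosed (V : Set (H →L[ℂ] H'))) (hk : IsQSProcess V k)
    (t : ℝ≥0) (A : matrixSpace V (ell2 I)) (α β : I) (g g' : L2On N (Set.Ici 0)) :
    entry V (delta α) (delta β) (entry (matrixSpace V (ell2 I)) (coh g) (coh g')
        ⟨perturbedLift Γ k t A, perturbedLift_mem Γ hV hk t A⟩)
      = (starRingEnd ℂ (weylPhase (ind (Γ α) t) g) * weylPhase (ind (Γ β) t) g') •
        entry V (coh (ind (Γ α) t + g)) (coh (ind (Γ β) t + g'))
          ⟨k t (entry V (delta α) (delta β) A), hk.mem t _⟩ := by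
  refine Subtype.ext ((slice_slice_perturbedLift Γ hk t A α β _ _).trans ?_)
  exact slice_of_eq_smul (weyl_coh' _ _) (weyl_coh' _ _) _

/-- The Weyl perturbation of the lifting of a cocycle is a cocycle. -/
theorem isQSCocycle_perturbedLift (hV : IsClosed (V : Set (H →L[ℂ] H')))
    (hk : IsQSCocycle V k) : IsQSCocycle (matrixSpace V (ell2 I)) (perturbedLift Γ k) where
  toIsQSProcess := isQSProcess_perturbedLift Γ hV hk.toIsQSProcess
  zero := perturbedLift_zero Γ hk
  cocycle r t A := by
    have hP := hk.toIsQSProcess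
    refine ext_slice_coh_join r fun f g f' g' => ?_
    refine Eq.trans ?_ (slice_hat_shiftMS r (isCompletelyBounded_perturbedLift Γ hP r)
      ⟨_, perturbedLift_mem Γ hV hP t A⟩ f f' g g').symm
    refine ext_slice_of_isTotal isTotal_delta isTotal_delta fun α β => ?_
    refine (slice_slice_perturbedLift Γ hP (r + t) A α β _ _).trans ?_
    refine Eq.trans ?_ (slice_slice_perturbedLift Γ hP r _ α β _ _).symm
    -- On the left the phases for time r+t come out together. On the right those for `r` come from
    -- the outer slice and those for `t` from inside k_r.
    refine (slice_of_eq_smul (weyl_ind_add_coh_join _ _ _ _ _)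
      (weyl_ind_add_coh_join _ _ _ _ _) _).trans ?_
    refine Eq.trans ?_
      (slice_of_eq_smul (weyl_ind_coh_inclL2 _ _ _) (weyl_ind_coh_inclL2 _ _ _) _).symm
    refine (congrArg (fun T : H →L[ℂ] H' => _ • T) (hk.slice_coh_join r t _ _ _ _ _)).trans ?_
    refine Eq.trans ?_ (congrArg (fun a : V => _ • slice _ _ (k r a))
      (entry_entry_perturbedLift Γ hV hP t A α β g g')).symm
    refine Eq.trans ?_ (congrArg (fun T : H →L[ℂ] H' => _ • T)
      ((congrArg (fun T => slice _ _ T) ((k r).map_smul _ _)).trans (slice_smul _ _ _ _))).symm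
    -- Both sides now carry the same four phases, two of them conjugated; conjugation is
    -- multiplicative, and commutativity does the rest.
    refine Eq.trans (congrArg (fun c : ℂ => c • _) ?_) (smul_smul _ _ _).symm
    rw [map_mul]
    ring

/-- The expectation semigroup of the perturbed lifting has Schur action. -/
theorem entry_assocMap_perturbedLift (hk : IsQSProcess V k)
    (hK : IsQSProcess (matrixSpace V (ell2 I)) (perturbedLift Γ k)) (t : ℝ≥0)
    (A : matrixSpace V (ell2 I)) (α β : I) :
    entry V (delta α) (delta β) (hK.assocMap 0 0 t A)
      = hk.assocMap (Γ α) (Γ β) t (entry V (delta α) (delta β) A) := by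
  -- A Weyl operator sends the vacuum to the exponential vector of its function with trivial phase,
  -- so the slices defining 𝒫^{Γ(α),Γ(β)} appear.
  have h : ∀ x : N, weyl (ind x t) (coh (ind (0 : N) t)) = coh (ind x t) := fun x => by
    rw [weyl_coh', ind_zero_left, weylPhase, inner_zero_right, add_zero]
    simp
  refine Subtype.ext ((slice_slice_perturbedLift Γ hk t A α β _ _).trans ?_)
  rw [h, h]
  rfl

end Perturbation

end QS

end

/-! ### The proposition -/

theorem proposition4p9 {N H H' I : Type*}
    [NormedAddCommGroup N] [InnerProductSpace ℂ N] [CompleteSpace N]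
    [NormedAddCommGroup H] [InnerProductSpace ℂ H] [CompleteSpace H]
    [NormedAddCommGroup H'] [InnerProductSpace ℂ H'] [CompleteSpace H']
    (Γ : I → N)
    (V : Submodule ℂ (H →L[ℂ] H')) (hV : IsClosed (V : Set (H →L[ℂ] H')))
    (k : ℝ≥0 → V →ₗ[ℂ] (QS.HTensor H (QS.NoiseFock N) →L[ℂ] QS.HTensor H' (QS.NoiseFock N)))
    (hk : QS.IsQSCocycle V k) :
    -- `W^Γ` is a unitary process
    (∀ t : ℝ≥0, QS.weylProcess Γ t ∈
      unitary (QS.HTensor (QS.ell2 I) (QS.NoiseFock N) →L[ℂ]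
        QS.HTensor (QS.ell2 I) (QS.NoiseFock N))) ∧
    -- (a) it is a strongly continuous left cocycle
    (QS.IsLeftOpCocycle (QS.weylProcess Γ) ∧
      ∀ ξ : QS.HTensor (QS.ell2 I) (QS.NoiseFock N),
        Continuous fun t : ℝ≥0 => QS.weylProcess Γ t ξ) ∧
    -- (b) it is a right cocycle
    QS.IsRightOpCocycle (QS.weylProcess Γ) ∧
    -- (c) each associated semigroup is norm continuous if and only if `Γ` is bounded
    (∀ x y : N, QS.IsSemigroup (QS.assocOp (QS.weylProcess Γ) x y) ∧
      (Continuous (QS.assocOp (QS.weylProcess Γ) x y) ↔ ∃ C : ℝ, ∀ α, ‖Γ α‖ ≤ C)) ∧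
    -- (d) `K^Γ` is a cocycle whose expectation semigroup is the Schur-action semigroup
    -- with components `𝒫^{Γ(α),Γ(β)}`
    ∃ hK : QS.IsQSCocycle (QS.matrixSpace V (QS.ell2 I)) (QS.perturbedLift Γ k),
      QS.IsSemigroup (hK.toIsQSProcess.assocMap 0 0) ∧
      ∀ (t : ℝ≥0) (A : QS.matrixSpace V (QS.ell2 I)) (α β : I),
        QS.entry V (QS.delta α) (QS.delta β) (hK.toIsQSProcess.assocMap 0 0 t A)
          = hk.toIsQSProcess.assocMap (Γ α) (Γ β) t
              (QS.entry V (QS.delta α) (QS.delta β) A) := by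
  have hKc := QS.isQSCocycle_perturbedLift Γ hV hk
  exact ⟨QS.weylProcess_mem_unitary Γ,
    ⟨QS.isLeftOpCocycle_weylProcess Γ, QS.continuous_weylProcess_apply Γ⟩,
    QS.isRightOpCocycle_weylProcess Γ,
    fun x y => ⟨QS.isSemigroup_assocOp_weylProcess Γ x y, QS.bounded_of_continuous_assocOp Γ,
      fun ⟨_, hC⟩ => QS.continuous_assocOp_of_bounded Γ x y hC⟩,
    hKc, hKc.isSemigroup_assocMap 0 0,
    QS.entry_assocMap_perturbedLift Γ hk.toIsQSProcess hKc.toIsQSProcess⟩
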